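/- Let $(M,g)$ be a smooth Riemannian manifold of dimension $m$ with Levi-Civita connection $\nabla$ and curvature $R(X,Y)Z=\nabla_X\nabla_YZ-\nabla_Y\nabla_XZ-\nabla_{[X,Y]}Z$. For $P\in M$ and $\xi\in T_PM$ near $0$ write $\exp_P^*\,\mathrm{dvol}=\tilde\Theta(P;\xi)\,d\xi$, where $d\xi$ is the measure on $T_PM$ given by its inner product, and expand $\tilde\Theta$ in its Taylor series at $\xi=0$, $$\tilde\Theta(P;\xi)\sim 1+\sum_{k\ge 1}\mathcal H_k(P;\xi),$$ with $\mathcal H_k(P;\cdot)$ homogeneous of degree $k$; that is, $\mathcal H_k(P;\xi)$ is the coefficient of $t^k$ in the Taylor series at $t=0$ of the function $t\mapsto\tilde\Theta(P;t\xi)$, which is smooth near $t=0$. Let $\mathcal J_k(\xi)$ be the endomorphism of $T_PM$ given by $\mathcal J_k(\xi)\eta=(\nabla^k_{\xi\cdots\xi}R)(\eta,\xi)\xi$, and let $\mathcal J=\mathcal J_0$ be the Jacobi operator. Theorem 1.4. Suppose that $(M,g)$ is a harmonic space, i.e. that near the origin of each tangent space $\tilde\Theta(P;\xi)$ depends only on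 $P$ and $\|\xi\|$. Then for all $P\in M$ and $\xi\in T_PM$ one has $\mathcal H_{2k+1}(\xi)=0$ for all $k\ge 0$, and 1. $\displaystyle \mathcal H_2(\xi)=-\tfrac16\operatorname{Tr}\{\mathcal J(\xi)\}$; 2. $\displaystyle \mathcal H_4(\xi)=\tfrac1{72}\operatorname{Tr}\{\mathcal J(\xi)\}^2-\tfrac1{180}\operatorname{Tr}\{\mathcal J(\xi)^2\}$; 3. $\displaystyle \mathcal H_6(\xi)=-\frac{\operatorname{Tr}\{\mathcal J(\xi)\}^3}{1296}+\frac{\operatorname{Tr}\{\mathcal J(\xi)\}\operatorname{Tr}\{\mathcal J(\xi)^2\}}{1080}-\frac{\operatorname{Tr}\{\mathcal J(\xi)^3\}}{2835}+\frac{\operatorname{Tr}\{\mathcal J_1(\xi)^2\}}{10080}$; 4. $\displaystyle \mathcal H_8(\xi)=\frac{\operatorname{Tr}\{\mathcal J(\xi)\}^4}{31104}-\frac{\operatorname{Tr}\{\mathcal J(\xi)\}^2\operatorname{Tr}\{\mathcal J(\xi)^2\}}{12960}+\frac{\operatorname{Tr}\{\mathcal J(\xi)\}\operatorname{Tr}\{\mathcal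 J(\xi)^3\}}{17010}-\frac{\operatorname{Tr}\{\mathcal J(\xi)\}\operatorname{Tr}\{\mathcal J_1(\xi)^2\}}{60480}+\frac{\operatorname{Tr}\{\mathcal J(\xi)^2\}^2}{64800}-\frac{\operatorname{Tr}\{\mathcal J(\xi)^4\}}{37800}-\frac{\operatorname{Tr}\{\mathcal J(\xi)^2\mathcal J_2(\xi)\}}{340200}+\frac{\operatorname{Tr}\{\mathcal J(\xi)\mathcal J_1(\xi)^2\}}{54432}-\frac{\operatorname{Tr}\{\mathcal J_2(\xi)^2\}}{907200}$. -/

import Mathlib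

open scoped Manifold ContDiff

noncomputable section

namespace HarmonicSpace

/-! ### Riemannian geometry in an open set of a coordinate space

A metric in coordinates is a function `G` sending a point `y` of the coordinate space `E` to the
bilinear form `G y` with matrix `(g_ij (y))`. -/

section Coordinates

variable {E : Type*} [NormedAddCommGroup E] [NormedSpace ℝ E]

/-- The Christoffel symbols of the Levi-Civita connection, as the vector
`Γ(u, v) = ∇_u v` for constant (coordinate) fields `u`, `v`.  It is determined by the Koszul formula
`G (Γ(u, v), w) = (∂_u G (v, w) + ∂_v G (u, w) - ∂_w G (u, v)) / 2` for all `w`. -/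
def christoffel (G : E → E →L[ℝ] E →L[ℝ] ℝ) (y u v : E) : E :=
  (G y).inverse
    ((1 / 2 : ℝ) • (fderiv ℝ G y u v + fderiv ℝ G y v u - ((fderiv ℝ G y).flip u).flip v))

/-- The curvature `R(u, v) w = ∇_u ∇_v w - ∇_v ∇_u w - ∇_[u, v] w` in coordinates. -/
def curvature (G : E → E →L[ℝ] E →L[ℝ] ℝ) (y u v w : E) : E :=
  fderiv ℝ (fun z => christoffel G z v w) y u - fderiv ℝ (fun z => christoffel G z u w) y v
    + christoffel G y u (christoffel G y v w) - christoffel G y v (christoffel G y u w)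

/-- The covariant derivative of a vector valued tensor field `T` with `n` arguments, the direction
of differentiation being put in the last slot:
`(∇T)(w₁, …, wₙ; v) = ∇_v (T(w₁, …, wₙ)) - ∑ i, T(w₁, …, ∇_v wᵢ, …, wₙ)`
for constant fields `w₁, …, wₙ, v`. -/
def covDeriv (G : E → E →L[ℝ] E →L[ℝ] ℝ) {n : ℕ} (T : E → (Fin n → E) → E) (y : E)
    (w : Fin (n + 1) → E) : E :=
  fderiv ℝ (fun z => T z (Fin.init w)) y (w (Fin.last n))
    + christoffel G y (w (Fin.last n)) (T y (Fin.init w))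
    - ∑ i : Fin n, T y (Function.update (Fin.init w) i
        (christoffel G y (w (Fin.last n)) (Fin.init w i)))

/-- The iterated covariant derivative `∇ᵏR` of the curvature, as a vector valued tensor field with
`3 + k` arguments: the three arguments of `R(u, v) w`, then the `k` directions. -/
def iterCovDerivCurvature (G : E → E →L[ℝ] E →L[ℝ] ℝ) : (k : ℕ) → E → (Fin (3 + k) → E) → E
  | 0 => fun y w => curvature G y (w 0) (w 1) (w 2)
  | k + 1 => covDeriv G (iterCovDerivCurvature G k)

/-- `c`, with velocity `c'`, is a geodesic `[0, 1] → U`, i.e. `c'' + Γ(c', c') = 0`. -/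
def IsCoordGeodesic (G : E → E →L[ℝ] E →L[ℝ] ℝ) (U : Set E) (c c' : ℝ → E) : Prop :=
  ∀ t ∈ Set.Icc (0 : ℝ) 1, c t ∈ U ∧
    HasDerivWithinAt c (c' t) (Set.Icc 0 1) t ∧
    HasDerivWithinAt c' (-christoffel G (c t) (c' t) (c' t)) (Set.Icc 0 1) t

open Classical in
/-- The exponential map in coordinates: the value at time `1` of the geodesic in `U` which starts at
`x` with velocity `v`.  (If there is none, the value is irrelevant; for `x` in the open set `U` the
geodesic exists for all `v` close to `0`.) -/
def coordExp (G : E → E →L[ℝ] E →L[ℝ] ℝ) (U : Set E) (x v : E) : E :=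
  if h : ∃ c : ℝ → E, ∃ c' : ℝ → E, c 0 = x ∧ c' 0 = v ∧ IsCoordGeodesic G U c c'
  then h.choose 1 else x

end Coordinates

/-! ### Riemannian manifolds

`M` is a smooth manifold of dimension `m` and `g` a smooth Riemannian metric on it.  Mathlib
identifies the tangent space at `P` with `EuclideanSpace ℝ (Fin m)` through the preferred chart
at `P`; the objects at `P` are computed in that chart. -/

section Manifold

variable {m : ℕ} {M : Type*} [TopologicalSpace M] [ChartedSpace (EuclideanSpace ℝ (Fin m)) M]
  [IsManifold (𝓡 m) ∞ M]

/-- The coordinate expression of `g` in the preferred chart `φ` at `P`: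
the pullback of `g` under `φ⁻¹`. -/
def coordMetric
    (g : Bundle.ContMDiffRiemannianMetric (𝓡 m) ∞ (EuclideanSpace ℝ (Fin m))
      (fun x : M => TangentSpace (𝓡 m) x)) (P : M) (y : EuclideanSpace ℝ (Fin m)) :
    EuclideanSpace ℝ (Fin m) →L[ℝ] EuclideanSpace ℝ (Fin m) →L[ℝ] ℝ :=
  let B : EuclideanSpace ℝ (Fin m) →L[ℝ] EuclideanSpace ℝ (Fin m) →L[ℝ] ℝ :=
    g.inner ((extChartAt (𝓡 m) P).symm y)
  let A : EuclideanSpace ℝ (Fin m) →L[ℝ] EuclideanSpace ℝ (Fin m) :=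
    mfderiv (𝓡 m) (𝓡 m) (extChartAt (𝓡 m) P).symm y
  B.bilinearComp A A

/-- The exponential map `exp_P`, on the vectors `v` whose geodesic stays in the domain of the
preferred chart at `P`; these form a neighbourhood of `0`, and only the germ of `exp_P` at `0` is
used. -/
def riemannianExp
    (g : Bundle.ContMDiffRiemannianMetric (𝓡 m) ∞ (EuclideanSpace ℝ (Fin m))
      (fun x : M => TangentSpace (𝓡 m) x)) (P : M) (v : TangentSpace (𝓡 m) P) : M :=
  (extChartAt (𝓡 m) P).symm
    (coordExp (coordMetric g P) (extChartAt (𝓡 m) P).target (extChartAt (𝓡 m) P P) v)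

/-- The `i`-th vector of the coordinate basis of the tangent space. -/
def stdVec (i : Fin m) : EuclideanSpace ℝ (Fin m) := EuclideanSpace.single i 1

/-- The volume density `Θ̃(P; ξ)`, defined by `exp_P^* dvol = Θ̃(P; ξ) dξ`, where `dξ` is the measure
on the tangent space at `P` given by its inner product.  With respect to the coordinate measure,
`exp_P^* dvol` has density `√det ((exp_P^* g)_ij)` and `dξ` has density `√det (g_ij (P))`. -/
def density
    (g : Bundle.ContMDiffRiemannianMetric (𝓡 m) ∞ (EuclideanSpace ℝ (Fin m))
      (fun x : M => TangentSpace (𝓡 m) x)) (P : M) (ξ : TangentSpace (𝓡 m) P) : ℝ :=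
  √(Matrix.det (Matrix.of fun i j : Fin m =>
      g.inner (riemannianExp g P ξ)
        (mfderiv (𝓡 m) (𝓡 m)
          (fun w : EuclideanSpace ℝ (Fin m) => riemannianExp g P w) ξ (stdVec i))
        (mfderiv (𝓡 m) (𝓡 m)
          (fun w : EuclideanSpace ℝ (Fin m) => riemannianExp g P w) ξ (stdVec j)))) /
  √(Matrix.det (Matrix.of fun i j : Fin m => g.inner P (stdVec i) (stdVec j)))

/-- `M` is a harmonic space: near the origin of each tangent space, the volume density
`Θ̃(P; ξ)` depends only on `P` and on the length of `ξ`. -/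
def IsHarmonicSpace
    (g : Bundle.ContMDiffRiemannianMetric (𝓡 m) ∞ (EuclideanSpace ℝ (Fin m))
      (fun x : M => TangentSpace (𝓡 m) x)) : Prop :=
  ∀ P : M, ∃ ε : ℝ, 0 < ε ∧ ∃ f : ℝ → ℝ, ∀ ξ : TangentSpace (𝓡 m) P,
    √(g.inner P ξ ξ) < ε → density g P ξ = f √(g.inner P ξ ξ)

/-- The homogeneous term `H_k(P; ξ)` of degree `k` of the Taylor series
`Θ̃(P; ξ) ∼ ∑ k, H_k(P; ξ)` at `ξ = 0`, that is the coefficient of `tᵏ` in the Taylor series of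
`Θ̃(P; tξ)` at `t = 0`. -/
def taylorTerm
    (g : Bundle.ContMDiffRiemannianMetric (𝓡 m) ∞ (EuclideanSpace ℝ (Fin m))
      (fun x : M => TangentSpace (𝓡 m) x)) (k : ℕ) (P : M) (ξ : TangentSpace (𝓡 m) P) : ℝ :=
  iteratedDeriv k (fun t : ℝ => density g P (t • ξ)) 0 / (k.factorial : ℝ)

/-- The endomorphism `J_k(ξ)` of the tangent space at `P` with
`g(J_k(ξ) η, ζ) = (∇ᵏR)(η, ξ, ξ, ζ; ξ, …, ξ)`, that is `J_k(ξ) η = (∇ᵏR)(η, ξ) ξ` with all directions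
of differentiation equal to `ξ`; it is given by its values on the coordinate basis. `J_0(ξ)` is
the Jacobi operator `η ↦ R(η, ξ) ξ`. -/
def jacobiOperator
    (g : Bundle.ContMDiffRiemannianMetric (𝓡 m) ∞ (EuclideanSpace ℝ (Fin m))
      (fun x : M => TangentSpace (𝓡 m) x)) (k : ℕ) (P : M) (ξ : TangentSpace (𝓡 m) P) :
    Module.End ℝ (TangentSpace (𝓡 m) P) :=
  (EuclideanSpace.basisFun (Fin m) ℝ).toBasis.constr ℝ fun j =>
    iterCovDerivCurvature (E := EuclideanSpace ℝ (Fin m)) (coordMetric g P) k (extChartAt (𝓡 m) P P)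
      (fun i : Fin (3 + k) => if i.val = 0 then stdVec j else ξ)

/-- The trace of an endomorphism of the tangent space at `P`. -/
abbrev Tr {P : M} (A : Module.End ℝ (TangentSpace (𝓡 m) P)) : ℝ :=
  LinearMap.trace ℝ (TangentSpace (𝓡 m) P) A

end Manifold

end HarmonicSpace

end

/-! # The Taylor coefficients of the volume density of a harmonic space

Fix a point `P` and a tangent vector `ξ`, and let `γ` be the geodesic with initial velocity `ξ`.
In a parallel frame along `γ`, the Jacobi operator is a curve `R` of endomorphisms of one vector
space, its derivatives at `0` are the operators `J_k(ξ)`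
(`IsGeodesicFrame.iteratedDeriv_frameJacobi`), and the derivative of `exp_P` at `tξ` becomes
`t⁻¹ A(t)`, where `A` solves the Jacobi equation `A'' = -R A` with `A(0) = 0`, `A'(0) = 1`. So, if
`A = t B`, the volume density at `tξ` is `det B(t)` (`HasNormalForm.eventually_density_eq`).

The logarithmic derivative `V = B' B⁻¹` solves the Riccati equation `t V' + 2 V + t V² + t R = 0`.
It determines the Taylor coefficients of `V` recursively (`taylorCoeff_logDerivative_succ`), and
`(det B)' = det B · Tr V` those of `det B`. For a general metric the results are long expressions
in the traces of products of the `J_k(ξ)`.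

In a harmonic space the density is even, so the coefficients of odd degree vanish. This gives
`Tr J_1 = 0`, `Tr(J J_1) = 0` and `16 Tr(J² J_1) = 3 Tr(J_1 J_2)`, the latter two with the help of
derivatives of the earlier ones. The decisive point is that evenness holds at *every* point
of `γ`, and that at `γ(s)` the Jacobi operator in the parallel frame is the shifted curve
`t ↦ R(s + t)`: the identities hold with `J_k` replaced by the derivatives of `R` at `s`, and can
therefore be differentiated with respect to `s` (`taylorCoeff_det_of_even`). The resulting relations
reduce the coefficients of degree `2`, `4`, `6` and `8` to the asserted form.

What has to be supplied from Riemannian geometry is the existence of this normal form at all points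
of a geodesic (`IsCoordMetric.exists_normalForms`). It rests on the differentiability of a flow with
respect to the initial value (`exists_flow_hasFDerivAt`), applied to the field of geodesics
with a parallel frame. The exponential map at a point is defined in the preferred chart at that
point, whereas the normal forms along `γ` are all computed in the chart at `P`; they are compared by
the transformation rule of the Christoffel symbols (`IsCoordMetric.fderiv_christoffel` and
`IsCoordMetric.eventually_coordExp_map`). -/

noncomputable section

namespace HarmonicSpace

open Set Filter Topology

/-! ### Taylor coefficients of functions of a real variable -/

section Taylor

variable {F G : Type*} [NormedAddCommGroup F] [NormedSpace ℝ F]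
  [NormedAddCommGroup G] [NormedSpace ℝ G]

/-- The coefficient of `tⁿ` in the Taylor series of `f` at `0`. -/
def taylorCoeff (n : ℕ) (f : ℝ → F) : F := ((n.factorial : ℝ))⁻¹ • iteratedDeriv n f 0

lemma taylorCoeff_zero (f : ℝ → F) : taylorCoeff 0 f = f 0 := by
  simp [taylorCoeff]

lemma taylorCoeff_congr {f g : ℝ → F} (h : f =ᶠ[𝓝 0] g) (n : ℕ) :
    taylorCoeff n f = taylorCoeff n g := by
  rw [taylorCoeff, taylorCoeff, h.iteratedDeriv_eq]

lemma taylorCoeff_add {f g : ℝ → F} (hf : ContDiffAt ℝ ∞ f 0) (hg : ContDiffAt ℝ ∞ g 0) (n : ℕ) :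
    taylorCoeff n (fun t => f t + g t) = taylorCoeff n f + taylorCoeff n g := by
  have hn : (n : ℕ∞ω) ≤ ∞ := by exact_mod_cast le_top
  rw [taylorCoeff, taylorCoeff, taylorCoeff, ← smul_add]
  congr 1
  exact iteratedDeriv_add (hf.of_le hn) (hg.of_le hn)

lemma taylorCoeff_deriv (f : ℝ → F) (n : ℕ) :
    taylorCoeff n (deriv f) = ((n : ℝ) + 1) • taylorCoeff (n + 1) f := by
  rw [taylorCoeff, taylorCoeff, iteratedDeriv_succ', smul_smul, Nat.factorial_succ]
  congr 1
  push_cast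
  have : ((n : ℝ) + 1) ≠ 0 := by positivity
  field_simp

lemma taylorCoeff_clm (L : F →L[ℝ] G) {f : ℝ → F} (hf : ContDiffAt ℝ ∞ f 0) (n : ℕ) :
    taylorCoeff n (fun t => L (f t)) = L (taylorCoeff n f) := by
  have hn : (n : ℕ∞ω) ≤ ∞ := by exact_mod_cast le_top
  rw [taylorCoeff, taylorCoeff, map_smul]
  congr 1
  rw [iteratedDeriv_eq_iteratedFDeriv, iteratedDeriv_eq_iteratedFDeriv]
  have := L.iteratedFDeriv_comp_left hf (i := n) hn
  rw [show (fun t => L (f t)) = L ∘ f from rfl, this]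
  rfl

lemma taylorCoeff_mul {𝔸 : Type*} [NormedRing 𝔸] [NormedAlgebra ℝ 𝔸] {f g : ℝ → 𝔸}
    (hf : ContDiffAt ℝ ∞ f 0) (hg : ContDiffAt ℝ ∞ g 0) (n : ℕ) :
    taylorCoeff n (fun t => f t * g t) =
      ∑ i ∈ Finset.range (n + 1), taylorCoeff i f * taylorCoeff (n - i) g := by
  have hn : (n : ℕ∞ω) ≤ ∞ := by exact_mod_cast le_top
  rw [taylorCoeff, iteratedDeriv_fun_mul (hf.of_le hn) (hg.of_le hn), Finset.smul_sum]
  refine Finset.sum_congr rfl fun i hi => ?_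
  have hi' : i ≤ n := Nat.lt_succ_iff.1 (Finset.mem_range.1 hi)
  rw [taylorCoeff, taylorCoeff, smul_mul_smul_comm, ← nsmul_eq_mul, ← Nat.cast_smul_eq_nsmul ℝ,
    smul_mul_assoc, smul_smul, Nat.cast_choose ℝ hi']
  congr 1
  have h1 : ((n.factorial : ℝ)) ≠ 0 := by positivity
  field_simp

lemma contDiffAt_deriv {f : ℝ → F} {x : ℝ} (hf : ContDiffAt ℝ ∞ f x) :
    ContDiffAt ℝ ∞ (deriv f) x := by
  have h := (hf.fderiv_right (m := ∞) (by simp)).clm_apply (contDiffAt_const (c := (1 : ℝ)))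
  exact h

lemma taylorCoeff_smul_succ {f : ℝ → F} (hf : ContDiffAt ℝ ∞ f 0) (n : ℕ) :
    taylorCoeff (n + 1) (fun t => t • f t) = taylorCoeff n f := by
  have key : ∀ (n : ℕ) (f : ℝ → F), ContDiffAt ℝ ∞ f 0 →
      iteratedDeriv (n + 1) (fun t => t • f t) 0 = ((n : ℝ) + 1) • iteratedDeriv n f 0 := by
    intro n
    induction n with
    | zero =>
      intro f hf
      have h := (hasDerivAt_id (0 : ℝ)).smul (hf.differentiableAt (by simp)).hasDerivAt
      rw [zero_add, iteratedDeriv_one]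
      exact h.deriv.trans (by simp)
    | succ n ih =>
      intro f hf
      have hd : deriv (fun t => t • f t) =ᶠ[𝓝 0] fun t => f t + t • deriv f t := by
        have := (hf.of_le (m := 1) (by exact_mod_cast le_top)).eventually (by simp)
        filter_upwards [this] with t ht
        have h := (hasDerivAt_id t).smul (ht.differentiableAt (by simp)).hasDerivAt
        exact h.deriv.trans (by simp [add_comm])
      have hdf : ContDiffAt ℝ ∞ (deriv f) 0 := contDiffAt_deriv hf
      have hg : ContDiffAt ℝ ∞ (fun t => t • deriv f t) 0 := contDiffAt_id.smul hdf
      have hn : ((n + 1 : ℕ) : ℕ∞ω) ≤ ∞ := by exact_mod_cast le_top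
      rw [iteratedDeriv_succ', hd.iteratedDeriv_eq,
        iteratedDeriv_fun_add (hf.of_le hn) (hg.of_le hn), ih _ hdf,
        ← iteratedDeriv_succ']
      push_cast
      module
  rw [taylorCoeff, taylorCoeff, key n f hf, smul_smul, Nat.factorial_succ]
  congr 1
  push_cast
  have : ((n : ℝ) + 1) ≠ 0 := by positivity
  field_simp

lemma taylorCoeff_eq_zero_of_even {f : ℝ → F} (h : ∀ᶠ t in 𝓝 0, f (-t) = f t) {n : ℕ}
    (hn : Odd n) : taylorCoeff n f = 0 := by
  have h1 := iteratedDeriv_comp_neg n f 0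
  rw [(show (fun x => f (-x)) =ᶠ[𝓝 0] f from h).iteratedDeriv_eq, hn.neg_one_pow, neg_zero,
    neg_one_smul] at h1
  have h2 : (2 : ℝ) • iteratedDeriv n f 0 = 0 := by
    rw [two_smul]
    nth_rewrite 1 [h1]
    exact neg_add_cancel _
  rw [taylorCoeff, (smul_eq_zero_iff_right two_ne_zero).1 h2, smul_zero]

end Taylor

/-! ### Hadamard's lemma -/

section Hadamard

variable {F : Type*} [NormedAddCommGroup F] [NormedSpace ℝ F]

/-- Smoothness of the integrals `∫ uᵏ f(ut) du`. The weight `uᵏ` is what differentiation with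
respect to `t` produces, and so lets the induction on the order of differentiability close. -/
lemma contDiff_integral_pow_smul_comp_mul (n : ℕ) :
    ∀ (k : ℕ) (f : ℝ → F), ContDiff ℝ ∞ f →
      ContDiff ℝ n (fun t : ℝ => ∫ u in (0 : ℝ)..1, u ^ k • f (u * t)) := by
  have hd : ∀ (k : ℕ) (f : ℝ → F), ContDiff ℝ ∞ f → ∀ t : ℝ,
      HasDerivAt (fun t : ℝ => ∫ u in (0 : ℝ)..1, u ^ k • f (u * t))
        (∫ u in (0 : ℝ)..1, u ^ (k + 1) • deriv f (u * t)) t := by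
    intro k f hf t
    have hf' : Continuous (deriv f) := hf.continuous_deriv (by exact_mod_cast le_top)
    have hc : Continuous (fun p : ℝ × ℝ => ‖p.1 ^ (k + 1) • deriv f (p.1 * p.2)‖) := by fun_prop
    obtain ⟨C, hC⟩ := (isCompact_Icc (a := (0 : ℝ)) (b := 1)).prod
      (isCompact_closedBall t 1) |>.bddAbove_image hc.continuousOn
    refine (intervalIntegral.hasDerivAt_integral_of_dominated_loc_of_deriv_le
      (F' := fun t u => u ^ (k + 1) • deriv f (u * t)) (bound := fun _ => C)
      (Metric.closedBall_mem_nhds t one_pos) ?_ ?_ ?_ ?_ ?_ ?_).2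
    · refine Eventually.of_forall fun s => Continuous.aestronglyMeasurable ?_
      have := hf.continuous
      fun_prop
    · have := hf.continuous
      exact Continuous.intervalIntegrable (by fun_prop) _ _
    · exact Continuous.aestronglyMeasurable (by fun_prop)
    · refine Eventually.of_forall fun u hu s hs => hC ⟨(u, s), ⟨?_, hs⟩, rfl⟩
      rw [uIoc_of_le zero_le_one] at hu
      exact Ioc_subset_Icc_self hu
    · exact intervalIntegrable_const
    · refine Eventually.of_forall fun u _ s _ => ?_
      have h1 : HasDerivAt f (deriv f (u * s)) (u * s) :=
        (hf.differentiable (by simp) _).hasDerivAt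
      have h2 := (h1.scomp s ((hasDerivAt_id s).const_mul u)).const_smul (u ^ k)
      convert! h2 using 1
      simp [smul_smul, pow_succ]
  induction n with
  | zero =>
    intro k f hf
    exact contDiff_zero.2 (continuous_iff_continuousAt.2 fun t => (hd k f hf t).continuousAt)
  | succ n ih =>
    intro k f hf
    push_cast
    refine contDiff_succ_iff_deriv.2 ⟨fun t => (hd k f hf t).differentiableAt, by simp, ?_⟩
    rw [show deriv _ = _ from funext fun t => (hd k f hf t).deriv]
    exact ih _ _ (contDiff_infty_iff_deriv.1 hf).2

/-- Hadamard's lemma: a function `A` which is smooth near `0` and vanishes there is `t` times a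
smooth function. -/
lemma exists_eventuallyEq_smul_of_zero [CompleteSpace F] {A : ℝ → F}
    (hA : ∀ᶠ t in 𝓝 0, ContDiffAt ℝ ∞ A t) (h0 : A 0 = 0) :
    ∃ B : ℝ → F, ContDiffAt ℝ ∞ B 0 ∧ B 0 = deriv A 0 ∧ ∀ᶠ t in 𝓝 0, A t = t • B t := by
  -- a bump function replaces `A` by a globally smooth function with the same germ
  obtain ⟨A', hA', hEq⟩ : ∃ A' : ℝ → F, ContDiff ℝ ∞ A' ∧ A' =ᶠ[𝓝 0] A := by
    obtain ⟨r, hr, hrs⟩ := Metric.eventually_nhds_iff_ball.1 hA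
    let χ : ContDiffBump (0 : ℝ) := ⟨r / 3, r / 2, by positivity, by linarith⟩
    refine ⟨fun t => χ t • A t, contDiff_iff_contDiffAt.2 fun t => ?_, ?_⟩
    · by_cases ht : t ∈ Metric.ball (0 : ℝ) r
      · exact χ.contDiffAt.smul (hrs t ht)
      · have : (fun t => χ t • A t) =ᶠ[𝓝 t] fun _ => 0 := by
          have h1 : t ∉ tsupport χ := by
            rw [χ.tsupport_eq]
            exact fun h => ht (Metric.closedBall_subset_ball (by simp only [χ]; linarith) h)
          filter_upwards [(isClosed_tsupport χ).isOpen_compl.mem_nhds h1] with s hs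
          simp [image_eq_zero_of_notMem_tsupport hs]
        exact contDiffAt_const.congr_of_eventuallyEq this
    · filter_upwards [χ.eventuallyEq_one] with t ht
      simp [ht]
  have hd : ∀ t, HasDerivAt A' (deriv A' t) t := fun t =>
    (hA'.differentiable (by simp) t).hasDerivAt
  have hd' : ContDiff ℝ ∞ (deriv A') := (contDiff_infty_iff_deriv.1 hA').2
  refine ⟨fun t => ∫ u in (0 : ℝ)..1, deriv A' (u * t), ?_, ?_, ?_⟩
  · have : ContDiff ℝ ∞ (fun t : ℝ => ∫ u in (0 : ℝ)..1, deriv A' (u * t)) := by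
      refine contDiff_infty.2 fun n => ?_
      simpa using contDiff_integral_pow_smul_comp_mul n 0 _ hd'
    exact this.contDiffAt
  · simp [hEq.deriv_eq]
  · filter_upwards [hEq] with t ht
    rw [← ht, ← intervalIntegral.integral_smul]
    have h1 : ∀ u ∈ uIcc (0 : ℝ) 1, HasDerivAt (fun u => A' (u * t)) (t • deriv A' (u * t)) u :=
      fun u _ => by
        have := (hd (u * t)).scomp u ((hasDerivAt_id u).mul_const t)
        convert! this using 1
        simp
    rw [intervalIntegral.integral_eq_sub_of_hasDerivAt h1]
    · simp [hEq.eq_of_nhds, h0]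
    · have := hd'.continuous
      exact Continuous.intervalIntegrable (by fun_prop) _ _

end Hadamard

/-! ### The determinant of a one-parameter family of endomorphisms -/

section Determinant

variable {E : Type*} [NormedAddCommGroup E] [NormedSpace ℝ E] [FiniteDimensional ℝ E]

/-- The trace as a continuous linear form on continuous endomorphisms. -/
def traceCLM (E : Type*) [NormedAddCommGroup E] [NormedSpace ℝ E] [FiniteDimensional ℝ E] :
    (E →L[ℝ] E) →L[ℝ] ℝ :=
  LinearMap.toContinuousLinearMap
    ((LinearMap.trace ℝ E).comp (ContinuousLinearMap.coeLM ℝ (M := E) (N₃ := E)))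

lemma traceCLM_apply (T : E →L[ℝ] E) : traceCLM E T = LinearMap.trace ℝ E (T : E →ₗ[ℝ] E) := rfl

lemma traceCLM_mul_comm (S T : E →L[ℝ] E) : traceCLM E (S * T) = traceCLM E (T * S) :=
  LinearMap.trace_mul_comm ℝ (S : E →ₗ[ℝ] E) (T : E →ₗ[ℝ] E)

lemma contDiff_det {n : ℕ∞ω} : ContDiff ℝ n (fun T : E →L[ℝ] E => T.det) := by
  let b := Module.finBasis ℝ E
  have h : (fun T : E →L[ℝ] E => T.det) =
      fun T => ∑ σ : Equiv.Perm (Fin (Module.finrank ℝ E)),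
        (Equiv.Perm.sign σ : ℤ) • ∏ i, b.coord (σ i) (T (b i)) := by
    funext T
    rw [ContinuousLinearMap.det, ← LinearMap.det_toMatrix b, Matrix.det_apply]
    refine Finset.sum_congr rfl fun σ _ => ?_
    simp [LinearMap.toMatrix_apply, Units.smul_def]
  rw [h]
  refine ContDiff.sum fun σ _ => ?_
  simp_rw [← Int.cast_smul_eq_zsmul ℝ]
  have hp : ContDiff ℝ n (fun T : E →L[ℝ] E => ∏ i, b.coord (σ i) (T (b i))) := by
    refine contDiff_prod fun i _ => ?_
    have hL : ContDiff ℝ n (LinearMap.toContinuousLinearMap (b.coord (σ i))) :=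
      ContinuousLinearMap.contDiff _
    exact hL.comp (contDiff_id.clm_apply contDiff_const)
  exact hp.const_smul _

/-- The derivative of the determinant at the identity is the trace. -/
lemma hasFDerivAt_det_one : HasFDerivAt (fun T : E →L[ℝ] E => T.det) (traceCLM E) 1 := by
  have h := ((contDiff_det (E := E) (n := 1)).differentiable (by simp) 1).hasFDerivAt
  convert! h using 1
  ext M
  have h1 : HasDerivAt (fun r : ℝ => (1 : E →L[ℝ] E) + r • M) M 0 := by
    simpa using ((hasDerivAt_id (0 : ℝ)).smul_const M).const_add (1 : E →L[ℝ] E)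
  have h2 := HasFDerivAt.comp_hasDerivAt (0 : ℝ) (by simpa using h) h1
  let b := Module.finBasis ℝ E
  let N := LinearMap.toMatrix b b (M : E →ₗ[ℝ] E)
  let q := (Matrix.det (1 + (Polynomial.X : Polynomial ℝ) • N.map Polynomial.C)).divX.divX
  have h3 : (fun T : E →L[ℝ] E => T.det) ∘ (fun r : ℝ => (1 : E →L[ℝ] E) + r • M) =
      fun r => 1 + N.trace * r + q.eval r * r ^ 2 := by
    funext r
    rw [← Matrix.det_one_add_smul, Function.comp, ContinuousLinearMap.det,
      ← LinearMap.det_toMatrix b]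
    congr 1
    simp [N, LinearMap.toMatrix_one]
  have h4 : HasDerivAt (fun r : ℝ => 1 + N.trace * r + q.eval r * r ^ 2) N.trace 0 := by
    have := (((hasDerivAt_id (0 : ℝ)).const_mul N.trace).const_add 1).add
      ((q.hasDerivAt 0).mul ((hasDerivAt_id (0 : ℝ)).pow 2))
    convert! this using 1
    simp
  rw [h3] at h2
  rw [← h2.unique h4 |>.symm, traceCLM_apply, LinearMap.trace_eq_matrix_trace ℝ b]

/-- Jacobi's formula for the derivative of a determinant. -/
lemma hasDerivAt_det {B : ℝ → E →L[ℝ] E} {B' : E →L[ℝ] E} {t : ℝ} (hB : HasDerivAt B B' t)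
    (hu : IsUnit (B t)) :
    HasDerivAt (fun s => (B s).det) ((B t).det * traceCLM E (B' * Ring.inverse (B t))) t := by
  have h1 : HasDerivAt (fun s => B s * Ring.inverse (B t)) (B' * Ring.inverse (B t)) t :=
    hB.mul_const _
  have h2 : HasFDerivAt (fun T : E →L[ℝ] E => T.det) (traceCLM E) (B t * Ring.inverse (B t)) := by
    rw [Ring.mul_inverse_cancel _ hu]; exact hasFDerivAt_det_one
  have h3 := (HasFDerivAt.comp_hasDerivAt t h2 h1).const_mul (B t).det
  convert! h3 using 1
  funext s
  have : B s = B s * Ring.inverse (B t) * B t := by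
    rw [mul_assoc, Ring.inverse_mul_cancel _ hu, mul_one]
  conv_lhs => rw [this]
  simp only [Function.comp, ContinuousLinearMap.det]
  rw [mul_comm, ← LinearMap.det_comp]
  rfl

end Determinant

/-! ### The Riccati equation and the Taylor coefficients of the determinant -/

section Riccati

variable {E : Type*} [NormedAddCommGroup E] [NormedSpace ℝ E] [FiniteDimensional ℝ E]

/-- The logarithmic derivative `B' B⁻¹`. -/
def logDerivative (B : ℝ → E →L[ℝ] E) (t : ℝ) : E →L[ℝ] E := deriv B t * Ring.inverse (B t)

lemma eventually_isUnit {B : ℝ → E →L[ℝ] E} (hB : ContinuousAt B 0) (hB0 : B 0 = 1) :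
    ∀ᶠ t in 𝓝 0, IsUnit (B t) := by
  have : IsUnit (B 0) := by rw [hB0]; exact isUnit_one
  exact hB (Units.isOpen.mem_nhds this)

lemma contDiffAt_logDerivative {B : ℝ → E →L[ℝ] E} (hB : ContDiffAt ℝ ∞ B 0) (hB0 : B 0 = 1) :
    ContDiffAt ℝ ∞ (logDerivative B) 0 := by
  have h1 : ContDiffAt ℝ ∞ (Ring.inverse : (E →L[ℝ] E) → E →L[ℝ] E) (B 0) := by
    rw [hB0]
    exact contDiffAt_ringInverse ℝ (1 : (E →L[ℝ] E)ˣ)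
  exact (contDiffAt_deriv hB).mul (h1.comp 0 hB)

/-- If `A = t B` solves the Jacobi equation `A'' = -R A`, then the logarithmic derivative `V` of
`B` solves a Riccati equation. -/
lemma logDerivative_riccati {R B : ℝ → E →L[ℝ] E} (hB : ContDiffAt ℝ ∞ B 0) (hB0 : B 0 = 1)
    (hode : ∀ᶠ t in 𝓝 0, deriv (deriv fun t => t • B t) t = -(R t * (t • B t))) :
    ∀ᶠ t in 𝓝 0, t • deriv (logDerivative B) t + ((2 : ℝ) • logDerivative B t +
      (t • (logDerivative B t * logDerivative B t) + t • R t)) = 0 := by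
  have hd : ∀ᶠ t in 𝓝 0, DifferentiableAt ℝ B t :=
    ((hB.of_le (m := 1) (by exact_mod_cast le_top)).eventually (by simp)).mono
      fun t ht => ht.differentiableAt (by simp)
  have hd' : ∀ᶠ t in 𝓝 0, DifferentiableAt ℝ (deriv B) t :=
    (((contDiffAt_deriv hB).of_le (m := 1) (by exact_mod_cast le_top)).eventually (by simp)).mono
      fun t ht => ht.differentiableAt (by simp)
  have hdV : ∀ᶠ t in 𝓝 0, DifferentiableAt ℝ (logDerivative B) t :=
    (((contDiffAt_logDerivative hB hB0).of_le (m := 1) (by exact_mod_cast le_top)).eventually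
      (by simp)).mono fun t ht => ht.differentiableAt (by simp)
  have hu := eventually_isUnit hB.continuousAt hB0
  have h1 : ∀ᶠ t in 𝓝 0, deriv (fun t => t • B t) t = B t + t • deriv B t := by
    filter_upwards [hd] with t ht
    exact ((hasDerivAt_id t).smul ht.hasDerivAt).deriv.trans (by simp [add_comm])
  have hVB : ∀ᶠ t in 𝓝 0, logDerivative B t * B t = deriv B t := by
    filter_upwards [hu] with t ht
    rw [logDerivative, mul_assoc, Ring.inverse_mul_cancel _ ht, mul_one]
  filter_upwards [hd, hd', hdV, hu, h1.eventually_nhds, hVB.eventually_nhds, hode]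
    with t hd hd' hdV hu h1 hVB hode
  have h2 : deriv (deriv fun t => t • B t) t = (2 : ℝ) • deriv B t + t • deriv (deriv B) t := by
    rw [Filter.EventuallyEq.deriv_eq h1]
    refine (hd.hasDerivAt.add ((hasDerivAt_id t).smul hd'.hasDerivAt)).deriv.trans ?_
    simp only [id, one_smul]
    module
  have h3 : deriv (logDerivative B) t * B t + logDerivative B t * deriv B t =
      deriv (deriv B) t := by
    rw [← Filter.EventuallyEq.deriv_eq hVB]
    exact (hdV.hasDerivAt.mul hd.hasDerivAt).deriv.symm
  have hVB := hVB.self_of_nhds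
  rw [← hu.mul_left_inj, zero_mul]
  rw [h2, ← h3, ← hVB, mul_smul_comm] at hode
  simp only [add_mul, smul_mul_assoc, mul_assoc, hVB] at hode ⊢
  rw [← sub_eq_zero] at hode
  rw [← hode]
  module

variable {R B : ℝ → E →L[ℝ] E}

lemma taylorCoeff_logDerivative_zero (hB : ContDiffAt ℝ ∞ B 0) (hB0 : B 0 = 1)
    (hode : ∀ᶠ t in 𝓝 0, deriv (deriv fun t => t • B t) t = -(R t * (t • B t))) :
    taylorCoeff 0 (logDerivative B) = 0 := by
  have h := (logDerivative_riccati hB hB0 hode).self_of_nhds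
  simpa [taylorCoeff_zero] using h

/-- The recursion which the Riccati equation gives for the Taylor coefficients of the logarithmic
derivative. -/
lemma taylorCoeff_logDerivative_succ (hR : ContDiffAt ℝ ∞ R 0) (hB : ContDiffAt ℝ ∞ B 0)
    (hB0 : B 0 = 1)
    (hode : ∀ᶠ t in 𝓝 0, deriv (deriv fun t => t • B t) t = -(R t * (t • B t))) (n : ℕ) :
    ((n : ℝ) + 3) • taylorCoeff (n + 1) (logDerivative B) = -(taylorCoeff n R +
      ∑ i ∈ Finset.range (n + 1), taylorCoeff i (logDerivative B) *
        taylorCoeff (n - i) (logDerivative B)) := by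
  have hV := contDiffAt_logDerivative hB hB0
  have hVV : ContDiffAt ℝ ∞ (fun t => logDerivative B t * logDerivative B t) 0 := hV.mul hV
  have hid : ContDiffAt ℝ ∞ (fun t : ℝ => t) 0 := contDiffAt_id
  have h := taylorCoeff_congr (logDerivative_riccati hB hB0 hode) (n + 1)
  have h0 : taylorCoeff (n + 1) (fun _ : ℝ => (0 : E →L[ℝ] E)) = 0 := by
    simp [taylorCoeff]
  have hc := taylorCoeff_clm ((2 : ℝ) • ContinuousLinearMap.id ℝ (E →L[ℝ] E)) hV (n + 1)
  simp only [smul_apply, ContinuousLinearMap.id_apply] at hc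
  have s1 : ContDiffAt ℝ ∞ (fun t => t • deriv (logDerivative B) t) 0 :=
    hid.smul (contDiffAt_deriv hV)
  have s2 : ContDiffAt ℝ ∞ (fun t => (2 : ℝ) • logDerivative B t) 0 := hV.const_smul _
  have s3 : ContDiffAt ℝ ∞ (fun t => t • (logDerivative B t * logDerivative B t)) 0 :=
    hid.smul hVV
  have s4 : ContDiffAt ℝ ∞ (fun t => t • R t) 0 := hid.smul hR
  have s34 : ContDiffAt ℝ ∞
      (fun t => t • (logDerivative B t * logDerivative B t) + t • R t) 0 := s3.add s4
  have s234 : ContDiffAt ℝ ∞ (fun t => (2 : ℝ) • logDerivative B t +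
      (t • (logDerivative B t * logDerivative B t) + t • R t)) 0 := s2.add s34
  rw [taylorCoeff_add s1 s234, taylorCoeff_add s2 s34, taylorCoeff_add s3 s4,
    taylorCoeff_smul_succ (contDiffAt_deriv hV), taylorCoeff_smul_succ hVV,
    taylorCoeff_smul_succ hR, taylorCoeff_mul hV hV, taylorCoeff_deriv, hc, h0] at h
  rw [eq_neg_iff_add_eq_zero, ← h]
  module

lemma contDiffAt_det (hB : ContDiffAt ℝ ∞ B 0) : ContDiffAt ℝ ∞ (fun t => (B t).det) 0 :=
  contDiff_det.contDiffAt.comp 0 hB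

lemma taylorCoeff_det_zero {F : Type*} [NormedAddCommGroup F] [NormedSpace ℝ F]
    {B : ℝ → F →L[ℝ] F} (hB0 : B 0 = 1) : taylorCoeff 0 (fun t => (B t).det) = 1 := by
  simp [taylorCoeff_zero, hB0, ContinuousLinearMap.det]

/-- The recursion which Jacobi's formula gives for the Taylor coefficients of the determinant. -/
lemma taylorCoeff_det_succ (hB : ContDiffAt ℝ ∞ B 0) (hB0 : B 0 = 1) (n : ℕ) :
    ((n : ℝ) + 1) * taylorCoeff (n + 1) (fun t => (B t).det) =
      ∑ i ∈ Finset.range (n + 1), taylorCoeff i (fun t => (B t).det) *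
        traceCLM E (taylorCoeff (n - i) (logDerivative B)) := by
  have hV := contDiffAt_logDerivative hB hB0
  have hd : ∀ᶠ t in 𝓝 0, DifferentiableAt ℝ B t :=
    ((hB.of_le (m := 1) (by exact_mod_cast le_top)).eventually (by simp)).mono
      fun t ht => ht.differentiableAt (by simp)
  have h : deriv (fun t => (B t).det) =ᶠ[𝓝 0]
      fun t => (B t).det * traceCLM E (logDerivative B t) := by
    filter_upwards [hd, eventually_isUnit hB.continuousAt hB0] with t ht hu
    exact (hasDerivAt_det ht.hasDerivAt hu).deriv
  have h1 := taylorCoeff_congr h n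
  have hτ : ContDiffAt ℝ ∞ (fun t => traceCLM E (logDerivative B t)) 0 :=
    (traceCLM E).contDiff.contDiffAt.comp 0 hV
  rw [taylorCoeff_deriv, taylorCoeff_mul (contDiffAt_det hB) hτ] at h1
  rw [← smul_eq_mul, h1]
  refine Finset.sum_congr rfl fun i _ => ?_
  rw [← taylorCoeff_clm _ hV]

end Riccati

/-! ### Traces of the solution of the Riccati recursion -/

section Traces

variable {𝔸 : Type*} [Ring 𝔸] [Algebra ℝ 𝔸]

/-- The traces of the first terms `v n` of a solution of the Riccati recursion with coefficients
`X n / n!`; here `τ` is any linear form with the cyclic property of the trace. -/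
lemma riccati_traces {v X : ℕ → 𝔸} {τ : 𝔸 →ₗ[ℝ] ℝ} (hτ : ∀ a b, τ (a * b) = τ (b * a))
    (h0 : v 0 = 0)
    (h : ∀ n : ℕ, ((n : ℝ) + 3) • v (n + 1) = -(((n.factorial : ℝ))⁻¹ • X n +
      ∑ i ∈ Finset.range (n + 1), v i * v (n - i))) :
    τ (v 1) = -(1 / 3) * τ (X 0) ∧
    τ (v 2) = -(1 / 4) * τ (X 1) ∧
    τ (v 3) = -(1 / 45) * τ (X 0 * X 0) - 1 / 10 * τ (X 2) ∧
    τ (v 4) = -(1 / 36) * τ (X 0 * X 1) - 1 / 36 * τ (X 3) ∧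
    τ (v 5) = -(2 / 945) * τ (X 0 * (X 0 * X 0)) - 1 / 105 * τ (X 0 * X 2)
      - 1 / 112 * τ (X 1 * X 1) - 1 / 168 * τ (X 4) ∧
    τ (v 6) = -(1 / 270) * τ (X 0 * (X 0 * X 1)) - 1 / 432 * τ (X 0 * X 3)
      - 1 / 160 * τ (X 1 * X 2) - 1 / 960 * τ (X 5) ∧
    τ (v 7) = -(1 / 4725) * τ (X 0 * (X 0 * (X 0 * X 0))) - 17 / 14175 * τ (X 0 * (X 0 * X 2))
      - 5 / 2268 * τ (X 0 * (X 1 * X 1)) - 1 / 2268 * τ (X 0 * X 4) - 1 / 648 * τ (X 1 * X 3)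
      - 1 / 900 * τ (X 2 * X 2) - 1 / 6480 * τ (X 6) := by
  have hc : ∀ a b c, τ (a * (b * c)) = τ (b * (c * a)) := fun a b c => by
    rw [hτ a, mul_assoc]
  have e1 : v 1 = (-(1 / 3) : ℝ) • X 0 := by
    have := h 0
    simp [h0] at this
    linear_combination (norm := module) (1 / 3 : ℝ) • this
  have e2 : v 2 = (-(1 / 4) : ℝ) • X 1 := by
    have := h 1
    simp [h0, Finset.sum_range_succ] at this
    linear_combination (norm := module) (1 / 4 : ℝ) • this
  have e3 : v 3 = (-(1 / 10) : ℝ) • X 2 - (1 / 45 : ℝ) • (X 0 * X 0) := by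
    have := h 2
    simp [h0, Finset.sum_range_succ, Nat.factorial, e1] at this
    linear_combination (norm := module) (1 / 5 : ℝ) • this
  have e4 : v 4 = (-(1 / 36) : ℝ) • X 3 - (1 / 72 : ℝ) • (X 0 * X 1 + X 1 * X 0) := by
    have := h 3
    simp [h0, Finset.sum_range_succ, Nat.factorial, e1, e2] at this
    linear_combination (norm := module) (1 / 6 : ℝ) • this
  have e5 : v 5 = (-(1 / 168) : ℝ) • X 4 - (1 / 210 : ℝ) • (X 0 * X 2 + X 2 * X 0)
      - (1 / 112 : ℝ) • (X 1 * X 1) - (2 / 945 : ℝ) • (X 0 * (X 0 * X 0)) := by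
    have := h 4
    simp [h0, Finset.sum_range_succ, Nat.factorial, e1, e2, e3, mul_sub, sub_mul, mul_assoc] at this
    linear_combination (norm := module) (1 / 7 : ℝ) • this
  have e6 : v 6 = (-(1 / 960) : ℝ) • X 5 - (1 / 864 : ℝ) • (X 0 * X 3 + X 3 * X 0)
      - (1 / 320 : ℝ) • (X 1 * X 2 + X 2 * X 1)
      - (1 / 1440 + 1 / 1728 : ℝ) • (X 0 * (X 0 * X 1) + X 1 * (X 0 * X 0))
      - (1 / 864 : ℝ) • (X 0 * (X 1 * X 0)) := by
    have := h 5
    simp [h0, Finset.sum_range_succ, Nat.factorial, e1, e2, e3, e4, mul_sub, sub_mul, mul_add,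
      add_mul, mul_assoc] at this
    linear_combination (norm := module) (1 / 8 : ℝ) • this
  -- by cyclicity `v 6` is not needed for the trace of `v 7`
  have t7 : 9 * τ (v 7) = -(1 / 720 * τ (X 6) +
      2 * τ (v 1 * v 5) + 2 * τ (v 2 * v 4) + τ (v 3 * v 3)) := by
    have := congrArg τ (h 6)
    simp [h0, Finset.sum_range_succ, Nat.factorial] at this
    rw [hτ (v 5), hτ (v 4)] at this
    linear_combination this
  have p01 := hτ (X 1) (X 0)
  have p02 := hτ (X 2) (X 0)
  have p03 := hτ (X 3) (X 0)
  have p12 := hτ (X 2) (X 1)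
  have q010 : τ (X 0 * (X 1 * X 0)) = τ (X 0 * (X 0 * X 1)) := (hc _ _ _).symm
  have q100 : τ (X 1 * (X 0 * X 0)) = τ (X 0 * (X 0 * X 1)) := hc _ _ _
  have q020 : τ (X 0 * (X 2 * X 0)) = τ (X 0 * (X 0 * X 2)) := (hc _ _ _).symm
  have q200 : τ (X 2 * (X 0 * X 0)) = τ (X 0 * (X 0 * X 2)) := hc _ _ _
  have q101 : τ (X 1 * (X 0 * X 1)) = τ (X 0 * (X 1 * X 1)) := hc _ _ _
  have q110 : τ (X 1 * (X 1 * X 0)) = τ (X 0 * (X 1 * X 1)) := (hc _ _ _).symm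
  refine ⟨?_, ?_, ?_, ?_, ?_, ?_, ?_⟩
  · simp [e1]
  · simp [e2]
  · simp [e3]; ring
  · simp [e4, p01]; ring
  · simp [e5, p02]; ring
  · simp [e6, p03, p12, q010, q100]; ring
  · simp only [e1, e2, e3, e4, e5, mul_add, mul_sub, sub_mul, smul_mul_assoc,
      mul_smul_comm, map_add, map_sub, map_smul, smul_eq_mul, mul_assoc, smul_add, smul_sub] at t7
    simp only [q020, q200, q101, q110] at t7
    linear_combination t7 / 9

/-- The Taylor coefficients of a determinant with even Taylor series, in terms of the traces of
the potential and its derivatives, once the identities which evenness forces along the whole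
geodesic have been used. -/
lemma coeff_of_traces {v X : ℕ → 𝔸} {τ : 𝔸 →ₗ[ℝ] ℝ} (hτ : ∀ a b, τ (a * b) = τ (b * a))
    (h0 : v 0 = 0)
    (h : ∀ n : ℕ, ((n : ℝ) + 3) • v (n + 1) = -(((n.factorial : ℝ))⁻¹ • X n +
      ∑ i ∈ Finset.range (n + 1), v i * v (n - i)))
    {f : ℕ → ℝ} (hf0 : f 0 = 1)
    (hf : ∀ n : ℕ, ((n : ℝ) + 1) * f (n + 1) = ∑ i ∈ Finset.range (n + 1), f i * τ (v (n - i)))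
    (hX : ∀ n, τ (X (n + 1)) = 0) (h01 : τ (X 0 * X 1) = 0)
    (h02 : τ (X 0 * X 2) = -τ (X 1 * X 1))
    (h03 : τ (X 0 * X 3) = -3 * τ (X 1 * X 2))
    (h04 : τ (X 0 * X 4) = -3 * τ (X 2 * X 2) - 4 * τ (X 1 * X 3))
    (h001 : τ (X 0 * (X 0 * X 1)) = 3 / 16 * τ (X 1 * X 2))
    (h002 : τ (X 0 * (X 0 * X 2)) + 2 * τ (X 0 * (X 1 * X 1)) =
      3 / 16 * (τ (X 2 * X 2) + τ (X 1 * X 3))) :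
    f 2 = -(1 / 6) * τ (X 0) ∧
    f 4 = 1 / 72 * τ (X 0) ^ 2 - 1 / 180 * τ (X 0 * X 0) ∧
    f 6 = -(τ (X 0) ^ 3 / 1296) + τ (X 0) * τ (X 0 * X 0) / 1080 - τ (X 0 * (X 0 * X 0)) / 2835
      + τ (X 1 * X 1) / 10080 ∧
    f 8 = τ (X 0) ^ 4 / 31104 - τ (X 0) ^ 2 * τ (X 0 * X 0) / 12960
      + τ (X 0) * τ (X 0 * (X 0 * X 0)) / 17010 - τ (X 0) * τ (X 1 * X 1) / 60480
      + τ (X 0 * X 0) ^ 2 / 64800 - τ (X 0 * (X 0 * (X 0 * X 0))) / 37800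
      - τ (X 0 * (X 0 * X 2)) / 340200 + τ (X 0 * (X 1 * X 1)) / 54432
      - τ (X 2 * X 2) / 907200 := by
  obtain ⟨t1, t2, t3, t4, t5, t6, t7⟩ := riccati_traces hτ h0 h
  have hX1 := hX 0
  have hX2 := hX 1
  have hX3 := hX 2
  have hX4 := hX 3
  have hX5 := hX 4
  have hX6 := hX 5
  norm_num only at hX1 hX2 hX3 hX4 hX5 hX6
  rw [hX1] at t2
  rw [hX2] at t3
  rw [hX3, h01] at t4
  rw [hX4, h02] at t5
  rw [hX5, h03, h001] at t6
  rw [hX6, h04] at t7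
  have f1 := hf 0
  have f2 := hf 1
  have f3 := hf 2
  have f4 := hf 3
  have f5 := hf 4
  have f6 := hf 5
  have f8 := hf 7
  simp only [Finset.sum_range_succ, Finset.sum_range_zero, Nat.sub_zero, Nat.reduceSub, zero_add,
    Nat.reduceAdd, h0, map_zero, mul_zero, add_zero, hf0, one_mul, Nat.cast_ofNat, Nat.cast_zero,
    Nat.cast_one, t1, t2, t3, t4, t5, t6, t7] at f1 f2 f3 f4 f5 f6 f8
  have g2 : f 2 = -(1 / 6) * τ (X 0) := by linarith
  have g3 : f 3 = 0 := by rw [f1] at f3; linarith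
  have g4 : f 4 = 1 / 72 * τ (X 0) ^ 2 - 1 / 180 * τ (X 0 * X 0) := by
    simp only [g2] at f4
    linear_combination f4 / 4
  have g5 : f 5 = 0 := by
    simp only [f1, g3] at f5
    linear_combination f5 / 5
  have g6 : f 6 = -(τ (X 0) ^ 3 / 1296) + τ (X 0) * τ (X 0 * X 0) / 1080
      - τ (X 0 * (X 0 * X 0)) / 2835 + τ (X 1 * X 1) / 10080 := by
    simp only [f1, g2, g4] at f6
    linear_combination f6 / 6
  refine ⟨g2, g4, g6, ?_⟩
  simp only [f1, g2, g3, g4, g6] at f8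
  -- the coefficient of `τ (X 1 * X 3)` in `f 8` is `1 / 36288`, and `h002` eliminates this trace
  linear_combination f8 / 8 - 1 / 36288 * (16 / 3) * h002

/-- The vanishing of the odd Taylor coefficients of the determinant, in terms of traces. The
hypotheses in the conclusion are obtained by differentiating the preceding identities along the
geodesic. -/
lemma traces_of_odd_coeff_eq_zero {v X : ℕ → 𝔸} {τ : 𝔸 →ₗ[ℝ] ℝ}
    (hτ : ∀ a b, τ (a * b) = τ (b * a)) (h0 : v 0 = 0)
    (h : ∀ n : ℕ, ((n : ℝ) + 3) • v (n + 1) = -(((n.factorial : ℝ))⁻¹ • X n +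
      ∑ i ∈ Finset.range (n + 1), v i * v (n - i)))
    {f : ℕ → ℝ} (hf0 : f 0 = 1)
    (hf : ∀ n : ℕ, ((n : ℝ) + 1) * f (n + 1) = ∑ i ∈ Finset.range (n + 1), f i * τ (v (n - i)))
    (hodd : ∀ n, f (2 * n + 1) = 0) :
    τ (X 1) = 0 ∧ (τ (X 3) = 0 → τ (X 0 * X 1) = 0) ∧
    (τ (X 3) = 0 → τ (X 5) = 0 → τ (X 0 * X 3) = -3 * τ (X 1 * X 2) →
      τ (X 0 * (X 0 * X 1)) = 3 / 16 * τ (X 1 * X 2)) := by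
  obtain ⟨t1, t2, t3, t4, t5, t6, t7⟩ := riccati_traces hτ h0 h
  have f1 := hodd 0
  have f3' := hodd 1
  have f5' := hodd 2
  have f7' := hodd 3
  have f3 := hf 2
  have f5 := hf 4
  have f7 := hf 6
  norm_num only at f1 f3' f5' f7'
  simp only [Finset.sum_range_succ, Finset.sum_range_zero, Nat.sub_zero, Nat.reduceSub, zero_add,
    Nat.reduceAdd, h0, map_zero, mul_zero, add_zero, hf0, one_mul, Nat.cast_ofNat, f1, f3', f5',
    f7', zero_mul] at f3 f5 f7
  have hv2 : τ (v 2) = 0 := f3.symm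
  have hv4 : τ (v 4) = 0 := by linear_combination -f5 - f 2 * hv2
  have hv6 : τ (v 6) = 0 := by linear_combination -f7 - f 2 * hv4 - f 4 * hv2
  refine ⟨by linarith, fun h3 => ?_, fun h3 h5 h03 => ?_⟩
  · rw [t4, h3] at hv4
    linarith
  · rw [t6, h5, h03] at hv6
    linarith

end Traces

/-! ### Determinants which are even at all base points -/

section EvenDeterminant

variable {E : Type*} [NormedAddCommGroup E] [NormedSpace ℝ E] [FiniteDimensional ℝ E]

lemma hasDerivAt_iteratedDeriv {F : Type*} [NormedAddCommGroup F] [NormedSpace ℝ F] {f : ℝ → F}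
    {s : ℝ} (hf : ContDiffAt ℝ ∞ f s) (k : ℕ) :
    HasDerivAt (iteratedDeriv k f) (iteratedDeriv (k + 1) f s) s := by
  have h : ContDiffAt ℝ ∞ (iteratedDeriv k f) s := by
    induction k with
    | zero => simpa using hf
    | succ k ih => rw [iteratedDeriv_succ]; exact contDiffAt_deriv ih
  rw [iteratedDeriv_succ]
  exact (h.differentiableAt (by simp)).hasDerivAt

lemma eventually_deriv_eq_zero {p p' : ℝ → ℝ} (h : ∀ᶠ s in 𝓝 0, p s = 0)
    (hp : ∀ᶠ s in 𝓝 0, HasDerivAt p (p' s) s) : ∀ᶠ s in 𝓝 0, p' s = 0 := by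
  filter_upwards [h.eventually_nhds, hp] with s hs hps
  have h1 : HasDerivAt p 0 s := (hasDerivAt_const s (0 : ℝ)).congr_of_eventuallyEq hs
  exact hps.unique h1

/-- Along a geodesic, let `R` be the Jacobi operator in a parallel frame, so that the Jacobi
endomorphisms are the solutions of `A'' = -R A`, and let `A = t B` be the solution which vanishes
at the origin.  If at all nearby base points `s` of the geodesic the function `det B` is even, then
the Taylor coefficients of `det B` simplify. -/
theorem taylorCoeff_det_of_even {R : ℝ → E →L[ℝ] E} (hR : ∀ᶠ s in 𝓝 0, ContDiffAt ℝ ∞ R s)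
    (H : ∀ᶠ s in 𝓝 0, ∃ B : ℝ → E →L[ℝ] E, ContDiffAt ℝ ∞ B 0 ∧ B 0 = 1 ∧
      (∀ᶠ t in 𝓝 0, deriv (deriv fun t => t • B t) t = -(R (s + t) * (t • B t))) ∧
      ∀ᶠ t in 𝓝 0, (B (-t)).det = (B t).det)
    {B : ℝ → E →L[ℝ] E} (hB : ContDiffAt ℝ ∞ B 0) (hB0 : B 0 = 1)
    (hode : ∀ᶠ t in 𝓝 0, deriv (deriv fun t => t • B t) t = -(R t * (t • B t)))
    {f : ℕ → ℝ} (hf : ∀ n, f n = taylorCoeff n fun t => (B t).det)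
    {X : ℕ → E →L[ℝ] E} (hX : ∀ n, X n = iteratedDeriv n R 0) {τ : (E →L[ℝ] E) → ℝ}
    (hτ : ∀ T, τ T = traceCLM E T) :
    f 2 = -(1 / 6) * τ (X 0) ∧
    f 4 = 1 / 72 * τ (X 0) ^ 2 - 1 / 180 * τ (X 0 * X 0) ∧
    f 6 = -(τ (X 0) ^ 3 / 1296) + τ (X 0) * τ (X 0 * X 0) / 1080 - τ (X 0 * (X 0 * X 0)) / 2835
      + τ (X 1 * X 1) / 10080 ∧
    f 8 = τ (X 0) ^ 4 / 31104 - τ (X 0) ^ 2 * τ (X 0 * X 0) / 12960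
      + τ (X 0) * τ (X 0 * (X 0 * X 0)) / 17010 - τ (X 0) * τ (X 1 * X 1) / 60480
      + τ (X 0 * X 0) ^ 2 / 64800 - τ (X 0 * (X 0 * (X 0 * X 0))) / 37800
      - τ (X 0 * (X 0 * X 2)) / 340200 + τ (X 0 * (X 1 * X 1)) / 54432
      - τ (X 2 * X 2) / 907200 := by
  obtain rfl : τ = traceCLM E := funext hτ
  obtain rfl : X = fun n => iteratedDeriv n R 0 := funext hX
  -- the data of the Riccati equation at the base point `s`
  have data : ∀ s, ContDiffAt ℝ ∞ R s → ∀ B : ℝ → E →L[ℝ] E, ContDiffAt ℝ ∞ B 0 → B 0 = 1 →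
      (∀ᶠ t in 𝓝 0, deriv (deriv fun t => t • B t) t = -(R (s + t) * (t • B t))) → ∀ n : ℕ,
      ((n : ℝ) + 3) • taylorCoeff (n + 1) (logDerivative B) =
      -(((n.factorial : ℝ))⁻¹ • iteratedDeriv n R s +
        ∑ i ∈ Finset.range (n + 1), taylorCoeff i (logDerivative B) *
          taylorCoeff (n - i) (logDerivative B)) := by
    intro s hRs B hB hB0 hode n
    have hRs' : ContDiffAt ℝ ∞ (fun t => R (s + t)) 0 := by
      have h1 : ContDiffAt ℝ ∞ R (s + 0) := by simpa using hRs
      exact h1.comp (0 : ℝ) (contDiffAt_const.add contDiffAt_id)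
    have hr : taylorCoeff n (fun t => R (s + t)) = ((n.factorial : ℝ))⁻¹ • iteratedDeriv n R s := by
      simp [taylorCoeff, iteratedDeriv_comp_const_add]
    rw [taylorCoeff_logDerivative_succ hRs' hB hB0 hode n, hr]
  set x : ℕ → ℝ → E →L[ℝ] E := fun n s => iteratedDeriv n R s with hx
  have dx : ∀ n, ∀ᶠ s in 𝓝 0, HasDerivAt (x n) (x (n + 1) s) s := fun n =>
    hR.mono fun s hs => hasDerivAt_iteratedDeriv hs n
  have dτ : ∀ {a : ℝ → E →L[ℝ] E} {a' : E →L[ℝ] E} {s : ℝ}, HasDerivAt a a' s →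
      HasDerivAt (fun s => traceCLM E (a s)) (traceCLM E a') s := fun h =>
    (traceCLM E).hasFDerivAt.comp_hasDerivAt _ h
  have comm : ∀ a b : E →L[ℝ] E, traceCLM E (a * b) = traceCLM E (b * a) := traceCLM_mul_comm
  -- the traces which vanish because the odd coefficients do
  have odd : ∀ᶠ s in 𝓝 0, traceCLM E (x 1 s) = 0 ∧
      (traceCLM E (x 3 s) = 0 → traceCLM E (x 0 s * x 1 s) = 0) ∧
      (traceCLM E (x 3 s) = 0 → traceCLM E (x 5 s) = 0 →
        traceCLM E (x 0 s * x 3 s) = -3 * traceCLM E (x 1 s * x 2 s) →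
        traceCLM E (x 0 s * (x 0 s * x 1 s)) = 3 / 16 * traceCLM E (x 1 s * x 2 s)) := by
    filter_upwards [hR, H] with s hs ⟨B, hB, hB0, hode, heven⟩
    exact traces_of_odd_coeff_eq_zero (τ := (traceCLM E : (E →L[ℝ] E) →ₗ[ℝ] ℝ))
      (v := fun n => taylorCoeff n (logDerivative B)) (X := fun n => x n s)
      (f := fun n => taylorCoeff n fun t => (B t).det) comm
      (taylorCoeff_logDerivative_zero hB hB0 hode) (data s hs B hB hB0 hode)
      (taylorCoeff_det_zero hB0) (taylorCoeff_det_succ hB hB0)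
      fun n => taylorCoeff_eq_zero_of_even heven (odd_two_mul_add_one n)
  -- as they vanish for all `s` near `0`, these traces can be differentiated with respect to `s`
  have z : ∀ n, ∀ᶠ s in 𝓝 0, traceCLM E (x (n + 1) s) = 0 := by
    intro n
    induction n with
    | zero => exact odd.mono fun s hs => hs.1
    | succ n ih => exact eventually_deriv_eq_zero ih ((dx _).mono fun s hs => dτ hs)
  have z01 : ∀ᶠ s in 𝓝 0, traceCLM E (x 0 s * x 1 s) = 0 := by
    filter_upwards [odd, z 2] with s hs h3 using hs.2.1 h3
  have z02 : ∀ᶠ s in 𝓝 0, traceCLM E (x 0 s * x 2 s) + traceCLM E (x 1 s * x 1 s) = 0 := by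
    refine eventually_deriv_eq_zero z01 ?_
    filter_upwards [dx 0, dx 1] with s h0 h1
    convert! dτ (h0.mul h1) using 1
    simp [add_comm]
  have z03 : ∀ᶠ s in 𝓝 0, traceCLM E (x 0 s * x 3 s) + 3 * traceCLM E (x 1 s * x 2 s) = 0 := by
    refine eventually_deriv_eq_zero z02 ?_
    filter_upwards [dx 0, dx 1, dx 2] with s h0 h1 h2
    convert! (dτ (h0.mul h2)).add (dτ (h1.mul h1)) using 1
    simp only [map_add, comm (x 2 s) (x 1 s)]
    ring
  have z04 : ∀ᶠ s in 𝓝 0, traceCLM E (x 0 s * x 4 s) + 4 * traceCLM E (x 1 s * x 3 s)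
      + 3 * traceCLM E (x 2 s * x 2 s) = 0 := by
    refine eventually_deriv_eq_zero z03 ?_
    filter_upwards [dx 0, dx 1, dx 2, dx 3] with s h0 h1 h2 h3
    convert! (dτ (h0.mul h3)).add ((dτ (h1.mul h2)).const_mul 3) using 1
    simp only [map_add]
    ring
  have z001 : ∀ᶠ s in 𝓝 0, traceCLM E (x 0 s * (x 0 s * x 1 s))
      - 3 / 16 * traceCLM E (x 1 s * x 2 s) = 0 := by
    filter_upwards [odd, z 2, z 4, z03] with s hs h3 h5 h03
    rw [hs.2.2 h3 h5 (by linarith), sub_self]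
  have z002 : ∀ᶠ s in 𝓝 0, traceCLM E (x 0 s * (x 0 s * x 2 s))
      + 2 * traceCLM E (x 0 s * (x 1 s * x 1 s))
      - 3 / 16 * (traceCLM E (x 2 s * x 2 s) + traceCLM E (x 1 s * x 3 s)) = 0 := by
    refine eventually_deriv_eq_zero z001 ?_
    filter_upwards [dx 0, dx 1, dx 2] with s h0 h1 h2
    convert! (dτ (h0.mul (h0.mul h1))).sub ((dτ (h1.mul h2)).const_mul (3 / 16)) using 1
    have e : traceCLM E (x 1 s * (x 0 s * x 1 s)) = traceCLM E (x 0 s * (x 1 s * x 1 s)) := by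
      rw [comm, mul_assoc]
    simp only [map_add, mul_add, Pi.mul_apply, e]
    ring
  refine coeff_of_traces (τ := (traceCLM E : (E →L[ℝ] E) →ₗ[ℝ] ℝ))
      (v := fun n => taylorCoeff n (logDerivative B)) (X := fun n => x n 0)
      (f := f) comm
      (taylorCoeff_logDerivative_zero hB hB0 hode)
      (data 0 hR.self_of_nhds B hB hB0 (by simpa using hode))
      (by rw [hf, taylorCoeff_det_zero hB0])
      (fun n => by simp only [hf]; exact taylorCoeff_det_succ hB hB0 n)
      (fun n => (z n).self_of_nhds) z01.self_of_nhds ?_ ?_ ?_ ?_ ?_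
  · linear_combination z02.self_of_nhds
  · linear_combination z03.self_of_nhds
  · linear_combination z04.self_of_nhds
  · linear_combination z001.self_of_nhds
  · linear_combination z002.self_of_nhds

end EvenDeterminant

/-! ### Autonomous differential equations: uniqueness, smoothness, dependence on initial values -/

section ODE

variable {Z : Type*} [NormedAddCommGroup Z] [NormedSpace ℝ Z]

/-- Two integral curves on an interval with the same initial value agree. -/
lemma ode_unique_Icc {F : Z → Z} {U : Set Z} (hU : IsOpen U) (hF : ContDiffOn ℝ 1 F U)
    {a b : ℝ} {y z : ℝ → Z} (hy : ∀ t ∈ Icc a b, HasDerivWithinAt y (F (y t)) (Icc a b) t)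
    (hyU : ∀ t ∈ Icc a b, y t ∈ U)
    (hz : ∀ t ∈ Icc a b, HasDerivWithinAt z (F (z t)) (Icc a b) t)
    (hzU : ∀ t ∈ Icc a b, z t ∈ U) (h : y a = z a) : EqOn y z (Icc a b) := by
  have hyc : ContinuousOn y (Icc a b) := fun t ht => (hy t ht).continuousWithinAt
  have hzc : ContinuousOn z (Icc a b) := fun t ht => (hz t ht).continuousWithinAt
  have hK : IsCompact (y '' Icc a b ∪ z '' Icc a b) :=
    (isCompact_Icc.image_of_continuousOn hyc).union (isCompact_Icc.image_of_continuousOn hzc)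
  have hKU : y '' Icc a b ∪ z '' Icc a b ⊆ U := by
    rintro _ (⟨t, ht, rfl⟩ | ⟨t, ht, rfl⟩)
    exacts [hyU t ht, hzU t ht]
  have hL : LocallyLipschitzOn (y '' Icc a b ∪ z '' Icc a b) F := by
    intro x hx
    obtain ⟨K, t, ht, hKt⟩ :=
      (hF.contDiffAt (hU.mem_nhds (hKU hx))).exists_lipschitzOnWith
    exact ⟨K, t, mem_nhdsWithin_of_mem_nhds ht, hKt⟩
  obtain ⟨K, hK⟩ := hL.exists_lipschitzOnWith_of_compact hK
  have aux : ∀ {w : ℝ → Z}, (∀ t ∈ Icc a b, HasDerivWithinAt w (F (w t)) (Icc a b) t) →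
      ∀ t ∈ Ico a b, HasDerivWithinAt w (F (w t)) (Ici t) t := fun hw t ht =>
    (hw t (Ico_subset_Icc_self ht)).mono_of_mem_nhdsWithin (Icc_mem_nhdsGE_of_mem ht)
  exact ODE_solution_unique_of_mem_Icc_right (v := fun _ => F)
    (s := fun _ => y '' Icc a b ∪ z '' Icc a b) (fun _ _ => hK) hyc (aux hy)
    (fun t ht => Or.inl ⟨t, Ico_subset_Icc_self ht, rfl⟩) hzc (aux hz)
    (fun t ht => Or.inr ⟨t, Ico_subset_Icc_self ht, rfl⟩) h

lemma ode_unique_nhds {F : Z → Z} {y z : ℝ → Z} {s : ℝ} (hF : ContDiffAt ℝ 1 F (y s))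
    (hy : ∀ᶠ t in 𝓝 s, HasDerivAt y (F (y t)) t) (hz : ∀ᶠ t in 𝓝 s, HasDerivAt z (F (z t)) t)
    (h : y s = z s) : y =ᶠ[𝓝 s] z := by
  obtain ⟨K, u, hu, hK⟩ := hF.exists_lipschitzOnWith
  have hyu : ∀ᶠ t in 𝓝 s, y t ∈ u := hy.self_of_nhds.continuousAt hu
  have hzu : ∀ᶠ t in 𝓝 s, z t ∈ u := hz.self_of_nhds.continuousAt (h ▸ hu)
  exact ODE_solution_unique_of_eventually (v := fun _ => F) (s := fun _ => u)
    (Eventually.of_forall fun _ => hK) (hy.and hyu) (hz.and hzu) h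

lemma ode_contDiffAt [CompleteSpace Z] {F : Z → Z} {U : Set Z} (hU : IsOpen U)
    (hF : ContDiffOn ℝ ∞ F U) {z : ℝ → Z} {s : ℝ}
    (hz : ∀ᶠ t in 𝓝 s, HasDerivAt z (F (z t)) t) (hs : z s ∈ U) :
    ContDiffAt ℝ ∞ z s := by
  have hzU : ∀ᶠ t in 𝓝 s, z t ∈ U := hz.self_of_nhds.continuousAt (hU.mem_nhds hs)
  obtain ⟨ε, hε, h⟩ := Metric.eventually_nhds_iff_ball.1 (hz.and hzU)
  have hsub : Icc (s - ε / 2) (s + ε / 2) ⊆ Metric.ball s ε := by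
    intro t ht
    rw [Real.ball_eq_Ioo]
    exact ⟨by linarith [ht.1], by linarith [ht.2]⟩
  have hF' : ContDiffOn ℝ ∞ (Function.uncurry fun _ : ℝ => F)
      (Icc (s - ε / 2) (s + ε / 2) ×ˢ U) :=
    hF.comp contDiff_snd.contDiffOn fun p hp => hp.2
  have := ODE.contDiffOn_enat_Icc_of_hasDerivWithinAt (n := ⊤) hF'
    (fun t ht => (h t (hsub ht)).1.hasDerivWithinAt) fun t ht => (h t (hsub ht)).2
  exact this.contDiffAt (Icc_mem_nhds (by linarith) (by linarith))

/-- Grönwall's inequality on both sides of the initial time. -/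
lemma norm_le_gronwallBound_abs {d d' : ℝ → Z} {δ K ε : ℝ}
    (hd : ∀ t ∈ Ioo (-δ) δ, HasDerivAt d (d' t) t) (h0 : d 0 = 0)
    (hb : ∀ t ∈ Ioo (-δ) δ, ‖d' t‖ ≤ K * ‖d t‖ + ε) :
    ∀ t ∈ Ioo (-δ) δ, ‖d t‖ ≤ gronwallBound 0 K ε |t| := by
  have key : ∀ {d d' : ℝ → Z}, (∀ t ∈ Ioo (-δ) δ, HasDerivAt d (d' t) t) → d 0 = 0 →
      (∀ t ∈ Ioo (-δ) δ, ‖d' t‖ ≤ K * ‖d t‖ + ε) →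
      ∀ t ∈ Ioo (-δ) δ, 0 ≤ t → ‖d t‖ ≤ gronwallBound 0 K ε t := by
    intro d d' hd h0 hb t ht ht0
    have hsub : Icc 0 t ⊆ Ioo (-δ) δ := fun s hs => ⟨by linarith [hs.1, ht.1, ht.2],
      by linarith [hs.2, ht.2]⟩
    have := norm_le_gronwallBound_of_norm_deriv_right_le (f := d) (f' := d') (δ := 0) (K := K)
      (ε := ε) (a := 0) (b := t)
      (fun s hs => (hd s (hsub hs)).continuousAt.continuousWithinAt)
      (fun s hs => (hd s (hsub (Ico_subset_Icc_self hs))).hasDerivWithinAt) (by simp [h0])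
      (fun s hs => hb s (hsub (Ico_subset_Icc_self hs))) t ⟨ht0, le_rfl⟩
    simpa using this
  intro t ht
  rcases le_total 0 t with h | h
  · rw [abs_of_nonneg h]; exact key hd h0 hb t ht h
  · rw [abs_of_nonpos h]
    have := key (d := fun s => d (-s)) (d' := fun s => - d' (-s))
      (fun s hs => by
        have := (hd (-s) ⟨by linarith [hs.2], by linarith [hs.1]⟩).scomp s (hasDerivAt_neg s)
        convert! this using 1
        simp)
      (by simp [h0])
      (fun s hs => by
        rw [norm_neg]
        exact hb (-s) ⟨by linarith [hs.2], by linarith [hs.1]⟩)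
      (-t) ⟨by linarith [ht.2], by linarith [ht.1]⟩ (by linarith)
    simpa using this

/-- The local flow of a smooth vector field `F` near `z₀` is differentiable with respect to the
initial value at `z₀`, and its derivative `Y` solves the variational equation. -/
theorem exists_flow_hasFDerivAt [CompleteSpace Z] {F : Z → Z} {U : Set Z} (hU : IsOpen U)
    (hF : ContDiffOn ℝ ∞ F U) {z₀ : Z} (hz₀ : z₀ ∈ U) :
    ∃ δ > 0, ∃ r > 0, ∃ α : Z → ℝ → Z, ∃ Y : ℝ → Z →L[ℝ] Z,
      (∀ z ∈ Metric.ball z₀ r, α z 0 = z ∧ ∀ t ∈ Ioo (-δ) δ, α z t ∈ U ∧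
        HasDerivAt (α z) (F (α z t)) t) ∧
      Y 0 = ContinuousLinearMap.id ℝ Z ∧
      (∀ t ∈ Ioo (-δ) δ, HasDerivAt Y ((fderiv ℝ F (α z₀ t)).comp (Y t)) t) ∧
      ∀ t ∈ Ioo (-δ) δ, HasFDerivAt (fun z => α z t) (Y t) z₀ := by
  have hFz : ContDiffAt ℝ ∞ F z₀ := hF.contDiffAt (hU.mem_nhds hz₀)
  have hF1 : ContDiffAt ℝ 1 F z₀ := hFz.of_le (by exact_mod_cast le_top)
  have hdF : ContDiffOn ℝ ∞ (fderiv ℝ F) U := hF.fderiv_of_isOpen hU (by simp)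
  -- a ball in `U` on which `DF` is bounded and Lipschitz
  obtain ⟨K₂, s, hs, hK₂⟩ := ((hdF.contDiffAt (hU.mem_nhds hz₀)).of_le (m := 1)
    (by exact_mod_cast le_top)).exists_lipschitzOnWith
  set K : ℝ := ‖fderiv ℝ F z₀‖ + 1 with hKdef
  have hKpos : 0 < K := by positivity
  have hs' : ∀ᶠ z in 𝓝 z₀, ‖fderiv ℝ F z‖ < K :=
    ((hdF.contDiffAt (hU.mem_nhds hz₀)).continuousAt.norm).eventually_lt_const (by simp [hKdef])
  obtain ⟨ρ, hρ, hρs⟩ := Metric.eventually_nhds_iff_ball.1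
    ((hs'.and (hU.mem_nhds hz₀)).and hs)
  have hball : ∀ z ∈ Metric.ball z₀ ρ, DifferentiableAt ℝ F z := fun z hz =>
    (hF.contDiffAt (hU.mem_nhds (hρs z hz).1.2)).differentiableAt (by simp)
  have hquad : ∀ x ∈ Metric.ball z₀ ρ, ∀ y ∈ Metric.ball z₀ ρ,
      ‖F y - F x - fderiv ℝ F x (y - x)‖ ≤ K₂ * ‖y - x‖ * ‖y - x‖ := by
    intro x hx y hy
    have hseg : segment ℝ x y ⊆ Metric.ball z₀ ρ := (convex_ball z₀ ρ).segment_subset hx hy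
    refine (convex_segment x y).norm_image_sub_le_of_norm_fderiv_le' (fun z hz => hball z (hseg hz))
      (fun z hz => ?_) (left_mem_segment ℝ x y) (right_mem_segment ℝ x y)
    refine (hK₂.norm_sub_le (hρs z (hseg hz)).2 (hρs x hx).2).trans ?_
    gcongr
    exact norm_sub_le_of_mem_segment hz
  -- the flow
  obtain ⟨ε, hε, a, r, L, K₀, hr, hpl⟩ := IsPicardLindelof.of_contDiffAt_one hF1
  obtain ⟨α, hα, L', hL'⟩ :=
    (hpl 0).exists_forall_mem_closedBall_eq_hasDerivWithinAt_lipschitzOnWith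
  simp only [zero_sub, zero_add] at hα hL'
  have hα' : ∀ z ∈ Metric.closedBall z₀ r, ∀ t ∈ Ioo (-ε) ε, HasDerivAt (α z) (F (α z t)) t :=
    fun z hz t ht => ((hα z hz).2 t (Ioo_subset_Icc_self ht)).hasDerivAt (Icc_mem_nhds ht.1 ht.2)
  have hz₀r : z₀ ∈ Metric.closedBall z₀ (r : ℝ) := Metric.mem_closedBall_self r.2
  have h0ε : (0 : ℝ) ∈ Ioo (-ε) ε := ⟨by linarith, hε⟩
  have hα0 : α z₀ 0 = z₀ := (hα z₀ hz₀r).1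
  -- the variational equation
  let T : Z × (Z →L[ℝ] Z) → Z × (Z →L[ℝ] Z) := fun p => (F p.1, (fderiv ℝ F p.1).comp p.2)
  have hT : ContDiffAt ℝ 1 T (z₀, ContinuousLinearMap.id ℝ Z) := by
    have h1 : ContDiffAt ℝ 1 (fun p : Z × (Z →L[ℝ] Z) => fderiv ℝ F p.1)
        (z₀, ContinuousLinearMap.id ℝ Z) :=
      ContDiffAt.comp (z₀, ContinuousLinearMap.id ℝ Z) (g := fderiv ℝ F) (f := Prod.fst)
        ((hdF.contDiffAt (hU.mem_nhds hz₀)).of_le (by exact_mod_cast le_top)) contDiffAt_fst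
    have h2 : ContDiffAt ℝ 1 (fun p : Z × (Z →L[ℝ] Z) => F p.1) (z₀, ContinuousLinearMap.id ℝ Z) :=
      ContDiffAt.comp (z₀, ContinuousLinearMap.id ℝ Z) (g := F) (f := Prod.fst) hF1 contDiffAt_fst
    exact h2.prodMk (h1.clm_comp contDiffAt_snd)
  obtain ⟨β, hβ0, ε', hε', hβ⟩ :=
    hT.exists_forall_mem_closedBall_exists_eq_forall_mem_Ioo_hasDerivAt₀ 0
  rw [zero_sub, zero_add] at hβ
  have hβ1 : ∀ t ∈ Ioo (-ε') ε', HasDerivAt (fun t => (β t).1) (F (β t).1) t := fun t ht =>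
    (hβ t ht).fst
  have hβ2 : ∀ t ∈ Ioo (-ε') ε',
      HasDerivAt (fun t => (β t).2) ((fderiv ℝ F (β t).1).comp (β t).2) t := fun t ht =>
    (hβ t ht).snd
  have hagree : α z₀ =ᶠ[𝓝 0] fun t => (β t).1 := by
    refine ode_unique_nhds (by rwa [hα0]) ?_ ?_ (by rw [hα0, hβ0])
    · filter_upwards [Ioo_mem_nhds h0ε.1 h0ε.2] with t ht using hα' z₀ hz₀r t ht
    · filter_upwards [Ioo_mem_nhds (neg_lt_zero.2 hε') hε'] with t ht using hβ1 t ht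
  have hnear : ∀ᶠ t in 𝓝 (0 : ℝ), α z₀ t ∈ Metric.ball z₀ (ρ / 2) := by
    have hc : ContinuousAt (α z₀) 0 := (hα' z₀ hz₀r 0 h0ε).continuousAt
    exact hc (by rw [hα0]; exact Metric.ball_mem_nhds _ (by positivity))
  obtain ⟨δ, hδ, hδs⟩ := Metric.eventually_nhds_iff_ball.1
    (((hagree.and hnear).and (Ioo_mem_nhds h0ε.1 h0ε.2)).and
      (Ioo_mem_nhds (neg_lt_zero.2 hε') hε'))
  rw [Real.ball_eq_Ioo, zero_sub, zero_add] at hδs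
  set r' : ℝ := min r (ρ / (2 * (L' + 1))) with hr'
  have hr'pos : 0 < r' := lt_min (by exact_mod_cast hr) (by positivity)
  have hsubr : Metric.ball z₀ r' ⊆ Metric.closedBall z₀ r :=
    (Metric.ball_subset_ball (min_le_left _ _)).trans Metric.ball_subset_closedBall
  have hlip : ∀ z ∈ Metric.ball z₀ r', ∀ t ∈ Ioo (-δ) δ,
      ‖α z t - α z₀ t‖ ≤ L' * ‖z - z₀‖ := fun z hz t ht =>
    (hL' t (Ioo_subset_Icc_self (hδs t ht).1.2)).norm_sub_le (hsubr hz) hz₀r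
  have hmem : ∀ z ∈ Metric.ball z₀ r', ∀ t ∈ Ioo (-δ) δ, α z t ∈ Metric.ball z₀ ρ := by
    intro z hz t ht
    have h1 := hlip z hz t ht
    have h2 : ‖α z₀ t - z₀‖ < ρ / 2 := by simpa [dist_eq_norm] using (hδs t ht).1.1.2
    have h3 : ‖z - z₀‖ < ρ / (2 * (L' + 1)) := by
      have : ‖z - z₀‖ < r' := by simpa [dist_eq_norm] using hz
      exact this.trans_le (min_le_right _ _)
    have h4 : (L' : ℝ) * ‖z - z₀‖ ≤ ρ / 2 := by
      have : ((L' : ℝ) + 1) * (ρ / (2 * (L' + 1))) = ρ / 2 := by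
        have : (L' : ℝ) + 1 ≠ 0 := by positivity
        field_simp
      rw [← this]
      gcongr
      linarith
    rw [Metric.mem_ball, dist_eq_norm]
    have h5 := norm_add_le (α z t - α z₀ t) (α z₀ t - z₀)
    rw [sub_add_sub_cancel] at h5
    linarith
  have heqβ : ∀ t ∈ Ioo (-δ) δ, α z₀ t = (β t).1 := fun t ht => (hδs t ht).1.1.1
  have hz₀' : z₀ ∈ Metric.ball z₀ r' := Metric.mem_ball_self hr'pos
  refine ⟨δ, hδ, r', hr'pos, α, fun t => (β t).2, fun z hz => ⟨(hα z (hsubr hz)).1, fun t ht =>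
    ⟨(hρs _ (hmem z hz t ht)).1.2, hα' z (hsubr hz) t (hδs t ht).1.2⟩⟩, by simp only [hβ0],
    fun t ht => ?_, fun t ht => ?_⟩
  · rw [heqβ t ht]; exact hβ2 t (hδs t ht).2
  · -- the error of the linear approximation satisfies the variational equation up to a term of
    -- second order, so Grönwall's inequality bounds it quadratically
    have est : ∀ z ∈ Metric.ball z₀ r',
        ‖α z t - α z₀ t - (β t).2 (z - z₀)‖ ≤
          K₂ * L' ^ 2 / K * (Real.exp (K * |t|) - 1) * ‖z - z₀‖ ^ 2 := by
      intro z hz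
      have hd := norm_le_gronwallBound_abs (d := fun t => α z t - α z₀ t - (β t).2 (z - z₀))
        (d' := fun t => F (α z t) - F (α z₀ t) - fderiv ℝ F (α z₀ t) ((β t).2 (z - z₀)))
        (δ := δ) (K := K) (ε := K₂ * L' ^ 2 * ‖z - z₀‖ ^ 2)
        (fun t ht => ?_) ?_ (fun t ht => ?_) t ht
      · refine hd.trans (le_of_eq ?_)
        rw [gronwallBound_of_K_ne_0 hKpos.ne']
        ring
      · have h1 := hβ2 t (hδs t ht).2
        rw [← heqβ t ht] at h1
        exact ((hα' z (hsubr hz) t (hδs t ht).1.2).sub (hα' z₀ hz₀r t (hδs t ht).1.2)).sub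
          (h1.clm_apply (hasDerivAt_const t (z - z₀)) |>.congr_deriv (by simp))
      · simp [hα0, hβ0, (hα z (hsubr hz)).1]
      · have e : F (α z t) - F (α z₀ t) - fderiv ℝ F (α z₀ t) ((β t).2 (z - z₀)) =
            fderiv ℝ F (α z₀ t) (α z t - α z₀ t - (β t).2 (z - z₀)) +
            (F (α z t) - F (α z₀ t) - fderiv ℝ F (α z₀ t) (α z t - α z₀ t)) := by
          rw [map_sub (fderiv ℝ F (α z₀ t)) (α z t - α z₀ t)]
          abel
        rw [e]
        refine (norm_add_le _ _).trans (add_le_add ?_ ?_)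
        · refine (ContinuousLinearMap.le_opNorm _ _).trans ?_
          gcongr
          exact (hρs _ (hmem z₀ hz₀' t ht)).1.1.le
        · refine (hquad _ (hmem z₀ hz₀' t ht) _ (hmem z hz t ht)).trans ?_
          have h1 := hlip z hz t ht
          calc (K₂ : ℝ) * ‖α z t - α z₀ t‖ * ‖α z t - α z₀ t‖
              ≤ K₂ * (L' * ‖z - z₀‖) * (L' * ‖z - z₀‖) := by gcongr
            _ = K₂ * L' ^ 2 * ‖z - z₀‖ ^ 2 := by ring
    refine HasFDerivAt.of_isLittleO (Asymptotics.IsBigO.trans_isLittleO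
      (Asymptotics.IsBigO.of_bound (K₂ * L' ^ 2 / K * (Real.exp (K * |t|) - 1)) ?_)
      (Asymptotics.isLittleO_pow_sub_sub z₀ one_lt_two))
    filter_upwards [Metric.ball_mem_nhds z₀ hr'pos] with z hz
    simpa using est z hz

end ODE

set_option maxSynthPendingDepth 3

/-! ### Metrics in coordinates and their Christoffel symbols -/

section CoordMetric

variable {E : Type*} [NormedAddCommGroup E] [NormedSpace ℝ E]

/-- `G` is a smooth Riemannian metric on the open set `U` of the coordinate space. -/
structure IsCoordMetric (G : E → E →L[ℝ] E →L[ℝ] ℝ) (U : Set E) : Prop where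
  isOpen : IsOpen U
  contDiffOn : ContDiffOn ℝ ∞ G U
  symm : ∀ y ∈ U, ∀ u v, G y u v = G y v u
  pos : ∀ y ∈ U, ∀ v, v ≠ 0 → 0 < G y v v

lemma IsCoordMetric.mono {G : E → E →L[ℝ] E →L[ℝ] ℝ} {U N : Set E} (hG : IsCoordMetric G U)
    (hN : IsOpen N) (h : N ⊆ U) : IsCoordMetric G N :=
  ⟨hN, hG.contDiffOn.mono h, fun y hy => hG.symm y (h hy), fun y hy => hG.pos y (h hy)⟩

/-- Interchange of the arguments: `koszulFlip D u v w = D w u v`. -/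
def koszulFlip (E : Type*) [NormedAddCommGroup E] [NormedSpace ℝ E] :
    (E →L[ℝ] E →L[ℝ] E →L[ℝ] ℝ) →L[ℝ] (E →L[ℝ] E →L[ℝ] E →L[ℝ] ℝ) :=
  (ContinuousLinearMap.compL ℝ E (E →L[ℝ] E →L[ℝ] ℝ) (E →L[ℝ] E →L[ℝ] ℝ)
    ((ContinuousLinearMap.flipₗᵢ ℝ E E ℝ).toContinuousLinearEquiv :
      (E →L[ℝ] E →L[ℝ] ℝ) →L[ℝ] (E →L[ℝ] E →L[ℝ] ℝ))).comp
  ((ContinuousLinearMap.flipₗᵢ ℝ E E (E →L[ℝ] ℝ)).toContinuousLinearEquiv :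
      (E →L[ℝ] E →L[ℝ] E →L[ℝ] ℝ) →L[ℝ] (E →L[ℝ] E →L[ℝ] E →L[ℝ] ℝ))

/-- The right-hand side of the Koszul formula, as a continuous linear function of the derivative
of the metric. -/
def koszul (E : Type*) [NormedAddCommGroup E] [NormedSpace ℝ E] :
    (E →L[ℝ] E →L[ℝ] E →L[ℝ] ℝ) →L[ℝ] (E →L[ℝ] E →L[ℝ] E →L[ℝ] ℝ) :=
  (1 / 2 : ℝ) • (ContinuousLinearMap.id ℝ _ +
    ((ContinuousLinearMap.flipₗᵢ ℝ E E (E →L[ℝ] ℝ)).toContinuousLinearEquiv :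
      (E →L[ℝ] E →L[ℝ] E →L[ℝ] ℝ) →L[ℝ] (E →L[ℝ] E →L[ℝ] E →L[ℝ] ℝ)) - koszulFlip E)

lemma koszul_apply (D : E →L[ℝ] E →L[ℝ] E →L[ℝ] ℝ) (u v : E) :
    koszul E D u v = (1 / 2 : ℝ) • (D u v + D v u - (D.flip u).flip v) := rfl

/-- The Christoffel symbols as a continuous bilinear map. -/
def christoffelCLM (G : E → E →L[ℝ] E →L[ℝ] ℝ) (y : E) : E →L[ℝ] E →L[ℝ] E :=
  (ContinuousLinearMap.compL ℝ E (E →L[ℝ] ℝ) E (G y).inverse).comp (koszul E (fderiv ℝ G y))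

lemma christoffelCLM_apply (G : E → E →L[ℝ] E →L[ℝ] ℝ) (y u v : E) :
    christoffelCLM G y u v = christoffel G y u v := rfl

namespace IsCoordMetric

variable {G : E → E →L[ℝ] E →L[ℝ] ℝ} {U : Set E}

lemma fderiv_symm (hG : IsCoordMetric G U) {y : E} (hy : y ∈ U) (u v w : E) :
    fderiv ℝ G y u v w = fderiv ℝ G y u w v := by
  have hy' := hG.isOpen.mem_nhds hy
  have hd : HasFDerivAt G (fderiv ℝ G y) y :=
    ((hG.contDiffOn.contDiffAt hy').differentiableAt (by simp)).hasFDerivAt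
  have h1 : ∀ v w, HasFDerivAt (fun z => G z v w)
      (((fderiv ℝ G y).flip v).flip w) y := fun v w => by
    simpa using (hd.clm_apply (hasFDerivAt_const v y)).clm_apply (hasFDerivAt_const w y)
  have h2 : (fun z => G z v w) =ᶠ[𝓝 y] fun z => G z w v := by
    filter_upwards [hy'] with z hz using hG.symm z hz v w
  have h3 := (h1 v w).unique ((h1 w v).congr_of_eventuallyEq h2)
  simpa using DFunLike.congr_fun h3 u

lemma eq_of_forall_inner_eq (hG : IsCoordMetric G U) {y : E} (hy : y ∈ U) {a b : E}
    (h : ∀ w, G y a w = G y b w) : a = b := by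
  by_contra hab
  have h1 := hG.pos y hy (a - b) (sub_ne_zero.2 hab)
  have h2 := h (a - b)
  rw [map_sub (G y), sub_apply] at h1
  linarith

variable [FiniteDimensional ℝ E]

lemma isInvertible (hG : IsCoordMetric G U) {y : E} (hy : y ∈ U) : (G y).IsInvertible := by
  have hinj : Function.Injective (G y : E →ₗ[ℝ] E →L[ℝ] ℝ) := by
    refine (injective_iff_map_eq_zero _).2 fun v hv => ?_
    by_contra h
    have h1 := hG.pos y hy v h
    have h2 : G y v = 0 := hv
    rw [h2] at h1
    simp at h1
  have hfin : Module.finrank ℝ E = Module.finrank ℝ (E →L[ℝ] ℝ) := by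
    rw [← (LinearMap.toContinuousLinearMap (𝕜 := ℝ) (E := E) (F' := ℝ)).finrank_eq]
    exact (Subspace.dual_finrank_eq (K := ℝ) (V := E)).symm
  refine ⟨(LinearEquiv.ofInjectiveOfFinrankEq _ hinj hfin).toContinuousLinearEquiv, ?_⟩
  ext v w
  simp
  rfl

lemma contDiffOn_christoffelCLM (hG : IsCoordMetric G U) :
    ContDiffOn ℝ ∞ (christoffelCLM G) U := by
  intro y hy
  have hy' := hG.isOpen.mem_nhds hy
  have h1 : ContDiffAt ℝ ∞ G y := hG.contDiffOn.contDiffAt hy'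
  have h2 : ContDiffAt ℝ ∞ (fun z => (G z).inverse) y :=
    ((hG.isInvertible hy).contDiffAt_map_inverse).comp y h1
  have h3 : ContDiffAt ℝ ∞ (fun z => koszul E (fderiv ℝ G z)) y :=
    (koszul E).contDiff.contDiffAt.comp y (h1.fderiv_right (by simp))
  have h4 : ContDiffAt ℝ ∞
      (fun z => ContinuousLinearMap.compL ℝ E (E →L[ℝ] ℝ) E (G z).inverse) y :=
    (ContinuousLinearMap.compL ℝ E (E →L[ℝ] ℝ) E).contDiff.contDiffAt.comp y h2
  exact (h4.clm_comp h3).contDiffWithinAt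

lemma koszul_formula (hG : IsCoordMetric G U) {y : E} (hy : y ∈ U) (u v w : E) :
    G y (christoffelCLM G y u v) w =
      (fderiv ℝ G y u v w + fderiv ℝ G y v u w - fderiv ℝ G y w u v) / 2 := by
  have h : G y (christoffelCLM G y u v) = koszul E (fderiv ℝ G y) u v := by
    obtain ⟨e, he⟩ := hG.isInvertible hy
    change G y ((G y).inverse _) = _
    rw [← he]
    simp
  rw [h, koszul_apply]
  simp
  ring

lemma christoffel_symm (hG : IsCoordMetric G U) {y : E} (hy : y ∈ U) (u v : E) :
    christoffelCLM G y u v = christoffelCLM G y v u := by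
  refine hG.eq_of_forall_inner_eq hy fun w => ?_
  rw [hG.koszul_formula hy, hG.koszul_formula hy, hG.fderiv_symm hy w u v]
  ring

/-- The Levi-Civita connection is metric. -/
lemma fderiv_eq (hG : IsCoordMetric G U) {y : E} (hy : y ∈ U) (u v w : E) :
    fderiv ℝ G y u v w = G y (christoffelCLM G y u v) w + G y v (christoffelCLM G y u w) := by
  rw [hG.symm y hy v, hG.koszul_formula hy, hG.koszul_formula hy, hG.fderiv_symm hy u w v]
  ring

end IsCoordMetric

end CoordMetric

/-! ### Tensor fields and the covariant derivatives of the curvature -/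

section Tensor

variable {E : Type*} [NormedAddCommGroup E] [NormedSpace ℝ E]

/-- `T` is a smooth vector valued tensor field on `U`: it is smooth jointly in the point and the
arguments, and multilinear in the arguments. -/
structure IsTensorField {n : ℕ} (T : E → (Fin n → E) → E) (U : Set E) : Prop where
  contDiffAt : ∀ y ∈ U, ∀ w, ContDiffAt ℝ ∞ (fun p : E × (Fin n → E) => T p.1 p.2) (y, w)
  multilinear : ∀ y ∈ U, ∃ f : MultilinearMap ℝ (fun _ : Fin n => E) E, ∀ w, f w = T y w

variable {G : E → E →L[ℝ] E →L[ℝ] ℝ} {U : Set E} {n : ℕ} {T : E → (Fin n → E) → E}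

namespace IsTensorField

lemma differentiableAt_left (hT : IsTensorField T U) {y : E} (hy : y ∈ U) (w : Fin n → E) :
    DifferentiableAt ℝ (fun z => T z w) y := by
  have h1 : ContDiffAt ℝ ∞ (fun z => T z w) y :=
    (hT.contDiffAt y hy w).comp y (contDiffAt_id.prodMk contDiffAt_const)
  exact h1.differentiableAt (by simp)

/-- The partial derivatives of a tensor field with respect to the point and to the arguments. -/
lemma fderiv_apply (hT : IsTensorField T U) {y : E} (hy : y ∈ U) (w : Fin n → E)
    (a : E) (h : Fin n → E) :
    fderiv ℝ (fun p : E × (Fin n → E) => T p.1 p.2) (y, w) (a, h) =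
      fderiv ℝ (fun z => T z w) y a + ∑ i, T y (Function.update w i (h i)) := by
  have hd := ((hT.contDiffAt y hy w).differentiableAt (by simp)).hasFDerivAt
  have h1 : HasFDerivAt (fun z => T z w) _ y :=
    hd.comp (f := fun z => (z, w)) y ((hasFDerivAt_id y).prodMk (hasFDerivAt_const w y))
  have h2 : HasFDerivAt (fun w => T y w) _ w :=
    hd.comp (f := fun w => (y, w)) w ((hasFDerivAt_const y w).prodMk (hasFDerivAt_id w))
  obtain ⟨f, hf⟩ := hT.multilinear y hy
  have hcont : Continuous f := by
    refine continuous_iff_continuousAt.2 fun w => ?_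
    have h3 : ContDiffAt ℝ ∞ (fun w => T y w) w :=
      (hT.contDiffAt y hy w).comp w (contDiffAt_const.prodMk contDiffAt_id)
    exact h3.continuousAt.congr (Eventually.of_forall fun w => (hf w).symm)
  have h3 := ContinuousMultilinearMap.hasFDerivAt (⟨f, hcont⟩ :
    ContinuousMultilinearMap ℝ (fun _ : Fin n => E) E) w
  have h4 := h2.unique (h3.congr_of_eventuallyEq (Eventually.of_forall fun w => (hf w).symm))
  have h5 := DFunLike.congr_fun h4 h
  rw [ContinuousMultilinearMap.linearDeriv_apply] at h5
  have h6 : ∑ i, T y (Function.update w i (h i)) =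
      fderiv ℝ (fun p : E × (Fin n → E) => T p.1 p.2) (y, w) (0, h) := by
    simp only [← hf]
    exact h5.symm
  rw [h1.fderiv, h6]
  simp [← map_add]

lemma fderiv_left_multilinear (hT : IsTensorField T U) (hU : IsOpen U) {y : E} (hy : y ∈ U)
    (v : E) : ∃ f : MultilinearMap ℝ (fun _ : Fin n => E) E,
      ∀ w, f w = fderiv ℝ (fun z => T z w) y v := by
  refine ⟨⟨fun w => fderiv ℝ (fun z => T z w) y v, fun w i a b => ?_, fun w i r a => ?_⟩,
    fun w => rfl⟩
  · have h : (fun z => T z (Function.update w i (a + b))) =ᶠ[𝓝 y]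
        fun z => T z (Function.update w i a) + T z (Function.update w i b) := by
      filter_upwards [hU.mem_nhds hy] with z hz
      obtain ⟨f, hf⟩ := hT.multilinear z hz
      rw [← hf, ← hf, ← hf, f.map_update_add]
    rw [h.fderiv_eq, fderiv_fun_add (hT.differentiableAt_left hy _)
      (hT.differentiableAt_left hy _)]
    rfl
  · have h : (fun z => T z (Function.update w i (r • a))) =ᶠ[𝓝 y]
        fun z => r • T z (Function.update w i a) := by
      filter_upwards [hU.mem_nhds hy] with z hz
      obtain ⟨f, hf⟩ := hT.multilinear z hz
      rw [← hf, ← hf, f.map_update_smul]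
    rw [h.fderiv_eq, fderiv_fun_const_smul (hT.differentiableAt_left hy _)]
    rfl

end IsTensorField

/-- The covariant derivative of a tensor field along a curve, evaluated on parallel fields. -/
lemma IsTensorField.hasDerivAt (hT : IsTensorField T U) {c : ℝ → E} {c' : E} {w : ℝ → Fin n → E}
    {t : ℝ} (ht : c t ∈ U) (hc : HasDerivAt c c' t)
    (hw : ∀ i, HasDerivAt (fun t => w t i) (-christoffel G (c t) c' (w t i)) t) :
    HasDerivAt (fun t => T (c t) (w t))
      (HarmonicSpace.covDeriv G T (c t) (Fin.snoc (w t) c')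
        - christoffel G (c t) c' (T (c t) (w t))) t := by
  have hd := ((hT.contDiffAt (c t) ht (w t)).differentiableAt (by simp)).hasFDerivAt
  have h1 := hd.comp_hasDerivAt t (hc.prodMk (hasDerivAt_pi.2 hw))
  convert! h1 using 1
  rw [hT.fderiv_apply ht]
  obtain ⟨f, hf⟩ := hT.multilinear _ ht
  simp only [HarmonicSpace.covDeriv, Fin.init_snoc, Fin.snoc_last, ← hf, f.map_update_neg,
    Finset.sum_neg_distrib]
  abel

variable [FiniteDimensional ℝ E]

lemma IsCoordMetric.contDiffAt_christoffel (hG : IsCoordMetric G U) {F : Type*}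
    [NormedAddCommGroup F] [NormedSpace ℝ F] {p : F} {y u v : F → E} (hp : y p ∈ U)
    (hy : ContDiffAt ℝ ∞ y p) (hu : ContDiffAt ℝ ∞ u p) (hv : ContDiffAt ℝ ∞ v p) :
    ContDiffAt ℝ ∞ (fun q => christoffel G (y q) (u q) (v q)) p := by
  have h1 : ContDiffAt ℝ ∞ (fun q => christoffelCLM G (y q)) p :=
    (hG.contDiffOn_christoffelCLM.contDiffAt (hG.isOpen.mem_nhds hp)).comp p hy
  exact (h1.clm_apply hu).clm_apply hv

/-- The covariant derivative of a tensor field is a tensor field. -/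
lemma IsTensorField.covDeriv (hG : IsCoordMetric G U) (hT : IsTensorField T U) :
    IsTensorField (covDeriv G T) U where
  contDiffAt y hy w := by
    have hcoord : ∀ i, ContDiffAt ℝ ∞ (fun p : E × (Fin (n + 1) → E) => p.2 i) (y, w) :=
      fun i => ((contDiff_apply ℝ E i).contDiffAt).comp (y, w) contDiffAt_snd
    have hinit : ContDiffAt ℝ ∞ (fun p : E × (Fin (n + 1) → E) => (Fin.init p.2 : Fin n → E))
        (y, w) := contDiffAt_pi.2 fun i => hcoord i.castSucc
    have h0 : ContDiffAt ℝ ∞ (fun p : E × (Fin (n + 1) → E) => T p.1 (Fin.init p.2)) (y, w) :=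
      (hT.contDiffAt y hy (Fin.init w)).comp (f := fun p : E × (Fin (n + 1) → E) =>
        (p.1, (Fin.init p.2 : Fin n → E))) (y, w) (contDiffAt_fst.prodMk hinit)
    have h1 : ContDiffAt ℝ ∞ (fun p : E × (Fin (n + 1) → E) =>
        fderiv ℝ (fun z => T z (Fin.init p.2)) p.1 (p.2 (Fin.last n))) (y, w) := by
      have h2 : ContDiffAt ℝ ∞ (fun p : E × (Fin (n + 1) → E) =>
          fderiv ℝ (fun p : E × (Fin n → E) => T p.1 p.2) (p.1, Fin.init p.2)
            (p.2 (Fin.last n), 0)) (y, w) := by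
        have h3 : ContDiffAt ℝ ∞ (fderiv ℝ (fun p : E × (Fin n → E) => T p.1 p.2))
          (y, Fin.init w) := (hT.contDiffAt y hy (Fin.init w)).fderiv_right (by simp)
        have h4 : ContDiffAt ℝ ∞ (fun p : E × (Fin (n + 1) → E) =>
          fderiv ℝ (fun p : E × (Fin n → E) => T p.1 p.2) (p.1, Fin.init p.2)) (y, w) :=
          h3.comp (y, w) (contDiffAt_fst.prodMk hinit)
        exact h4.clm_apply ((hcoord _).prodMk contDiffAt_const)
      refine h2.congr_of_eventuallyEq ?_
      filter_upwards [continuousAt_fst.eventually (hG.isOpen.mem_nhds hy)] with p hp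
      have h3 : HasFDerivAt (fun z => T z (Fin.init p.2)) _ p.1 :=
        (((hT.contDiffAt p.1 hp (Fin.init p.2)).differentiableAt
          (by simp)).hasFDerivAt).comp (f := fun z => (z, (Fin.init p.2 : Fin n → E))) p.1
          ((hasFDerivAt_id p.1).prodMk (hasFDerivAt_const (Fin.init p.2 : Fin n → E) p.1))
      rw [h3.fderiv]
      simp
    have hlast : ContDiffAt ℝ ∞ (fun p : E × (Fin (n + 1) → E) => p.2 (Fin.last n)) (y, w) :=
      hcoord _
    have h2 := hG.contDiffAt_christoffel hy contDiffAt_fst hlast h0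
    have h3 : ∀ i : Fin n, ContDiffAt ℝ ∞ (fun p : E × (Fin (n + 1) → E) =>
        T p.1 (Function.update (Fin.init p.2) i
          (christoffel G p.1 (p.2 (Fin.last n)) (Fin.init p.2 i)))) (y, w) := by
      intro i
      have h4 : ContDiffAt ℝ ∞ (fun p : E × (Fin (n + 1) → E) =>
          Function.update (Fin.init p.2 : Fin n → E) i
          (christoffel G p.1 (p.2 (Fin.last n)) (Fin.init p.2 i))) (y, w) := by
        refine contDiffAt_pi.2 fun j => ?_
        by_cases hj : j = i
        · subst hj
          simp only [Function.update_self]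
          exact hG.contDiffAt_christoffel hy contDiffAt_fst hlast (hcoord _)
        · simp only [Function.update_of_ne hj]
          exact hcoord _
      exact (hT.contDiffAt y hy _).comp (y, w) (contDiffAt_fst.prodMk h4)
    exact (h1.add h2).sub (ContDiffAt.sum fun i _ => h3 i)
  multilinear y hy := by
    obtain ⟨f, hf⟩ := hT.multilinear y hy
    choose D hD using hT.fderiv_left_multilinear hG.isOpen hy
    let Γ := christoffelCLM G y
    let M : E → MultilinearMap ℝ (fun _ : Fin n => E) E := fun v =>
      D v + (Γ v : E →ₗ[ℝ] E).compMultilinearMap f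
        - ∑ i, f.compLinearMap (Function.update (fun _ => LinearMap.id) i (Γ v : E →ₗ[ℝ] E))
    have hM : ∀ v w, M v w = fderiv ℝ (fun z => T z w) y v + Γ v (T y w)
        - ∑ i, T y (Function.update w i (Γ v (w i))) := by
      intro v w
      simp only [M, sub_apply, add_apply, hD,
        LinearMap.compMultilinearMap_apply, hf, sum_apply]
      congr 1
      refine Finset.sum_congr rfl fun i _ => ?_
      rw [MultilinearMap.compLinearMap_apply, hf]
      congr 1
      ext j
      by_cases hj : j = i
      · subst hj; simp
      · simp [hj]
    let L : E →ₗ[ℝ] MultilinearMap ℝ (fun _ : Fin n => E) E :=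
      { toFun := M
        map_add' := fun a b => by
          ext w
          rw [add_apply, hM, hM, hM]
          simp only [map_add, add_apply, ← hf, f.map_update_add, Finset.sum_add_distrib]
          abel
        map_smul' := fun r a => by
          ext w
          rw [smul_apply, hM, hM]
          simp only [map_smul, smul_apply, ← hf, f.map_update_smul, ← Finset.smul_sum,
            RingHom.id_apply, smul_sub, smul_add] }
    let N : MultilinearMap ℝ (fun _ : Fin n => E) (E →ₗ[ℝ] E) :=
      { toFun := fun w =>
          { toFun := fun v => L v w
            map_add' := fun a b => by rw [map_add, add_apply]
            map_smul' := fun r a => by rw [map_smul, smul_apply, RingHom.id_apply] }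
        map_update_add' := fun w i a b => LinearMap.ext fun v => (L v).map_update_add w i a b
        map_update_smul' := fun w i r a => LinearMap.ext fun v => (L v).map_update_smul w i r a }
    exact ⟨N.uncurryRight, fun w => hM _ _⟩

lemma IsCoordMetric.curvature_eq (hG : IsCoordMetric G U) {y : E} (hy : y ∈ U) (u v w : E) :
    curvature G y u v w = fderiv ℝ (christoffelCLM G) y u v w
      - fderiv ℝ (christoffelCLM G) y v u w
      + christoffelCLM G y u (christoffelCLM G y v w)
      - christoffelCLM G y v (christoffelCLM G y u w) := by
  have hd : HasFDerivAt (christoffelCLM G) (fderiv ℝ (christoffelCLM G) y) y :=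
    ((hG.contDiffOn_christoffelCLM.contDiffAt (hG.isOpen.mem_nhds hy)).differentiableAt
      (by simp)).hasFDerivAt
  have h : ∀ a b d, fderiv ℝ (fun z => christoffel G z a b) y d =
      fderiv ℝ (christoffelCLM G) y d a b := by
    intro a b d
    have h1 : HasFDerivAt (fun z => christoffelCLM G z a b)
        (((fderiv ℝ (christoffelCLM G) y).flip a).flip b) y := by
      simpa using (hd.clm_apply (hasFDerivAt_const a y)).clm_apply (hasFDerivAt_const b y)
    exact DFunLike.congr_fun h1.fderiv d
  rw [curvature, h, h]
  rfl

lemma IsCoordMetric.isTensorField_curvature (hG : IsCoordMetric G U) :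
    IsTensorField (iterCovDerivCurvature G 0) U where
  contDiffAt y hy w := by
    have hcoord : ∀ i, ContDiffAt ℝ ∞ (fun p : E × (Fin 3 → E) => p.2 i) (y, w) :=
      fun i => ((contDiff_apply ℝ E i).contDiffAt).comp (y, w) contDiffAt_snd
    have hΓ := hG.contDiffOn_christoffelCLM.contDiffAt (hG.isOpen.mem_nhds hy)
    have hD : ∀ i j k, ContDiffAt ℝ ∞ (fun p : E × (Fin 3 → E) =>
        fderiv ℝ (christoffelCLM G) p.1 (p.2 i) (p.2 j) (p.2 k)) (y, w) := by
      intro i j k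
      have h1 : ContDiffAt ℝ ∞ (fun p : E × (Fin 3 → E) => fderiv ℝ (christoffelCLM G) p.1)
          (y, w) := (hΓ.fderiv_right (m := ∞) (by simp)).comp (y, w) contDiffAt_fst
      exact ((h1.clm_apply (hcoord i)).clm_apply (hcoord j)).clm_apply (hcoord k)
    have hΓΓ : ∀ i j k, ContDiffAt ℝ ∞ (fun p : E × (Fin 3 → E) =>
        christoffel G p.1 (p.2 i) (christoffel G p.1 (p.2 j) (p.2 k))) (y, w) := fun i j k =>
      hG.contDiffAt_christoffel hy contDiffAt_fst (hcoord i)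
        (hG.contDiffAt_christoffel hy contDiffAt_fst (hcoord j) (hcoord k))
    refine ((((hD 0 1 2).sub (hD 1 0 2)).add (hΓΓ 0 1 2)).sub
      (hΓΓ 1 0 2)).congr_of_eventuallyEq ?_
    filter_upwards [continuousAt_fst.eventually (hG.isOpen.mem_nhds hy)] with p hp
    exact hG.curvature_eq hp _ _ _
  multilinear y hy := by
    refine ⟨⟨fun w => iterCovDerivCurvature G 0 y w, ?_, ?_⟩, fun _ => rfl⟩
    · intro inst w i a b
      cases Subsingleton.elim inst (instDecidableEqFin 3)
      simp only [iterCovDerivCurvature, hG.curvature_eq hy]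
      fin_cases i <;> simp <;> abel
    · intro inst w i r a
      cases Subsingleton.elim inst (instDecidableEqFin 3)
      simp only [iterCovDerivCurvature, hG.curvature_eq hy]
      fin_cases i <;> simp <;> module

lemma IsCoordMetric.isTensorField_iterCovDerivCurvature (hG : IsCoordMetric G U) (k : ℕ) :
    IsTensorField (iterCovDerivCurvature G k) U := by
  induction k with
  | zero => exact hG.isTensorField_curvature
  | succ k ih => exact ih.covDeriv hG

end Tensor

/-! ### Geodesics, parallel frames and the exponential map in coordinates -/

section Geodesic

variable {E : Type*} [NormedAddCommGroup E] [NormedSpace ℝ E]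
  {G : E → E →L[ℝ] E →L[ℝ] ℝ} {U : Set E}

/-- The vector field whose integral curves `(c, c', e)` are the geodesics `c` with velocity `c'` and
a parallel frame `e` along `c`; a frame is encoded as a linear map from `E` to the tangent
space. -/
def geodesicField (G : E → E →L[ℝ] E →L[ℝ] ℝ) (z : E × E × (E →L[ℝ] E)) :
    E × E × (E →L[ℝ] E) :=
  (z.2.1, -christoffelCLM G z.1 z.2.1 z.2.1, -(christoffelCLM G z.1 z.2.1).comp z.2.2)

/-- On `I`, the curve `c` is a geodesic in `U` with velocity `c'`, and `e` is a parallel frame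
along it. -/
structure IsGeodesicFrame (G : E → E →L[ℝ] E →L[ℝ] ℝ) (U : Set E) (I : Set ℝ) (c c' : ℝ → E)
    (e : ℝ → E →L[ℝ] E) : Prop where
  mem : ∀ t ∈ I, c t ∈ U
  hasDerivAt : ∀ t ∈ I, HasDerivAt c (c' t) t
  hasDerivAt_velocity : ∀ t ∈ I, HasDerivAt c' (-christoffelCLM G (c t) (c' t) (c' t)) t
  hasDerivAt_frame : ∀ t ∈ I, HasDerivAt e (-(christoffelCLM G (c t) (c' t)).comp (e t)) t

/-- On `I`, the linear maps `W`, with derivative `W'`, solve the linearization of the geodesic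
equation along the geodesic `c`: for each `η`, `W η` is a Jacobi field. -/
structure IsJacobi (G : E → E →L[ℝ] E →L[ℝ] ℝ) (I : Set ℝ) (c c' : ℝ → E)
    (W W' : ℝ → E →L[ℝ] E) : Prop where
  hasDerivAt : ∀ t ∈ I, HasDerivAt W (W' t) t
  hasDerivAt_deriv : ∀ t ∈ I, ∀ η, HasDerivAt (fun t => W' t η)
    (-(fderiv ℝ (christoffelCLM G) (c t) (W t η) (c' t) (c' t)
      + christoffelCLM G (c t) (W' t η) (c' t) + christoffelCLM G (c t) (c' t) (W' t η))) t

lemma IsGeodesicFrame.hasDerivAt_prod {I : Set ℝ} {c c' : ℝ → E} {e : ℝ → E →L[ℝ] E}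
    (h : IsGeodesicFrame G U I c c' e) {t : ℝ} (ht : t ∈ I) :
    HasDerivAt (fun t => (c t, c' t, e t)) (geodesicField G (c t, c' t, e t)) t :=
  (h.hasDerivAt t ht).prodMk ((h.hasDerivAt_velocity t ht).prodMk (h.hasDerivAt_frame t ht))

/-- An initial segment of a geodesic, reparametrized by `[0, 1]`. -/
lemma IsGeodesicFrame.isCoordGeodesic {δ : ℝ} {c c' : ℝ → E} {e : ℝ → E →L[ℝ] E}
    (h : IsGeodesicFrame G U (Ioo (-δ) δ) c c' e) {t : ℝ} (ht : t ∈ Ioo (-δ) δ) :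
    IsCoordGeodesic G U (fun s => c (s * t)) (fun s => t • c' (s * t)) := by
  intro s hs
  have hst : s * t ∈ Ioo (-δ) δ := by
    rw [mem_Ioo, ← abs_lt] at ht ⊢
    rw [abs_mul, abs_of_nonneg hs.1]
    nlinarith [hs.2, abs_nonneg t]
  have hm : HasDerivAt (fun s : ℝ => s * t) t s := by simpa using (hasDerivAt_id s).mul_const t
  refine ⟨h.mem _ hst, ?_, ?_⟩
  · exact ((h.hasDerivAt _ hst).scomp s hm).hasDerivWithinAt
  · have h1 := ((h.hasDerivAt_velocity _ hst).scomp s hm).const_smul t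
    refine HasDerivAt.hasDerivWithinAt ?_
    convert! h1 using 1
    rw [← christoffelCLM_apply]
    simp

lemma IsCoordMetric.isOpen_prod (hG : IsCoordMetric G U) :
    IsOpen (U ×ˢ (univ : Set (E × (E →L[ℝ] E)))) := hG.isOpen.prod isOpen_univ

variable [FiniteDimensional ℝ E]

lemma IsCoordMetric.contDiffOn_geodesicField (hG : IsCoordMetric G U) :
    ContDiffOn ℝ ∞ (geodesicField G) (U ×ˢ univ) := by
  have hΓ : ContDiffOn ℝ ∞ (fun z : E × E × (E →L[ℝ] E) => christoffelCLM G z.1 z.2.1)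
      (U ×ˢ univ) :=
    (hG.contDiffOn_christoffelCLM.comp contDiffOn_fst fun z hz => hz.1).clm_apply
      (contDiff_fst.comp contDiff_snd).contDiffOn
  exact (contDiff_fst.comp contDiff_snd).contDiffOn.prodMk
    ((hΓ.clm_apply (contDiff_fst.comp contDiff_snd).contDiffOn).neg.prodMk
      (hΓ.clm_comp (contDiff_snd.comp contDiff_snd).contDiffOn).neg)

/-- The derivative of the geodesic field, in directions which do not change the frame. -/
lemma IsCoordMetric.fderiv_geodesicField (hG : IsCoordMetric G U) {y : E} (hy : y ∈ U) (v : E)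
    (e : E →L[ℝ] E) (d : E × E × (E →L[ℝ] E)) :
    (fderiv ℝ (geodesicField G) (y, v, e) d).1 = d.2.1 ∧
    (fderiv ℝ (geodesicField G) (y, v, e) d).2.1 =
      -(fderiv ℝ (christoffelCLM G) y d.1 v v + christoffelCLM G y d.2.1 v
        + christoffelCLM G y v d.2.1) := by
  have hd := ((hG.contDiffOn_geodesicField.contDiffAt
    (hG.isOpen_prod.mem_nhds (x := (y, v, e)) ⟨hy, mem_univ _⟩)).differentiableAt
      (by simp)).hasFDerivAt
  have hΓ : HasFDerivAt (christoffelCLM G) (fderiv ℝ (christoffelCLM G) y) y :=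
    ((hG.contDiffOn_christoffelCLM.contDiffAt (hG.isOpen.mem_nhds hy)).differentiableAt
      (by simp)).hasFDerivAt
  have hv : HasFDerivAt (fun z : E × E × (E →L[ℝ] E) => z.2.1)
      ((ContinuousLinearMap.fst ℝ E (E →L[ℝ] E)).comp
        (ContinuousLinearMap.snd ℝ E (E × (E →L[ℝ] E)))) (y, v, e) :=
    ((ContinuousLinearMap.fst ℝ E (E →L[ℝ] E)).comp
      (ContinuousLinearMap.snd ℝ E (E × (E →L[ℝ] E)))).hasFDerivAt
  have hΓ' : HasFDerivAt (fun z : E × E × (E →L[ℝ] E) => christoffelCLM G z.1) _ (y, v, e) :=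
    hΓ.comp (f := Prod.fst) (y, v, e) hasFDerivAt_fst
  constructor
  · have h1 := (hasFDerivAt_fst.comp (g := Prod.fst) (y, v, e) hd).unique hv
    exact DFunLike.congr_fun h1 d
  · have h2 : HasFDerivAt (fun z => (geodesicField G z).2.1) _ (y, v, e) :=
      hasFDerivAt_fst.comp (g := Prod.fst) (f := fun z => (geodesicField G z).2) (y, v, e)
        (hasFDerivAt_snd.comp (g := Prod.snd) (f := geodesicField G) (y, v, e) hd)
    have h3 := DFunLike.congr_fun (h2.unique ((hΓ'.clm_apply hv).clm_apply hv).neg) d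
    refine h3.trans ?_
    simp
    abel

/-- The value of the exponential map, from any geodesic with the given initial data. -/
lemma IsCoordMetric.coordExp_eq (hG : IsCoordMetric G U) {c c' : ℝ → E}
    (h : IsCoordGeodesic G U c c') : coordExp G U (c 0) (c' 0) = c 1 := by
  have hex : ∃ γ : ℝ → E, ∃ γ' : ℝ → E, γ 0 = c 0 ∧ γ' 0 = c' 0 ∧ IsCoordGeodesic G U γ γ' :=
    ⟨c, c', rfl, rfl, h⟩
  rw [coordExp, dif_pos hex]
  obtain ⟨γ', h0, h0', hγ⟩ := hex.choose_spec
  set γ := hex.choose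
  -- complete both geodesics by the zero frame to integral curves of the geodesic field
  have key : ∀ {c c' : ℝ → E}, IsCoordGeodesic G U c c' → ∀ t ∈ Icc (0 : ℝ) 1,
      HasDerivWithinAt (fun t => (c t, c' t, (0 : E →L[ℝ] E)))
        (geodesicField G (c t, c' t, 0)) (Icc 0 1) t := by
    intro c c' h t ht
    obtain ⟨-, h1, h2⟩ := h t ht
    have h3 := h1.prodMk (h2.prodMk (hasDerivWithinAt_const t (Icc (0 : ℝ) 1) (0 : E →L[ℝ] E)))
    convert! h3 using 1
    simp [geodesicField, christoffelCLM_apply]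
  have h1 := ode_unique_Icc hG.isOpen_prod
    (hG.contDiffOn_geodesicField.of_le (m := 1) (by exact_mod_cast le_top)) (key hγ)
    (fun t ht => ⟨(hγ t ht).1, mem_univ _⟩) (key h) (fun t ht => ⟨(h t ht).1, mem_univ _⟩)
    (by simp only [h0, h0']) (right_mem_Icc.2 zero_le_one)
  exact congrArg Prod.fst h1

lemma IsGeodesicFrame.coordExp_smul (hG : IsCoordMetric G U) {δ : ℝ} {c c' : ℝ → E}
    {e : ℝ → E →L[ℝ] E} (h : IsGeodesicFrame G U (Ioo (-δ) δ) c c' e) {t : ℝ}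
    (ht : t ∈ Ioo (-δ) δ) : coordExp G U (c 0) (t • c' 0) = c t := by
  simpa using hG.coordExp_eq (h.isCoordGeodesic ht)

lemma IsGeodesicFrame.contDiffAt (hG : IsCoordMetric G U) {I : Set ℝ} (hI : IsOpen I)
    {c c' : ℝ → E} {e : ℝ → E →L[ℝ] E} (h : IsGeodesicFrame G U I c c' e) {t : ℝ} (ht : t ∈ I) :
    ContDiffAt ℝ ∞ c t ∧ ContDiffAt ℝ ∞ c' t ∧ ContDiffAt ℝ ∞ e t := by
  have h1 : ContDiffAt ℝ ∞ (fun t => (c t, c' t, e t)) t :=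
    ode_contDiffAt hG.isOpen_prod hG.contDiffOn_geodesicField
      ((hI.eventually_mem ht).mono fun s hs => h.hasDerivAt_prod hs)
      ⟨h.mem t ht, mem_univ _⟩
  exact ⟨h1.fst, h1.snd.fst, h1.snd.snd⟩

/-- Local existence of geodesics with parallel frames.  The derivative of the exponential map at
`t • v` is given by the Jacobi fields `W` with `W 0 = 0` and `W' 0 = 1`. -/
theorem IsCoordMetric.exists_geodesic (hG : IsCoordMetric G U) {x : E} (hx : x ∈ U) (v : E)
    (e₀ : E →L[ℝ] E) : ∃ δ > 0, ∃ c c' : ℝ → E, ∃ e W W' : ℝ → E →L[ℝ] E,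
      (c 0 = x ∧ c' 0 = v ∧ e 0 = e₀ ∧ W 0 = 0 ∧ W' 0 = 1) ∧
      IsGeodesicFrame G U (Ioo (-δ) δ) c c' e ∧ IsJacobi G (Ioo (-δ) δ) c c' W W' ∧
      (∀ t ∈ Ioo (-δ) δ, ContDiffAt ℝ ∞ W t) ∧
      (∀ t ∈ Ioo (-δ) δ, HasFDerivAt (fun u => coordExp G U x (t • u)) (W t) v) ∧
      ∀ t ∈ Ioo (-δ) δ, ∀ᶠ u in 𝓝 v,
        ∃ γ γ', γ 0 = x ∧ γ' 0 = t • u ∧ IsCoordGeodesic G U γ γ' := by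
  obtain ⟨δ, hδ, r, hr, α, Y, hα, hY0, hY, hαY⟩ := exists_flow_hasFDerivAt hG.isOpen_prod
    hG.contDiffOn_geodesicField (z₀ := (x, v, e₀)) ⟨hx, mem_univ _⟩
  have h0 : (0 : ℝ) ∈ Ioo (-δ) δ := ⟨by linarith, hδ⟩
  have hframe : ∀ z ∈ Metric.ball (x, v, e₀) r, IsGeodesicFrame G U (Ioo (-δ) δ)
      (fun t => (α z t).1) (fun t => (α z t).2.1) (fun t => (α z t).2.2) := fun z hz =>
    { mem := fun t ht => ((hα z hz).2 t ht).1.1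
      hasDerivAt := fun t ht => (hasFDerivAt_fst.comp_hasDerivAt t ((hα z hz).2 t ht).2 :)
      hasDerivAt_velocity := fun t ht => (hasFDerivAt_fst.comp_hasDerivAt t
        (hasFDerivAt_snd.comp_hasDerivAt t ((hα z hz).2 t ht).2) :)
      hasDerivAt_frame := fun t ht => (hasFDerivAt_snd.comp_hasDerivAt t
        (hasFDerivAt_snd.comp_hasDerivAt t ((hα z hz).2 t ht).2) :) }
  have hz₀ : (x, v, e₀) ∈ Metric.ball (x, v, e₀) r := Metric.mem_ball_self hr
  let ι : E →L[ℝ] E × E × (E →L[ℝ] E) := (0 : E →L[ℝ] E).prod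
    ((ContinuousLinearMap.id ℝ E).prod (0 : E →L[ℝ] E →L[ℝ] E))
  have hι : ∀ u, HasFDerivAt (fun u => (x, u, e₀)) ι u := fun u =>
    (hasFDerivAt_const x u).prodMk ((hasFDerivAt_id u).prodMk (hasFDerivAt_const e₀ u))
  have hball : ∀ᶠ u in 𝓝 v, (x, u, e₀) ∈ Metric.ball (x, v, e₀) r :=
    (hι v).continuousAt.eventually (Metric.ball_mem_nhds _ hr)
  let π₁ : E × E × (E →L[ℝ] E) →L[ℝ] E := ContinuousLinearMap.fst ℝ _ _
  let π₂ : E × E × (E →L[ℝ] E) →L[ℝ] E :=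
    (ContinuousLinearMap.fst ℝ _ _).comp (ContinuousLinearMap.snd ℝ _ _)
  have hpost : ∀ (π : E × E × (E →L[ℝ] E) →L[ℝ] E) (t : ℝ) (ht : t ∈ Ioo (-δ) δ),
      HasDerivAt (fun t => π.comp ((Y t).comp ι))
        (π.comp (((fderiv ℝ (geodesicField G) (α (x, v, e₀) t)).comp (Y t)).comp ι)) t := by
    intro π t ht
    simpa using (hasDerivAt_const t π).clm_comp ((hY t ht).clm_comp (hasDerivAt_const t ι))
  refine ⟨δ, hδ, fun t => (α (x, v, e₀) t).1, fun t => (α (x, v, e₀) t).2.1,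
    fun t => (α (x, v, e₀) t).2.2, fun t => π₁.comp ((Y t).comp ι),
    fun t => π₂.comp ((Y t).comp ι), ?_, hframe _ hz₀, ⟨?_, ?_⟩, ?_, ?_, ?_⟩
  · have h1 := (hα _ hz₀).1
    refine ⟨by simp [h1], by simp [h1], by simp [h1], ?_, ?_⟩
    · ext u; simp [hY0, π₁, ι]
    · ext u; simp [hY0, π₂, ι]
  · intro t ht
    convert! hpost π₁ t ht using 1
    ext u
    exact (hG.fderiv_geodesicField ((hframe _ hz₀).mem t ht) _ _ _).1.symm
  · intro t ht η
    have h1 := (hpost π₂ t ht).clm_apply (hasDerivAt_const t η)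
    convert! h1 using 1
    rw [map_zero, add_zero]
    exact (hG.fderiv_geodesicField ((hframe _ hz₀).mem t ht) _ _ _).2.symm
  · intro t ht
    -- the flow and its derivative together solve a smooth equation
    have hF : ContDiffOn ℝ ∞ (fun p : (E × E × (E →L[ℝ] E)) ×
        ((E × E × (E →L[ℝ] E)) →L[ℝ] (E × E × (E →L[ℝ] E))) =>
        (geodesicField G p.1, (fderiv ℝ (geodesicField G) p.1).comp p.2))
        ((U ×ˢ univ) ×ˢ univ) := by
      refine (hG.contDiffOn_geodesicField.comp contDiffOn_fst fun p hp => hp.1).prodMk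
        (((hG.contDiffOn_geodesicField.fderiv_of_isOpen hG.isOpen_prod (m := ∞) (by simp)).comp
          contDiffOn_fst fun p hp => hp.1).clm_comp contDiffOn_snd)
    have h1 : ContDiffAt ℝ ∞ (fun t => (α (x, v, e₀) t, Y t)) t :=
      ode_contDiffAt (hG.isOpen_prod.prod isOpen_univ) hF
        ((isOpen_Ioo.eventually_mem ht).mono fun s hs =>
          ((hα _ hz₀).2 s hs).2.prodMk (hY s hs)) ⟨((hα _ hz₀).2 t ht).1, mem_univ _⟩
    exact contDiffAt_const.clm_comp (h1.snd.clm_comp contDiffAt_const)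
  · intro t ht
    have h1 : HasFDerivAt (fun u => (α (x, u, e₀) t).1) (π₁.comp ((Y t).comp ι)) v :=
      π₁.hasFDerivAt.comp v ((hαY t ht).comp (f := fun u => (x, u, e₀)) v (hι v))
    refine h1.congr_of_eventuallyEq ?_
    filter_upwards [hball] with u hu
    have h2 := (hframe _ hu).coordExp_smul hG ht
    simpa only [(hα _ hu).1] using h2
  · intro t ht
    filter_upwards [hball] with u hu
    refine ⟨_, _, ?_, ?_, (hframe _ hu).isCoordGeodesic ht⟩
    · simp [(hα _ hu).1]
    · simp [(hα _ hu).1]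

end Geodesic

/-! ### The Jacobi equation in a parallel frame -/

section Jacobi

variable {E : Type*} [NormedAddCommGroup E] [NormedSpace ℝ E]
  {G : E → E →L[ℝ] E →L[ℝ] ℝ} {U : Set E} {I : Set ℝ} {c c' : ℝ → E} {e : ℝ → E →L[ℝ] E}

/-- The Jacobi operator `η ↦ R(η, v) v` at the point `y`, as a continuous linear map. -/
def jacobiCLM (G : E → E →L[ℝ] E →L[ℝ] ℝ) (y v : E) : E →L[ℝ] E :=
  ((fderiv ℝ (christoffelCLM G) y).flip v).flip v - (fderiv ℝ (christoffelCLM G) y v).flip v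
    + (christoffelCLM G y).flip (christoffelCLM G y v v)
    - (christoffelCLM G y v).comp ((christoffelCLM G y).flip v)

/-- The Jacobi operator along the curve `c`, in the frame `e`. -/
def frameJacobi (G : E → E →L[ℝ] E →L[ℝ] ℝ) (c c' : ℝ → E) (e : ℝ → E →L[ℝ] E) (t : ℝ) :
    E →L[ℝ] E :=
  (e t).inverse.comp ((jacobiCLM G (c t) (c' t)).comp (e t))

variable [FiniteDimensional ℝ E]

lemma IsCoordMetric.jacobiCLM_apply (hG : IsCoordMetric G U) {y : E} (hy : y ∈ U) (v η : E) :
    jacobiCLM G y v η = curvature G y η v v := by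
  rw [hG.curvature_eq hy]
  simp [jacobiCLM]

lemma IsCoordMetric.hasDerivAt_christoffelCLM (hG : IsCoordMetric G U) {t : ℝ} (ht : c t ∈ U)
    {v : E} (hc : HasDerivAt c v t) :
    HasDerivAt (fun t => christoffelCLM G (c t)) (fderiv ℝ (christoffelCLM G) (c t) v) t :=
  ((hG.contDiffOn_christoffelCLM.contDiffAt (hG.isOpen.mem_nhds ht)).differentiableAt
    (by simp)).hasFDerivAt.comp_hasDerivAt t hc

namespace IsGeodesicFrame

/-- Parallel transport is an isometry. -/
lemma inner_eq (hG : IsCoordMetric G U) {δ : ℝ}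
    (h : IsGeodesicFrame G U (Ioo (-δ) δ) c c' e) {t : ℝ} (ht : t ∈ Ioo (-δ) δ) (a b : E) :
    G (c t) (e t a) (e t b) = G (c 0) (e 0 a) (e 0 b) := by
  have hd : ∀ s ∈ Ioo (-δ) δ, HasDerivAt (fun t => G (c t) (e t a) (e t b)) 0 s := by
    intro s hs
    have h1 : HasDerivAt (fun t => G (c t)) (fderiv ℝ G (c s) (c' s)) s :=
      ((hG.contDiffOn.contDiffAt (hG.isOpen.mem_nhds (h.mem s hs))).differentiableAt
        (by simp)).hasFDerivAt.comp_hasDerivAt s (h.hasDerivAt s hs)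
    have h2 : ∀ a, HasDerivAt (fun t => e t a)
        (-christoffelCLM G (c s) (c' s) (e s a)) s := fun a => by
      simpa using (h.hasDerivAt_frame s hs).clm_apply (hasDerivAt_const s a)
    convert! (h1.clm_apply (h2 a)).clm_apply (h2 b) using 1
    simp only [add_apply, map_neg, neg_apply, hG.fderiv_eq (h.mem s hs)]
    ring
  have h0 : (0 : ℝ) ∈ Ioo (-δ) δ := ⟨by linarith [ht.1, ht.2], by linarith [ht.1, ht.2]⟩
  exact isOpen_Ioo.is_const_of_deriv_eq_zero isPreconnected_Ioo
    (fun s hs => (hd s hs).differentiableAt.differentiableWithinAt)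
    (fun s hs => (hd s hs).deriv) ht h0

lemma isInvertible (hG : IsCoordMetric G U) {δ : ℝ}
    (h : IsGeodesicFrame G U (Ioo (-δ) δ) c c' e) (h0 : (e 0).IsInvertible) {t : ℝ}
    (ht : t ∈ Ioo (-δ) δ) : (e t).IsInvertible := by
  have h0m : (0 : ℝ) ∈ Ioo (-δ) δ := ⟨by linarith [ht.1, ht.2], by linarith [ht.1, ht.2]⟩
  have hinj : Function.Injective (e t : E →ₗ[ℝ] E) := by
    refine (injective_iff_map_eq_zero _).2 fun a ha => ?_
    by_contra hne
    have h1 := h.inner_eq hG ht a a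
    have h2 : e t a = 0 := ha
    have h3 : e 0 a ≠ 0 := fun h4 => hne (h0.injective (by rw [h4, map_zero]))
    have h5 := hG.pos _ (h.mem 0 h0m) _ h3
    rw [← h1, h2, map_zero] at h5
    exact lt_irrefl _ h5
  exact ⟨(LinearEquiv.ofInjectiveEndo _ hinj).toContinuousLinearEquiv, by ext; rfl⟩

variable (hG : IsCoordMetric G U) (hI : IsOpen I) (h : IsGeodesicFrame G U I c c' e)
  (hinv : ∀ t ∈ I, (e t).IsInvertible)

include hG hI h hinv

lemma contDiffAt_inverse {t : ℝ} (ht : t ∈ I) : ContDiffAt ℝ ∞ (fun t => (e t).inverse) t :=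
  (hinv t ht).contDiffAt_map_inverse.comp t (h.contDiffAt hG hI ht).2.2

lemma contDiffAt_frameJacobi {t : ℝ} (ht : t ∈ I) : ContDiffAt ℝ ∞ (frameJacobi G c c' e) t := by
  refine ContDiffOn.contDiffAt (s := I) (contDiffOn_clm_apply.2 fun η => ?_) (hI.mem_nhds ht)
  intro s hs
  obtain ⟨hc, hc', he⟩ := h.contDiffAt hG hI hs
  have heη : ContDiffAt ℝ ∞ (fun t => e t η) s := he.clm_apply contDiffAt_const
  have hw : ContDiffAt ℝ ∞ (fun t => (![e t η, c' t, c' t] : Fin 3 → E)) s := by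
    refine contDiffAt_pi.2 fun i => ?_
    fin_cases i
    exacts [heη, hc', hc']
  have h1 : ContDiffAt ℝ ∞ (fun t => curvature G (c t) (e t η) (c' t) (c' t)) s :=
    (hG.isTensorField_curvature.contDiffAt (c s) (h.mem s hs) _).comp
      (f := fun t => (c t, ![e t η, c' t, c' t])) s (hc.prodMk hw)
  refine (((h.contDiffAt_inverse hG hI hinv hs).clm_apply h1).congr_of_eventuallyEq
    ?_).contDiffWithinAt
  filter_upwards [hI.eventually_mem hs] with t ht
  simp [frameJacobi, hG.jacobiCLM_apply (h.mem t ht)]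

/-- The derivatives of the Jacobi operator in a parallel frame are the covariant derivatives
`∇ᵏR`. -/
lemma iteratedDeriv_frameJacobi (k : ℕ) : ∀ t ∈ I, ∀ η,
    e t (iteratedDeriv k (frameJacobi G c c' e) t η) =
      iterCovDerivCurvature G k (c t) (fun i => if i.val = 0 then e t η else c' t) := by
  induction k with
  | zero =>
    intro t ht η
    rw [iteratedDeriv_zero]
    simp only [frameJacobi, ContinuousLinearMap.comp_apply, (hinv t ht).self_apply_inverse,
      hG.jacobiCLM_apply (h.mem t ht), iterCovDerivCurvature]
    rfl
  | succ k ih =>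
    intro t ht η
    have hd : HasDerivAt (iteratedDeriv k (frameJacobi G c c' e))
        (iteratedDeriv (k + 1) (frameJacobi G c c' e) t) t :=
      hasDerivAt_iteratedDeriv (h.contDiffAt_frameJacobi hG hI hinv ht) k
    have h1 := (h.hasDerivAt_frame t ht).clm_apply (hd.clm_apply (hasDerivAt_const t η))
    have hw : ∀ i : Fin (3 + k), HasDerivAt
        (fun t => if i.val = 0 then e t η else c' t)
        (-christoffel G (c t) (c' t) (if i.val = 0 then e t η else c' t)) t := by
      intro i
      split_ifs
      · simpa [christoffelCLM_apply] using
          (h.hasDerivAt_frame t ht).clm_apply (hasDerivAt_const t η)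
      · exact h.hasDerivAt_velocity t ht
    have h2 := (hG.isTensorField_iterCovDerivCurvature k).hasDerivAt
      (w := fun t i => if i.val = 0 then e t η else c' t) (h.mem t ht) (h.hasDerivAt t ht) hw
    have h3 := h1.unique (h2.congr_of_eventuallyEq
      ((hI.eventually_mem ht).mono fun s hs => ih s hs η))
    simp only [map_zero, add_zero, neg_apply, ContinuousLinearMap.comp_apply, ih t ht η,
      christoffelCLM_apply] at h3
    rw [neg_add_eq_sub, sub_left_inj] at h3
    rw [h3]
    change covDeriv G _ _ _ = covDeriv G _ _ _
    congr 1
    funext i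
    refine Fin.lastCases ?_ (fun j => ?_) i
    · simp
    · simp

/-- In a parallel frame, the Jacobi fields satisfy `A'' = - R A`. -/
lemma deriv_deriv_frame {W W' : ℝ → E →L[ℝ] E} (hW : IsJacobi G I c c' W W')
    (hWs : ∀ t ∈ I, ContDiffAt ℝ ∞ W t) {t : ℝ} (ht : t ∈ I) :
    e t ∘L deriv (fun t => (e t).inverse ∘L W t) t = W' t + (christoffelCLM G (c t) (c' t)) ∘L W t ∧
    deriv (deriv fun t => (e t).inverse ∘L W t) t =
      -(frameJacobi G c c' e t * ((e t).inverse ∘L W t)) := by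
  set A := fun t => (e t).inverse ∘L W t with hA
  have hAs : ∀ t ∈ I, ContDiffAt ℝ ∞ A t := fun t ht =>
    (h.contDiffAt_inverse hG hI hinv ht).clm_comp (hWs t ht)
  have heA : ∀ t ∈ I, ∀ η, e t (A t η) = W t η := fun t ht η =>
    (hinv t ht).self_apply_inverse _
  have hWd : ∀ t ∈ I, ∀ η, HasDerivAt (fun t => W t η) (W' t η) t := fun t ht η => by
    simpa using (hW.hasDerivAt t ht).clm_apply (hasDerivAt_const t η)
  have hΓ : ∀ t ∈ I, HasDerivAt (fun t => christoffelCLM G (c t))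
      (fderiv ℝ (christoffelCLM G) (c t) (c' t)) t := fun t ht =>
    hG.hasDerivAt_christoffelCLM (h.mem t ht) (h.hasDerivAt t ht)
  have first : ∀ t ∈ I, ∀ η, e t (deriv A t η) =
      W' t η + christoffelCLM G (c t) (c' t) (W t η) := by
    intro t ht η
    have hd := ((hAs t ht).differentiableAt (by simp)).hasDerivAt
    have h1 := (h.hasDerivAt_frame t ht).clm_apply (hd.clm_apply (hasDerivAt_const t η))
    have h2 := h1.unique ((hWd t ht η).congr_of_eventuallyEq
      ((hI.eventually_mem ht).mono fun s hs => heA s hs η))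
    simp only [map_zero, add_zero, neg_apply, ContinuousLinearMap.comp_apply, heA t ht η] at h2
    rw [← h2]
    abel
  refine ⟨ContinuousLinearMap.ext fun η => first t ht η, ?_⟩
  ext η
  refine (hinv t ht).injective ?_
  have hd := ((contDiffAt_deriv (hAs t ht)).differentiableAt (by simp)).hasDerivAt
  have h1 := (h.hasDerivAt_frame t ht).clm_apply (hd.clm_apply (hasDerivAt_const t η))
  have h2 := (hW.hasDerivAt_deriv t ht η).add
    (((hΓ t ht).clm_apply (hWd t ht η)).clm_apply (h.hasDerivAt_velocity t ht))
  have h3 := h1.unique (h2.congr_of_eventuallyEq ((hI.eventually_mem ht).mono fun s hs => by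
    simp only [first s hs η, Pi.add_apply, hG.christoffel_symm (h.mem s hs) (c' s)]))
  have h4 : e t ((-(frameJacobi G c c' e t * A t)) η) =
      -curvature G (c t) (W t η) (c' t) (c' t) := by
    simp only [neg_apply, map_neg, mul_apply_eq_comp, frameJacobi,
      ContinuousLinearMap.comp_apply, (hinv t ht).self_apply_inverse, heA t ht η,
      hG.jacobiCLM_apply (h.mem t ht)]
  rw [h4, hG.curvature_eq (h.mem t ht)]
  simp only [map_zero, add_zero, neg_apply, ContinuousLinearMap.comp_apply, first t ht η, add_apply,
    map_add, map_neg] at h3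
  rw [hG.christoffel_symm (h.mem t ht) (W t η) (c' t)]
  rw [neg_add_eq_iff_eq_add] at h3
  rw [h3]
  abel

end IsGeodesicFrame

end Jacobi

/-! ### The exponential map and the Jacobi equation near a point -/

section NormalForm

variable {E : Type*} [NormedAddCommGroup E] [NormedSpace ℝ E] [FiniteDimensional ℝ E]
  {G : E → E →L[ℝ] E →L[ℝ] ℝ} {U : Set E}

lemma IsCoordMetric.hasFDerivAt_coordExp_zero (hG : IsCoordMetric G U) {x : E} (hx : x ∈ U) :
    HasFDerivAt (coordExp G U x) (ContinuousLinearMap.id ℝ E) 0 := by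
  -- differentiability comes from the flow at a small positive time, and homogeneity
  obtain ⟨D, hD⟩ : ∃ D, HasFDerivAt (coordExp G U x) D 0 := by
    obtain ⟨δ, hδ, c, c', e, W, W', -, -, -, -, hW, -⟩ := hG.exists_geodesic hx 0 0
    have h1 := hW (δ / 2) ⟨by linarith, by linarith⟩
    have h2 : HasFDerivAt (fun u : E => (δ / 2)⁻¹ • u)
        ((δ / 2)⁻¹ • ContinuousLinearMap.id ℝ E) 0 := (hasFDerivAt_id 0).const_smul _
    have h3 := HasFDerivAt.comp (g := fun u => coordExp G U x ((δ / 2) • u)) (0 : E)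
      (by simpa using h1) h2
    refine ⟨_, h3.congr_of_eventuallyEq (Eventually.of_forall fun u => ?_)⟩
    simp [smul_smul, hδ.ne']
  convert! hD using 1
  ext v
  obtain ⟨δ, hδ, c, c', e, W, W', ⟨hc0, hc'0, -⟩, hf, -⟩ := hG.exists_geodesic hx v 0
  have h0 : (0 : ℝ) ∈ Ioo (-δ) δ := ⟨by linarith, hδ⟩
  have h1 : HasDerivAt (fun t : ℝ => coordExp G U x (t • v)) v 0 := by
    have h2 := hf.hasDerivAt 0 h0
    rw [hc'0] at h2
    refine h2.congr_of_eventuallyEq ((isOpen_Ioo.eventually_mem h0).mono fun t ht => ?_)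
    simpa only [hc0, hc'0] using hf.coordExp_smul hG ht
  have h3 : HasDerivAt (fun t : ℝ => t • v) v 0 := by
    simpa using (hasDerivAt_id (0 : ℝ)).smul_const v
  have h4 : HasDerivAt (fun t : ℝ => coordExp G U x (t • v)) (D v) 0 :=
    HasFDerivAt.comp_hasDerivAt (l := coordExp G U x) (f := fun t : ℝ => t • v) (0 : ℝ)
      (by simpa using hD) h3
  exact h1.unique h4

/-- For small initial velocities, the geodesic on `[0, 1]` exists and stays in `U`. -/
lemma IsCoordMetric.eventually_exists_geodesic (hG : IsCoordMetric G U) {x : E} (hx : x ∈ U) :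
    ∀ᶠ w in 𝓝 (0 : E), ∃ γ γ', γ 0 = x ∧ γ' 0 = w ∧ IsCoordGeodesic G U γ γ' := by
  obtain ⟨δ, hδ, c, c', e, W, W', -, -, -, -, -, hγ⟩ := hG.exists_geodesic hx 0 0
  have h1 := hγ (δ / 2) ⟨by linarith, by linarith⟩
  have h2 : Tendsto (fun u : E => (δ / 2)⁻¹ • u) (𝓝 0) (𝓝 0) := by
    simpa using (continuous_const_smul (δ / 2)⁻¹).tendsto (0 : E)
  filter_upwards [h2.eventually h1] with w hw
  simpa [smul_smul, hδ.ne'] using hw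

/-- In a frame `p` of the tangent space at `x`, parallel along the geodesic with initial velocity
`v`, the endomorphisms `R t` describe the Jacobi operator, and `t • B t` the solution of the Jacobi
equation which gives the derivative of the exponential map; `V` is the derivative of the exponential
map at `t • v`, and parallel transport to `x` turns it into `p * B t * p⁻¹`. Only the inner products
which result from this are recorded. -/
def HasNormalForm (G : E → E →L[ℝ] E →L[ℝ] ℝ) (U : Set E) (R : ℝ → E →L[ℝ] E) (x v : E)
    (p : E →L[ℝ] E) : Prop :=
  ∃ B : ℝ → E →L[ℝ] E, ContDiffAt ℝ ∞ B 0 ∧ B 0 = 1 ∧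
    (∀ᶠ t in 𝓝 0, deriv (deriv fun t => t • B t) t = -(R t * (t • B t))) ∧
    ∀ᶠ t in 𝓝 (0 : ℝ), coordExp G U x (t • v) ∈ U ∧
      ∃ V : E →L[ℝ] E, HasFDerivAt (coordExp G U x) V (t • v) ∧ ∀ a b,
        G (coordExp G U x (t • v)) (V a) (V b) =
          G x (p (B t (p.inverse a))) (p (B t (p.inverse b)))

/-- Every geodesic with a parallel frame gives a normal form of the exponential map. -/
theorem IsCoordMetric.exists_hasNormalForm (hG : IsCoordMetric G U) {x : E} (hx : x ∈ U) (v : E)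
    {p : E →L[ℝ] E} (hp : p.IsInvertible) : ∃ δ > 0, ∃ c c' e, c 0 = x ∧ c' 0 = v ∧ e 0 = p ∧
      IsGeodesicFrame G U (Ioo (-δ) δ) c c' e ∧
      HasNormalForm G U (frameJacobi G c c' e) x v p := by
  obtain ⟨δ, hδ, c, c', e, W, W', ⟨hc0, hc'0, he0, hW0, hW'0⟩, hf, hJ, hWs, hexp, -⟩ :=
    hG.exists_geodesic hx v p
  refine ⟨δ, hδ, c, c', e, hc0, hc'0, he0, hf, ?_⟩
  have h0 : (0 : ℝ) ∈ Ioo (-δ) δ := ⟨by linarith, hδ⟩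
  have hinv : ∀ t ∈ Ioo (-δ) δ, (e t).IsInvertible := fun t ht =>
    hf.isInvertible hG (by rwa [he0]) ht
  have hAs : ∀ t ∈ Ioo (-δ) δ, ContDiffAt ℝ ∞ (fun t => (e t).inverse ∘L W t) t := fun t ht =>
    (hf.contDiffAt_inverse hG isOpen_Ioo hinv ht).clm_comp (hWs t ht)
  have hAp : ∀ t ∈ Ioo (-δ) δ, ContDiffAt ℝ ∞ (fun t => ((e t).inverse ∘L W t) ∘L p) t :=
    fun t ht => (hAs t ht).clm_comp contDiffAt_const
  have hderiv : ∀ {F : ℝ → E →L[ℝ] E} {t : ℝ}, DifferentiableAt ℝ F t →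
      deriv (fun t => F t ∘L p) t = deriv F t ∘L p := fun hF => by
    simpa using (hF.hasDerivAt.clm_comp (hasDerivAt_const _ p)).deriv
  obtain ⟨B, hB, hB0, hAB⟩ := exists_eventuallyEq_smul_of_zero
    ((isOpen_Ioo.eventually_mem h0).mono hAp) (by simp [hW0])
  have hB1 : B 0 = 1 := by
    rw [hB0, hderiv ((hAs 0 h0).differentiableAt (by simp))]
    have h1 := (hf.deriv_deriv_frame hG isOpen_Ioo hinv hJ hWs h0).1
    rw [hW0, hW'0, he0] at h1
    ext η
    refine hp.injective ?_
    have h2 := DFunLike.congr_fun h1 (p η)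
    simpa [hp.self_apply_inverse] using h2
  refine ⟨B, hB, hB1, ?_, ?_⟩
  · have h1 : (deriv fun t => t • B t) =ᶠ[𝓝 0]
        deriv fun t => ((e t).inverse ∘L W t) ∘L p := EventuallyEq.deriv (by
      filter_upwards [hAB] with t ht using ht.symm)
    filter_upwards [h1.deriv, hAB, isOpen_Ioo.eventually_mem h0] with t ht1 ht2 ht3
    have h2 : (deriv fun t => ((e t).inverse ∘L W t) ∘L p) =ᶠ[𝓝 t]
        fun t => deriv (fun t => (e t).inverse ∘L W t) t ∘L p :=
      (isOpen_Ioo.eventually_mem ht3).mono fun s hs =>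
        hderiv ((hAs s hs).differentiableAt (by simp))
    rw [ht1, h2.deriv_eq, hderiv ((contDiffAt_deriv (hAs t ht3)).differentiableAt (by simp)),
      (hf.deriv_deriv_frame hG isOpen_Ioo hinv hJ hWs ht3).2, ← ht2]
    rfl
  · filter_upwards [hAB, isOpen_Ioo.eventually_mem h0] with t ht1 ht
    have hct : coordExp G U x (t • v) = c t := by
      simpa only [hc0, hc'0] using hf.coordExp_smul hG ht
    rw [hct]
    refine ⟨hf.mem t ht, e t ∘L B t ∘L p.inverse, ?_, fun a b => ?_⟩
    · rcases eq_or_ne t 0 with rfl | ht0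
      · rw [zero_smul, hB1, he0]
        convert! hG.hasFDerivAt_coordExp_zero hx using 1
        exact hp.self_comp_inverse
      · have h2 : HasFDerivAt (fun u : E => t⁻¹ • u) (t⁻¹ • ContinuousLinearMap.id ℝ E) (t • v) :=
          (hasFDerivAt_id _).const_smul _
        have h3 := HasFDerivAt.comp (g := fun u => coordExp G U x (t • u)) (t • v)
          (by simpa [smul_smul, ht0] using hexp t ht) h2
        have h4 : HasFDerivAt (coordExp G U x) (W t ∘L (t⁻¹ • ContinuousLinearMap.id ℝ E))
            (t • v) := h3.congr_of_eventuallyEq (Eventually.of_forall fun u => by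
          simp [smul_smul, ht0])
        convert! h4 using 1
        ext a
        have h5 := DFunLike.congr_fun ht1 (p.inverse a)
        simp only [ContinuousLinearMap.comp_apply, hp.self_apply_inverse, smul_apply] at h5
        have h6 : B t (p.inverse a) = t⁻¹ • (e t).inverse (W t a) := by
          rw [h5, smul_smul, inv_mul_cancel₀ ht0, one_smul]
        simp [h6, (hinv t ht).self_apply_inverse]
    · rw [← hc0, ← he0]
      exact hf.inner_eq hG ht _ _

/-- Two geodesics with parallel frames and the same initial data, one of them with its parameter
shifted, have the same Jacobi operators. -/
lemma IsGeodesicFrame.frameJacobi_shift (hG : IsCoordMetric G U) {δ ε s : ℝ}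
    {c c' d d' : ℝ → E} {e f : ℝ → E →L[ℝ] E} (h : IsGeodesicFrame G U (Ioo (-δ) δ) c c' e)
    (k : IsGeodesicFrame G U (Ioo (-ε) ε) d d' f) (hε : 0 < ε) (hs : s ∈ Ioo (-δ) δ)
    (h0 : d 0 = c s) (h1 : d' 0 = c' s) (h2 : f 0 = e s) :
    ∀ᶠ t in 𝓝 0, frameJacobi G d d' f t = frameJacobi G c c' e (s + t) := by
  have h0m : (0 : ℝ) ∈ Ioo (-ε) ε := ⟨by linarith, hε⟩
  have hsh : ∀ᶠ t in 𝓝 (0 : ℝ), s + t ∈ Ioo (-δ) δ := by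
    have h3 : Tendsto (fun t : ℝ => s + t) (𝓝 0) (𝓝 s) := by
      simpa using (continuous_const_add s).tendsto (0 : ℝ)
    exact h3.eventually (isOpen_Ioo.eventually_mem hs)
  have key : (fun t => (d t, d' t, f t)) =ᶠ[𝓝 0] fun t => (c (s + t), c' (s + t), e (s + t)) := by
    refine ode_unique_nhds (F := geodesicField G) ?_
      ((isOpen_Ioo.eventually_mem h0m).mono fun t ht => k.hasDerivAt_prod ht)
      (hsh.mono fun t ht => ?_) (by simp [h0, h1, h2])
    · exact (hG.contDiffOn_geodesicField.contDiffAt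
        (hG.isOpen_prod.mem_nhds ⟨k.mem 0 h0m, mem_univ _⟩)).of_le (by exact_mod_cast le_top)
    · exact (h.hasDerivAt_prod ht).comp_const_add s t
  filter_upwards [key] with t ht
  simp only [Prod.mk.injEq] at ht
  simp only [frameJacobi, ht]

/-- The normal forms of the exponential maps at the points of one geodesic: they are described by one
family `R` of endomorphisms, the derivatives of which are the covariant derivatives of the Jacobi
operator. -/
theorem IsCoordMetric.exists_normalForms (hG : IsCoordMetric G U) {x : E} (hx : x ∈ U) (v : E) :
    ∃ R : ℝ → E →L[ℝ] E, (∀ᶠ s in 𝓝 0, ContDiffAt ℝ ∞ R s) ∧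
      (∀ k η, iteratedDeriv k R 0 η =
        iterCovDerivCurvature G k x (fun i => if i.val = 0 then η else v)) ∧
      HasNormalForm G U R x v 1 ∧
      ∀ᶠ s in 𝓝 0, ∃ y ∈ U, ∃ w, ∃ p : E →L[ℝ] E, p.IsInvertible ∧
        HasNormalForm G U (fun t => R (s + t)) y w p := by
  obtain ⟨δ, hδ, c, c', e, hc0, hc'0, he0, hf, hN⟩ := hG.exists_hasNormalForm hx v
    (p := 1) ⟨ContinuousLinearEquiv.refl ℝ E, rfl⟩
  have h0 : (0 : ℝ) ∈ Ioo (-δ) δ := ⟨by linarith, hδ⟩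
  have hinv : ∀ t ∈ Ioo (-δ) δ, (e t).IsInvertible := fun t ht =>
    hf.isInvertible hG (by rw [he0]; exact ⟨ContinuousLinearEquiv.refl ℝ E, rfl⟩) ht
  refine ⟨frameJacobi G c c' e, ?_, ?_, hN, ?_⟩
  · exact (isOpen_Ioo.eventually_mem h0).mono fun s hs =>
      hf.contDiffAt_frameJacobi hG isOpen_Ioo hinv hs
  · intro k η
    simpa [he0, hc0, hc'0] using hf.iteratedDeriv_frameJacobi hG isOpen_Ioo hinv k 0 h0 η
  · filter_upwards [isOpen_Ioo.eventually_mem h0] with s hs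
    refine ⟨c s, hf.mem s hs, c' s, e s, hinv s hs, ?_⟩
    obtain ⟨ε, hε, d, d', f, h1, h2, h3, hk, B, hB, hB0, hode, hV⟩ :=
      hG.exists_hasNormalForm (hf.mem s hs) (c' s) (hinv s hs)
    refine ⟨B, hB, hB0, ?_, hV⟩
    filter_upwards [hode, hf.frameJacobi_shift hG hk hε hs h1 h2 h3] with t ht1 ht2
    rw [ht1, ht2]

end NormalForm

/-! ### Change of coordinates -/

section Transformation

variable {E : Type*} [NormedAddCommGroup E] [NormedSpace ℝ E] [FiniteDimensional ℝ E]
  {G G' : E → E →L[ℝ] E →L[ℝ] ℝ} {N U : Set E} {ψ : E → E}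

/-- The transformation of the Christoffel symbols under a change of coordinates `ψ`. -/
lemma IsCoordMetric.fderiv_christoffel (hG : IsCoordMetric G N) (hG' : IsCoordMetric G' U)
    (hψ : ContDiffOn ℝ ∞ ψ N) (hψU : MapsTo ψ N U)
    (h : ∀ y ∈ N, ∀ u v, G y u v = G' (ψ y) (fderiv ℝ ψ y u) (fderiv ℝ ψ y v))
    {y : E} (hy : y ∈ N) (u v : E) :
    fderiv ℝ ψ y (christoffelCLM G y u v) =
      christoffelCLM G' (ψ y) (fderiv ℝ ψ y u) (fderiv ℝ ψ y v)
        + fderiv ℝ (fderiv ℝ ψ) y u v := by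
  have hyN := hG.isOpen.mem_nhds hy
  have hψd : HasFDerivAt ψ (fderiv ℝ ψ y) y :=
    ((hψ.contDiffAt hyN).differentiableAt (by simp)).hasFDerivAt
  have hψ2 : ContDiffAt ℝ ∞ (fderiv ℝ ψ) y := (hψ.contDiffAt hyN).fderiv_right (by simp)
  have hψdd : HasFDerivAt (fderiv ℝ ψ) (fderiv ℝ (fderiv ℝ ψ) y) y :=
    (hψ2.differentiableAt (by simp)).hasFDerivAt
  have hsymm : ∀ u v, fderiv ℝ (fderiv ℝ ψ) y u v = fderiv ℝ (fderiv ℝ ψ) y v u := fun u v =>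
    ((hψ.contDiffAt hyN).isSymmSndFDerivAt (by
      rw [minSmoothness_of_isRCLikeNormedField]
      exact WithTop.coe_le_coe.2 (le_top : (2 : ℕ∞) ≤ ⊤))).eq u v
  have hGd : HasFDerivAt G (fderiv ℝ G y) y :=
    ((hG.contDiffOn.contDiffAt hyN).differentiableAt (by simp)).hasFDerivAt
  have hG'd : HasFDerivAt G' (fderiv ℝ G' (ψ y)) (ψ y) :=
    ((hG'.contDiffOn.contDiffAt (hG'.isOpen.mem_nhds (hψU hy))).differentiableAt
      (by simp)).hasFDerivAt
  have hD : ∀ w u v, fderiv ℝ G y w u v =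
      fderiv ℝ G' (ψ y) (fderiv ℝ ψ y w) (fderiv ℝ ψ y u) (fderiv ℝ ψ y v)
        + G' (ψ y) (fderiv ℝ (fderiv ℝ ψ) y w u) (fderiv ℝ ψ y v)
        + G' (ψ y) (fderiv ℝ ψ y u) (fderiv ℝ (fderiv ℝ ψ) y w v) := by
    intro w u v
    have h1 := (hGd.clm_apply (hasFDerivAt_const u y)).clm_apply (hasFDerivAt_const v y)
    have h2 := ((hG'd.comp y hψd).clm_apply (hψdd.clm_apply (hasFDerivAt_const u y))).clm_apply
      (hψdd.clm_apply (hasFDerivAt_const v y))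
    have h3 := h1.unique (h2.congr_of_eventuallyEq
      ((hG.isOpen.eventually_mem hy).mono fun z hz => h z hz u v))
    have h4 := DFunLike.congr_fun h3 w
    simp at h4
    rw [h4]
    ring
  have hinj : Function.Injective (fderiv ℝ ψ y : E →ₗ[ℝ] E) := by
    refine (injective_iff_map_eq_zero _).2 fun a ha => ?_
    by_contra hne
    have h1 := hG.pos y hy a hne
    have h2 : fderiv ℝ ψ y a = 0 := ha
    rw [h y hy, h2, map_zero] at h1
    exact lt_irrefl _ h1
  have hsurj := LinearMap.injective_iff_surjective.1 hinj
  refine hG'.eq_of_forall_inner_eq (hψU hy) fun w' => ?_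
  obtain ⟨w, hw⟩ := hsurj w'
  have hw : fderiv ℝ ψ y w = w' := hw
  rw [← hw, ← h y hy, hG.koszul_formula hy, map_add, add_apply, hG'.koszul_formula (hψU hy), hD, hD,
    hD, hsymm w u, hsymm w v, hsymm v u,
    hG'.symm _ (hψU hy) (fderiv ℝ ψ y u) (fderiv ℝ (fderiv ℝ ψ) y v w),
    hG'.symm _ (hψU hy) (fderiv ℝ ψ y v) (fderiv ℝ (fderiv ℝ ψ) y u w)]
  ring

/-- A change of coordinates maps geodesics to geodesics. -/
lemma IsCoordGeodesic.map (hG : IsCoordMetric G N) (hG' : IsCoordMetric G' U)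
    (hψ : ContDiffOn ℝ ∞ ψ N) (hψU : MapsTo ψ N U)
    (h : ∀ y ∈ N, ∀ u v, G y u v = G' (ψ y) (fderiv ℝ ψ y u) (fderiv ℝ ψ y v))
    {c c' : ℝ → E} (hc : IsCoordGeodesic G N c c') :
    IsCoordGeodesic G' U (fun t => ψ (c t)) (fun t => fderiv ℝ ψ (c t) (c' t)) := by
  intro t ht
  obtain ⟨hm, h1, h2⟩ := hc t ht
  have hyN := hG.isOpen.mem_nhds hm
  have hψd : HasFDerivAt ψ (fderiv ℝ ψ (c t)) (c t) :=
    ((hψ.contDiffAt hyN).differentiableAt (by simp)).hasFDerivAt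
  have hψ2 : ContDiffAt ℝ ∞ (fderiv ℝ ψ) (c t) := (hψ.contDiffAt hyN).fderiv_right (by simp)
  have hψdd : HasFDerivAt (fderiv ℝ ψ) (fderiv ℝ (fderiv ℝ ψ) (c t)) (c t) :=
    (hψ2.differentiableAt (by simp)).hasFDerivAt
  refine ⟨hψU hm, hψd.comp_hasDerivWithinAt t h1, ?_⟩
  have h3 := (hψdd.comp_hasDerivWithinAt t h1).clm_apply h2
  convert! h3 using 1
  simp only [Function.comp_apply]
  rw [map_neg, ← christoffelCLM_apply, ← christoffelCLM_apply,
    hG.fderiv_christoffel hG' hψ hψU h hm]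
  abel

/-- The exponential map in other coordinates, near the origin. -/
lemma IsCoordMetric.eventually_coordExp_map (hG : IsCoordMetric G N) {U' : Set E}
    (hGU : IsCoordMetric G U') (hN : N ⊆ U') (hG' : IsCoordMetric G' U)
    (hψ : ContDiffOn ℝ ∞ ψ N) (hψU : MapsTo ψ N U)
    (h : ∀ y ∈ N, ∀ u v, G y u v = G' (ψ y) (fderiv ℝ ψ y u) (fderiv ℝ ψ y v))
    {x : E} (hx : x ∈ N) :
    ∀ᶠ w in 𝓝 (0 : E), coordExp G U' x w ∈ N ∧
      coordExp G' U (ψ x) (fderiv ℝ ψ x w) = ψ (coordExp G U' x w) := by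
  filter_upwards [hG.eventually_exists_geodesic hx] with w hw
  obtain ⟨γ, γ', h0, h1, hγ⟩ := hw
  have h2 := hG'.coordExp_eq (hγ.map hG hG' hψ hψU h)
  have h3 := hGU.coordExp_eq (fun t ht => ⟨hN (hγ t ht).1, (hγ t ht).2⟩ :
    IsCoordGeodesic G U' γ γ')
  rw [h0, h1] at h3
  simp only [h0, h1] at h2
  rw [h3]
  exact ⟨(hγ 1 (right_mem_Icc.2 zero_le_one)).1, h2⟩

end Transformation

/-! ### The metric of a Riemannian manifold in the preferred charts -/

section Charts

variable {m : ℕ} {M : Type*} [TopologicalSpace M] [ChartedSpace (EuclideanSpace ℝ (Fin m)) M]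
  {P Q : M} {y : EuclideanSpace ℝ (Fin m)}

/-- The change of coordinates from the preferred chart at `P` to the preferred chart at `Q`. -/
def chartChange (P Q : M) (y : EuclideanSpace ℝ (Fin m)) : EuclideanSpace ℝ (Fin m) :=
  extChartAt (𝓡 m) Q ((extChartAt (𝓡 m) P).symm y)

/-- The domain of the change of coordinates. -/
def chartOverlap (P Q : M) : Set (EuclideanSpace ℝ (Fin m)) :=
  (extChartAt (𝓡 m) P).target ∩ (extChartAt (𝓡 m) P).symm ⁻¹' (extChartAt (𝓡 m) Q).source

lemma isOpen_chartOverlap (P Q : M) : IsOpen (chartOverlap (m := m) P Q) :=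
  (continuousOn_extChartAt_symm P).isOpen_inter_preimage (isOpen_extChartAt_target P)
    (isOpen_extChartAt_source Q)

lemma mapsTo_chartChange (P Q : M) :
    MapsTo (chartChange P Q) (chartOverlap (m := m) P Q) (extChartAt (𝓡 m) Q).target :=
  fun _ hy => (extChartAt (𝓡 m) Q).map_source hy.2

lemma chartSymm_chartChange (hy : y ∈ chartOverlap P Q) :
    (extChartAt (𝓡 m) Q).symm (chartChange P Q y) = (extChartAt (𝓡 m) P).symm y :=
  (extChartAt (𝓡 m) Q).left_inv hy.2

variable [IsManifold (𝓡 m) ∞ M]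

/-- The derivative at `y` of the inverse of the preferred chart at `P`, as an endomorphism of
`EuclideanSpace ℝ (Fin m)`. -/
def chartSymmDeriv (P : M) (y : EuclideanSpace ℝ (Fin m)) :
    EuclideanSpace ℝ (Fin m) →L[ℝ] EuclideanSpace ℝ (Fin m) :=
  (mfderiv (𝓡 m) (𝓡 m) (extChartAt (𝓡 m) P).symm y :)

/-- The metric at a point, as a bilinear form on `EuclideanSpace ℝ (Fin m)`. -/
def metricForm (g : Bundle.ContMDiffRiemannianMetric (𝓡 m) ∞ (EuclideanSpace ℝ (Fin m))
      (fun x : M => TangentSpace (𝓡 m) x)) (Q : M) :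
    EuclideanSpace ℝ (Fin m) →L[ℝ] EuclideanSpace ℝ (Fin m) →L[ℝ] ℝ :=
  g.inner Q

variable {g : Bundle.ContMDiffRiemannianMetric (𝓡 m) ∞ (EuclideanSpace ℝ (Fin m))
      (fun x : M => TangentSpace (𝓡 m) x)}

lemma coordMetric_apply (u v : EuclideanSpace ℝ (Fin m)) :
    coordMetric g P y u v = metricForm g ((extChartAt (𝓡 m) P).symm y)
      (chartSymmDeriv P y u) (chartSymmDeriv P y v) := rfl

lemma chartSymmDeriv_isInvertible (hy : y ∈ (extChartAt (𝓡 m) P).target) :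
    (chartSymmDeriv P y).IsInvertible := by
  have h := isInvertible_mfderivWithin_extChartAt_symm (I := 𝓡 m) hy
  rw [ModelWithCorners.range_eq_univ, mfderivWithin_univ] at h
  exact h

lemma chartSymmDeriv_self (P : M) :
    chartSymmDeriv P (extChartAt (𝓡 m) P P) = ContinuousLinearMap.id ℝ _ := by
  have h := mfderivWithin_range_extChartAt_symm (I := 𝓡 m) (x := P)
  rw [ModelWithCorners.range_eq_univ, mfderivWithin_univ] at h
  exact h

/-- The coordinate vector fields of the preferred chart are smooth sections of the tangent bundle. -/
lemma contMDiffAt_chartSymmDeriv (hy : y ∈ (extChartAt (𝓡 m) P).target)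
    (u : EuclideanSpace ℝ (Fin m)) :
    ContMDiffAt 𝓘(ℝ, EuclideanSpace ℝ (Fin m)) ((𝓡 m).prod 𝓘(ℝ, EuclideanSpace ℝ (Fin m))) ∞
      (fun z => Bundle.TotalSpace.mk' (EuclideanSpace ℝ (Fin m))
        (E := fun x : M => TangentSpace (𝓡 m) x) ((extChartAt (𝓡 m) P).symm z)
        (chartSymmDeriv P z u)) y := by
  have htn : (extChartAt (𝓡 m) P).target ∈ 𝓝 y := (isOpen_extChartAt_target P).mem_nhds hy
  have hmem : ∀ z ∈ (extChartAt (𝓡 m) P).target,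
      (extChartAt (𝓡 m) P).symm z ∈ (chartAt (EuclideanSpace ℝ (Fin m)) P).source := fun z hz => by
    rw [← extChartAt_source (I := 𝓡 m)]
    exact (extChartAt (𝓡 m) P).map_target hz
  have hbase : ∀ z ∈ (extChartAt (𝓡 m) P).target, (extChartAt (𝓡 m) P).symm z ∈
      (trivializationAt (EuclideanSpace ℝ (Fin m)) (fun x : M => TangentSpace (𝓡 m) x) P).baseSet :=
    fun z hz => by rw [TangentBundle.trivializationAt_baseSet]; exact hmem z hz
  refine ((trivializationAt (EuclideanSpace ℝ (Fin m)) (fun x : M => TangentSpace (𝓡 m) x)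
    P).contMDiffAt_iff ?_).2 ⟨?_, ?_⟩
  · rw [Bundle.Trivialization.mem_source]
    exact hbase y hy
  · exact (contMDiffOn_extChartAt_symm P).contMDiffAt htn
  · refine (contMDiffAt_const (c := u)).congr_of_eventuallyEq ?_
    filter_upwards [htn] with z hz
    have h1 := TangentBundle.symmL_trivializationAt (I := 𝓡 m) (𝕜 := ℝ) (hmem z hz)
    rw [ModelWithCorners.range_eq_univ, mfderivWithin_univ, (extChartAt (𝓡 m) P).right_inv hz] at h1
    have h2 : chartSymmDeriv P z u = (trivializationAt (EuclideanSpace ℝ (Fin m))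
      (fun x : M => TangentSpace (𝓡 m) x) P).symmL ℝ ((extChartAt (𝓡 m) P).symm z) u :=
      (DFunLike.congr_fun h1 u).symm
    rw [h2, Bundle.Trivialization.symmL_apply _ (hbase z hz)]
    exact congrArg Prod.snd (Bundle.Trivialization.apply_mk_symm _ (hbase z hz) u)

lemma contDiffAt_coordMetric_apply (g : Bundle.ContMDiffRiemannianMetric (𝓡 m) ∞
      (EuclideanSpace ℝ (Fin m)) (fun x : M => TangentSpace (𝓡 m) x))
    (hy : y ∈ (extChartAt (𝓡 m) P).target) (u v : EuclideanSpace ℝ (Fin m)) :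
    ContDiffAt ℝ ∞ (fun y => coordMetric g P y u v) y := by
  have hφ : ContMDiffAt 𝓘(ℝ, EuclideanSpace ℝ (Fin m)) (𝓡 m) ∞ (extChartAt (𝓡 m) P).symm y :=
    (contMDiffOn_extChartAt_symm P).contMDiffAt ((isOpen_extChartAt_target P).mem_nhds hy)
  have h : ContMDiffAt 𝓘(ℝ, EuclideanSpace ℝ (Fin m)) ((𝓡 m).prod 𝓘(ℝ)) ∞
      (fun z => Bundle.TotalSpace.mk' ℝ (E := Bundle.Trivial M ℝ) ((extChartAt (𝓡 m) P).symm z)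
        (g.inner ((extChartAt (𝓡 m) P).symm z) (chartSymmDeriv P z u)
          (chartSymmDeriv P z v))) y := by
    apply ContMDiffAt.clm_bundle_apply₂ (F₁ := EuclideanSpace ℝ (Fin m))
      (F₂ := EuclideanSpace ℝ (Fin m))
    · exact ContMDiffAt.comp y g.contMDiff.contMDiffAt hφ
    · exact contMDiffAt_chartSymmDeriv hy u
    · exact contMDiffAt_chartSymmDeriv hy v
  simp only [Bundle.contMDiffAt_totalSpace] at h
  exact contMDiffAt_iff_contDiffAt.1 h.2

lemma isCoordMetric_coordMetric (g : Bundle.ContMDiffRiemannianMetric (𝓡 m) ∞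
      (EuclideanSpace ℝ (Fin m)) (fun x : M => TangentSpace (𝓡 m) x)) (P : M) :
    IsCoordMetric (coordMetric g P) (extChartAt (𝓡 m) P).target where
  isOpen := isOpen_extChartAt_target P
  contDiffOn := contDiffOn_clm_apply.2 fun u => contDiffOn_clm_apply.2 fun v => fun _ hy =>
    (contDiffAt_coordMetric_apply g hy u v).contDiffWithinAt
  symm y _ u v := by
    rw [coordMetric_apply, coordMetric_apply]
    exact g.symm ((extChartAt (𝓡 m) P).symm y) _ _
  pos y hy v hv := by
    rw [coordMetric_apply]
    refine g.pos ((extChartAt (𝓡 m) P).symm y) (chartSymmDeriv P y v) fun h => hv ?_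
    have h' : chartSymmDeriv P y v = 0 := h
    exact (chartSymmDeriv_isInvertible hy).injective (by rw [h', map_zero])

lemma contDiffOn_chartChange (P Q : M) :
    ContDiffOn ℝ ∞ (chartChange P Q) (chartOverlap (m := m) P Q) := by
  rw [← contMDiffOn_iff_contDiffOn]
  refine (contMDiffOn_extChartAt (x := Q)).comp
    ((contMDiffOn_extChartAt_symm P).mono fun y hy => hy.1) fun y hy => ?_
  rw [← extChartAt_source (I := 𝓡 m)]
  exact hy.2

lemma hasMFDerivAt_chartSymm (hy : y ∈ (extChartAt (𝓡 m) P).target) :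
    HasMFDerivAt 𝓘(ℝ, EuclideanSpace ℝ (Fin m)) (𝓡 m) (extChartAt (𝓡 m) P).symm y
      (chartSymmDeriv P y) :=
  (((contMDiffOn_extChartAt_symm (n := ∞) P).contMDiffAt
    ((isOpen_extChartAt_target P).mem_nhds hy)).mdifferentiableAt (by simp)).hasMFDerivAt

lemma chartSymmDeriv_chartChange (hy : y ∈ chartOverlap P Q) :
    (chartSymmDeriv Q (chartChange P Q y)).comp (fderiv ℝ (chartChange P Q) y) =
      chartSymmDeriv P y := by
  have hN := (isOpen_chartOverlap P Q).mem_nhds hy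
  have hψ : HasFDerivAt (chartChange P Q) (fderiv ℝ (chartChange P Q) y) y :=
    (((contDiffOn_chartChange P Q).contDiffAt hN).differentiableAt (by simp)).hasFDerivAt
  have h1 := (hasMFDerivAt_chartSymm (mapsTo_chartChange P Q hy)).comp y hψ.hasMFDerivAt
  have h2 : HasMFDerivAt 𝓘(ℝ, EuclideanSpace ℝ (Fin m)) (𝓡 m)
      ((extChartAt (𝓡 m) Q).symm ∘ chartChange P Q) y (chartSymmDeriv P y) :=
    (hasMFDerivAt_chartSymm hy.1).congr_of_eventuallyEq
      (by filter_upwards [hN] with z hz using chartSymm_chartChange hz)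
  exact hasMFDerivAt_unique h1 h2

lemma coordMetric_chartChange (hy : y ∈ chartOverlap P Q) (u v : EuclideanSpace ℝ (Fin m)) :
    coordMetric g P y u v = coordMetric g Q (chartChange P Q y)
      (fderiv ℝ (chartChange P Q) y u) (fderiv ℝ (chartChange P Q) y v) := by
  rw [coordMetric_apply, coordMetric_apply, chartSymm_chartChange hy,
    ← chartSymmDeriv_chartChange hy]
  rfl

end Charts

/-! ### Gram determinants -/

section Gram

variable {m : ℕ}

/-- The Gram matrix of a bilinear form with respect to the coordinate basis. -/
def gramMatrix (β : EuclideanSpace ℝ (Fin m) →L[ℝ] EuclideanSpace ℝ (Fin m) →L[ℝ] ℝ) :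
    Matrix (Fin m) (Fin m) ℝ :=
  Matrix.of fun i j => β (stdVec i) (stdVec j)

lemma bilin_eq_sum (β : EuclideanSpace ℝ (Fin m) →L[ℝ] EuclideanSpace ℝ (Fin m) →L[ℝ] ℝ)
    (a b : EuclideanSpace ℝ (Fin m)) :
    β a b = ∑ i, ∑ j, a i * b j * β (stdVec i) (stdVec j) := by
  have h : ∀ a : EuclideanSpace ℝ (Fin m), a = ∑ i, a i • stdVec i := fun a => by
    simpa [stdVec] using ((EuclideanSpace.basisFun (Fin m) ℝ).sum_repr a).symm
  conv_lhs => rw [h a, h b]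
  simp only [map_sum, map_smul, sum_apply, smul_apply, smul_eq_mul,
    Finset.mul_sum]
  rw [Finset.sum_comm]
  refine Finset.sum_congr rfl fun i _ => Finset.sum_congr rfl fun j _ => ?_
  ring

lemma det_gramMatrix_bilinearComp
    (β : EuclideanSpace ℝ (Fin m) →L[ℝ] EuclideanSpace ℝ (Fin m) →L[ℝ] ℝ)
    (T : EuclideanSpace ℝ (Fin m) →L[ℝ] EuclideanSpace ℝ (Fin m)) :
    (gramMatrix (β.bilinearComp T T)).det = T.det ^ 2 * (gramMatrix β).det := by
  have hA : T.det = (LinearMap.toMatrix (EuclideanSpace.basisFun (Fin m) ℝ).toBasis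
      (EuclideanSpace.basisFun (Fin m) ℝ).toBasis (T : _ →ₗ[ℝ] _)).det := by
    rw [LinearMap.det_toMatrix]
  set A := LinearMap.toMatrix (EuclideanSpace.basisFun (Fin m) ℝ).toBasis
      (EuclideanSpace.basisFun (Fin m) ℝ).toBasis (T : _ →ₗ[ℝ] _)
  have hT : ∀ i j, T (stdVec i) j = A j i := fun i j => by
    simp [A, LinearMap.toMatrix_apply, stdVec]
  have h : gramMatrix (β.bilinearComp T T) = A.transpose * gramMatrix β * A := by
    ext i j
    have h1 : gramMatrix (β.bilinearComp T T) i j = β (T (stdVec i)) (T (stdVec j)) := rfl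
    rw [h1, bilin_eq_sum]
    simp only [hT, Matrix.mul_apply, Matrix.transpose_apply, gramMatrix, Matrix.of_apply,
      Finset.sum_mul]
    rw [Finset.sum_comm]
    refine Finset.sum_congr rfl fun k _ => Finset.sum_congr rfl fun l _ => by ring
  rw [h, Matrix.det_mul, Matrix.det_mul, Matrix.det_transpose, hA]
  ring

lemma det_gramMatrix_pos {β : EuclideanSpace ℝ (Fin m) →L[ℝ] EuclideanSpace ℝ (Fin m) →L[ℝ] ℝ}
    (hs : ∀ a b, β a b = β b a) (hpos : ∀ a, a ≠ 0 → 0 < β a a) : 0 < (gramMatrix β).det := by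
  refine Matrix.PosDef.det_pos (Matrix.PosDef.of_dotProduct_mulVec_pos ?_ fun x hx => ?_)
  · ext i j
    simp [gramMatrix, hs (stdVec j)]
  · have h1 : WithLp.toLp 2 x ≠ (0 : EuclideanSpace ℝ (Fin m)) := fun h => hx (by
      simpa using congrArg WithLp.ofLp h)
    convert! hpos _ h1 using 1
    rw [bilin_eq_sum]
    simp only [dotProduct, Matrix.mulVec, gramMatrix, Matrix.of_apply, Finset.mul_sum, star_trivial]
    refine Finset.sum_congr rfl fun i _ => Finset.sum_congr rfl fun j _ => by ring

end Gram

/-! ### The volume density -/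

section Density

variable {m : ℕ} {M : Type*} [TopologicalSpace M] [ChartedSpace (EuclideanSpace ℝ (Fin m)) M]

/-- An endomorphism of `EuclideanSpace ℝ (Fin m)` as an endomorphism of the tangent space at `P`. -/
def tangentEnd (P : M) (S : EuclideanSpace ℝ (Fin m) →L[ℝ] EuclideanSpace ℝ (Fin m)) :
    Module.End ℝ (TangentSpace (𝓡 m) P) :=
  S.toLinearMap

lemma tangentEnd_mul (P : M) (S T : EuclideanSpace ℝ (Fin m) →L[ℝ] EuclideanSpace ℝ (Fin m)) :
    tangentEnd P S * tangentEnd P T = tangentEnd P (S * T) := rfl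

variable [IsManifold (𝓡 m) ∞ M]
  {g : Bundle.ContMDiffRiemannianMetric (𝓡 m) ∞ (EuclideanSpace ℝ (Fin m))
    (fun x : M => TangentSpace (𝓡 m) x)} {P Q : M}

/-- The volume density at `Q`, as a function on `EuclideanSpace ℝ (Fin m)`. -/
def densityAt (g : Bundle.ContMDiffRiemannianMetric (𝓡 m) ∞ (EuclideanSpace ℝ (Fin m))
      (fun x : M => TangentSpace (𝓡 m) x)) (Q : M) (ξ : EuclideanSpace ℝ (Fin m)) : ℝ :=
  density g Q ξ

/-- The density in terms of the derivative of the exponential map. -/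
lemma density_eq (ξ : EuclideanSpace ℝ (Fin m)) {y : M}
    {D : EuclideanSpace ℝ (Fin m) →L[ℝ] EuclideanSpace ℝ (Fin m)}
    (hy : riemannianExp g Q ξ = y)
    (hD : HasMFDerivAt (𝓡 m) (𝓡 m)
      (fun w : EuclideanSpace ℝ (Fin m) => riemannianExp g Q w) ξ D) :
    densityAt g Q ξ = √(gramMatrix ((metricForm g y).bilinearComp D D)).det /
      √(gramMatrix (metricForm g Q)).det := by
  subst hy
  obtain rfl : (mfderiv (𝓡 m) (𝓡 m)
      (fun w : EuclideanSpace ℝ (Fin m) => riemannianExp g Q w) ξ :) = D := hD.mfderiv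
  rfl

/-- The exponential map at `Q` in the preferred chart at `P`. -/
lemma eventually_riemannianExp (hQ : Q ∈ (extChartAt (𝓡 m) P).source) :
    ∀ᶠ w in 𝓝 (0 : EuclideanSpace ℝ (Fin m)),
      riemannianExp g Q (chartSymmDeriv P (extChartAt (𝓡 m) P Q) w) =
        (extChartAt (𝓡 m) P).symm
          (coordExp (coordMetric g P) (extChartAt (𝓡 m) P).target (extChartAt (𝓡 m) P Q) w) := by
  have hx : extChartAt (𝓡 m) P Q ∈ chartOverlap P Q := by
    refine ⟨(extChartAt (𝓡 m) P).map_source hQ, ?_⟩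
    rw [mem_preimage, (extChartAt (𝓡 m) P).left_inv hQ]
    exact mem_extChartAt_source Q
  have hψx : chartChange P Q (extChartAt (𝓡 m) P Q) = extChartAt (𝓡 m) Q Q := by
    rw [chartChange, (extChartAt (𝓡 m) P).left_inv hQ]
  have hL : fderiv ℝ (chartChange P Q) (extChartAt (𝓡 m) P Q) =
      chartSymmDeriv P (extChartAt (𝓡 m) P Q) := by
    rw [← chartSymmDeriv_chartChange hx, hψx, chartSymmDeriv_self, ContinuousLinearMap.id_comp]
  have hsub : chartOverlap P Q ⊆ (extChartAt (𝓡 m) P).target := inter_subset_left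
  have hG := isCoordMetric_coordMetric g P
  filter_upwards [(hG.mono (isOpen_chartOverlap P Q) hsub).eventually_coordExp_map hG hsub
    (isCoordMetric_coordMetric g Q) (contDiffOn_chartChange P Q) (mapsTo_chartChange P Q)
    (fun y hy u v => coordMetric_chartChange hy u v) hx] with w hw
  rw [← chartSymm_chartChange hw.1, ← hw.2, hψx, hL]
  rfl

/-- The volume density along a geodesic through `Q` is `det B`, where `t • B t` is the solution of
the Jacobi equation in a parallel frame. The point `Q` lies in the chart at `P`, in which the normal
form is computed. -/
lemma HasNormalForm.eventually_density_eq {R : ℝ → EuclideanSpace ℝ (Fin m) →L[ℝ]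
      EuclideanSpace ℝ (Fin m)} {w : EuclideanSpace ℝ (Fin m)}
    {p : EuclideanSpace ℝ (Fin m) →L[ℝ] EuclideanSpace ℝ (Fin m)} (hp : p.IsInvertible)
    (hQ : Q ∈ (extChartAt (𝓡 m) P).source)
    (h : HasNormalForm (coordMetric g P) (extChartAt (𝓡 m) P).target R
      (extChartAt (𝓡 m) P Q) w p) :
    ∃ B : ℝ → EuclideanSpace ℝ (Fin m) →L[ℝ] EuclideanSpace ℝ (Fin m),
      ContDiffAt ℝ ∞ B 0 ∧ B 0 = 1 ∧
      (∀ᶠ t in 𝓝 0, deriv (deriv fun t => t • B t) t = -(R t * (t • B t))) ∧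
      ∀ᶠ t in 𝓝 (0 : ℝ),
        densityAt g Q (t • chartSymmDeriv P (extChartAt (𝓡 m) P Q) w) = (B t).det := by
  obtain ⟨B, hB, hB0, hode, hV⟩ := h
  refine ⟨B, hB, hB0, hode, ?_⟩
  have hx : extChartAt (𝓡 m) P Q ∈ (extChartAt (𝓡 m) P).target :=
    (extChartAt (𝓡 m) P).map_source hQ
  set x := extChartAt (𝓡 m) P Q
  have hxQ : (extChartAt (𝓡 m) P).symm x = Q := (extChartAt (𝓡 m) P).left_inv hQ
  set L := chartSymmDeriv P x
  have hL : L.IsInvertible := chartSymmDeriv_isInvertible hx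
  have hexp := eventually_riemannianExp (g := g) hQ
  have hdet : ∀ᶠ t in 𝓝 (0 : ℝ), 0 < (B t).det := by
    have h1 : ContinuousAt (fun t => (B t).det) 0 := (contDiffAt_det hB).continuousAt
    refine h1.eventually (lt_mem_nhds ?_)
    simp only [hB0]
    simp [ContinuousLinearMap.det]
  have htw : Tendsto (fun t : ℝ => t • w) (𝓝 0) (𝓝 0) := by
    have h1 : Continuous fun t : ℝ => t • w := by fun_prop
    simpa using h1.tendsto 0
  filter_upwards [hV, hdet, htw.eventually hexp.eventually_nhds] with t ht htdet htexp
  obtain ⟨hyU, V, hVd, hVG⟩ := ht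
  set y := coordExp (coordMetric g P) (extChartAt (𝓡 m) P).target x (t • w)
  have hy : riemannianExp g Q (t • L w) = (extChartAt (𝓡 m) P).symm y := by
    rw [← map_smul]
    exact htexp.self_of_nhds
  obtain ⟨D, hDdef⟩ : ∃ D : EuclideanSpace ℝ (Fin m) →L[ℝ] EuclideanSpace ℝ (Fin m),
      D = (chartSymmDeriv P y).comp (V.comp L.inverse) := ⟨_, rfl⟩
  have hD : HasMFDerivAt (𝓡 m) (𝓡 m)
      (fun w : EuclideanSpace ℝ (Fin m) => riemannianExp g Q w) (t • L w) D := by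
    rw [hDdef]
    have hLinv : HasFDerivAt L.inverse L.inverse (t • L w) := L.inverse.hasFDerivAt
    have hLt : L.inverse (t • L w) = t • w := by rw [map_smul, hL.inverse_apply_self]
    have h1 : HasFDerivAt (fun u => coordExp (coordMetric g P) (extChartAt (𝓡 m) P).target x
        (L.inverse u)) (V.comp L.inverse) (t • L w) :=
      HasFDerivAt.comp (g := coordExp (coordMetric g P) (extChartAt (𝓡 m) P).target x)
        (t • L w) (by rwa [hLt]) hLinv
    have h2 : HasMFDerivAt 𝓘(ℝ, EuclideanSpace ℝ (Fin m)) (𝓡 m) (extChartAt (𝓡 m) P).symm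
        (coordExp (coordMetric g P) (extChartAt (𝓡 m) P).target x (L.inverse (t • L w)))
        (chartSymmDeriv P y) := by
      rw [hLt]
      exact hasMFDerivAt_chartSymm hyU
    refine (h2.comp (t • L w) h1.hasMFDerivAt).congr_of_eventuallyEq ?_
    have h3 : Tendsto L.inverse (𝓝 (t • L w)) (𝓝 (t • w)) := by
      have h4 := L.inverse.continuous.tendsto (t • L w)
      rwa [hLt] at h4
    filter_upwards [h3.eventually htexp] with u hu
    rw [hL.self_apply_inverse] at hu
    exact hu
  rw [density_eq _ hy hD]
  -- the Gram matrix at `y`, transported to `Q`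
  have hgram : gramMatrix ((metricForm g ((extChartAt (𝓡 m) P).symm y)).bilinearComp D D) =
      gramMatrix ((metricForm g Q).bilinearComp ((L.comp p).comp ((B t).comp (L.comp p).inverse))
        ((L.comp p).comp ((B t).comp (L.comp p).inverse))) := by
    ext i j
    have h1 := hVG (L.inverse (stdVec i)) (L.inverse (stdVec j))
    rw [coordMetric_apply, coordMetric_apply, hxQ] at h1
    rw [hDdef, hL.inverse_comp_of_left]
    exact h1
  have hconj : ((L.comp p).comp ((B t).comp (L.comp p).inverse)).det = (B t).det := by
    obtain ⟨e, he⟩ := hL.comp hp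
    rw [← he, ContinuousLinearMap.inverse_equiv]
    exact LinearMap.det_conj (B t : _ →ₗ[ℝ] _) e.toLinearEquiv
  have hpos : 0 < (gramMatrix (metricForm g Q)).det :=
    det_gramMatrix_pos (fun a b => g.symm Q a b) (fun a ha => g.pos Q a ha)
  rw [hgram, det_gramMatrix_bilinearComp, hconj, Real.sqrt_mul (sq_nonneg _),
    Real.sqrt_sq htdet.le, mul_div_assoc, div_self (Real.sqrt_pos.2 hpos).ne', mul_one]

/-- In a harmonic space the density is even near the origin. -/
lemma IsHarmonicSpace.eventually_density_neg (hg : IsHarmonicSpace g) (Q : M)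
    (v : EuclideanSpace ℝ (Fin m)) :
    ∀ᶠ t in 𝓝 (0 : ℝ), densityAt g Q ((-t) • v) = densityAt g Q (t • v) := by
  obtain ⟨ε, hε, f, hf⟩ := hg Q
  have h1 : Continuous fun t : ℝ => √(metricForm g Q (t • v) (t • v)) := by fun_prop
  have h2 : ∀ᶠ t in 𝓝 (0 : ℝ), √(metricForm g Q (t • v) (t • v)) < ε := by
    refine h1.continuousAt.eventually (gt_mem_nhds ?_)
    simpa using hε
  filter_upwards [h2] with t ht
  have h3 : metricForm g Q ((-t) • v) ((-t) • v) = metricForm g Q (t • v) (t • v) := by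
    simp
  have h4 : densityAt g Q (t • v) = _ := hf (t • v) ht
  have h5 : densityAt g Q ((-t) • v) = _ :=
    hf ((-t) • v) (lt_of_eq_of_lt (congrArg Real.sqrt h3) ht)
  rw [h4, h5]
  exact congrArg (fun r => f √r) h3

lemma jacobiOperator_eq {k : ℕ} {ξ : EuclideanSpace ℝ (Fin m)}
    {S : EuclideanSpace ℝ (Fin m) →L[ℝ] EuclideanSpace ℝ (Fin m)}
    (hS : ∀ η, S η = iterCovDerivCurvature (coordMetric g P) k (extChartAt (𝓡 m) P P)
      (fun i => if i.val = 0 then η else ξ)) :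
    jacobiOperator g k P ξ = tangentEnd P S := by
  refine (EuclideanSpace.basisFun (Fin m) ℝ).toBasis.ext fun j => ?_
  refine (Module.Basis.constr_basis (M' := TangentSpace (𝓡 m) P) _ ℝ _ j).trans ?_
  have h := hS (stdVec j)
  exact h.symm.trans (congrArg S (by simp [stdVec]))

end Density

end HarmonicSpace

end

theorem theorem1p4 {m : ℕ} {M : Type*} [TopologicalSpace M]
    [ChartedSpace (EuclideanSpace ℝ (Fin m)) M] [IsManifold (𝓡 m) ∞ M]
    (g : Bundle.ContMDiffRiemannianMetric (𝓡 m) ∞ (EuclideanSpace ℝ (Fin m))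
      (fun x : M => TangentSpace (𝓡 m) x))
    (hg : HarmonicSpace.IsHarmonicSpace g) (P : M) (ξ : TangentSpace (𝓡 m) P)
    (H : ℕ → ℝ) (hH : ∀ k : ℕ, H k = HarmonicSpace.taylorTerm g k P ξ)
    (J : ℕ → Module.End ℝ (TangentSpace (𝓡 m) P))
    (hJ : ∀ k : ℕ, J k = HarmonicSpace.jacobiOperator g k P ξ) :
    ContDiffAt ℝ ∞ (fun t : ℝ => HarmonicSpace.density g P (t • ξ)) 0 ∧
    (∀ k : ℕ, H (2 * k + 1) = 0) ∧
    H 2 = -(1 / 6) * HarmonicSpace.Tr (J 0) ∧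
    H 4 = 1 / 72 * HarmonicSpace.Tr (J 0) ^ 2 - 1 / 180 * HarmonicSpace.Tr (J 0 ^ 2) ∧
    H 6 = -(HarmonicSpace.Tr (J 0) ^ 3 / 1296) + HarmonicSpace.Tr (J 0) * HarmonicSpace.Tr (J 0 ^ 2) / 1080 - HarmonicSpace.Tr (J 0 ^ 3) / 2835
      + HarmonicSpace.Tr (J 1 ^ 2) / 10080 ∧
    H 8 = HarmonicSpace.Tr (J 0) ^ 4 / 31104 - HarmonicSpace.Tr (J 0) ^ 2 * HarmonicSpace.Tr (J 0 ^ 2) / 12960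
      + HarmonicSpace.Tr (J 0) * HarmonicSpace.Tr (J 0 ^ 3) / 17010 - HarmonicSpace.Tr (J 0) * HarmonicSpace.Tr (J 1 ^ 2) / 60480
      + HarmonicSpace.Tr (J 0 ^ 2) ^ 2 / 64800 - HarmonicSpace.Tr (J 0 ^ 4) / 37800
      - HarmonicSpace.Tr (J 0 ^ 2 * J 2) / 340200 + HarmonicSpace.Tr (J 0 * J 1 ^ 2) / 54432
      - HarmonicSpace.Tr (J 2 ^ 2) / 907200 := by
  obtain ⟨R, hR, hRJ, hN, hNs⟩ := (HarmonicSpace.isCoordMetric_coordMetric g P).exists_normalForms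
    (mem_extChartAt_target P) ξ
  obtain ⟨B, hB, hB0, hode, hBd⟩ := hN.eventually_density_eq ⟨ContinuousLinearEquiv.refl ℝ _, rfl⟩
    (mem_extChartAt_source P)
  rw [HarmonicSpace.chartSymmDeriv_self] at hBd
  have hdens : (fun t : ℝ => HarmonicSpace.density g P (t • ξ)) =ᶠ[nhds 0] fun t => (B t).det := hBd
  have hHf : ∀ n, H n = HarmonicSpace.taylorCoeff n fun t => (B t).det := fun n => by
    rw [hH, ← HarmonicSpace.taylorCoeff_congr hdens, HarmonicSpace.taylorTerm,
      HarmonicSpace.taylorCoeff, smul_eq_mul, div_eq_inv_mul]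
  let X : ℕ → EuclideanSpace ℝ (Fin m) →L[ℝ] EuclideanSpace ℝ (Fin m) := fun k =>
    iteratedDeriv k R 0
  have hJX : ∀ k, J k = HarmonicSpace.tangentEnd P (X k) := fun k =>
    (hJ k).trans (HarmonicSpace.jacobiOperator_eq (hRJ k))
  have hsq : ∀ k, J k ^ 2 = HarmonicSpace.tangentEnd P (X k * X k) := fun k => by
    rw [pow_two, hJX, HarmonicSpace.tangentEnd_mul]
  have hcube : J 0 ^ 3 = HarmonicSpace.tangentEnd P (X 0 * (X 0 * X 0)) := by
    rw [pow_succ', hsq, hJX, HarmonicSpace.tangentEnd_mul]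
  have hfourth : J 0 ^ 4 = HarmonicSpace.tangentEnd P (X 0 * (X 0 * (X 0 * X 0))) := by
    rw [pow_succ', hcube, hJX, HarmonicSpace.tangentEnd_mul]
  have h02 : J 0 ^ 2 * J 2 = HarmonicSpace.tangentEnd P (X 0 * (X 0 * X 2)) := by
    rw [hsq, hJX, HarmonicSpace.tangentEnd_mul, mul_assoc]
  have h011 : J 0 * J 1 ^ 2 = HarmonicSpace.tangentEnd P (X 0 * (X 1 * X 1)) := by
    rw [hsq, hJX, HarmonicSpace.tangentEnd_mul]
  -- the density is even along geodesics through every point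
  have heven : ∀ᶠ s in nhds 0, ∃ B : ℝ → EuclideanSpace ℝ (Fin m) →L[ℝ] EuclideanSpace ℝ (Fin m),
      ContDiffAt ℝ ∞ B 0 ∧ B 0 = 1 ∧
      (∀ᶠ t in nhds 0, deriv (deriv fun t => t • B t) t = -(R (s + t) * (t • B t))) ∧
      ∀ᶠ t in nhds 0, (B (-t)).det = (B t).det := by
    filter_upwards [hNs] with s hs
    obtain ⟨y, hy, w, p, hp, hNs⟩ := hs
    rw [← (extChartAt (𝓡 m) P).right_inv hy] at hNs
    obtain ⟨B, hB, hB0, hode, hBd⟩ := hNs.eventually_density_eq hp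
      ((extChartAt (𝓡 m) P).map_target hy)
    refine ⟨B, hB, hB0, hode, ?_⟩
    have hneg : Filter.Tendsto (fun t : ℝ => -t) (nhds 0) (nhds 0) := by
      simpa using (continuous_neg.tendsto (0 : ℝ))
    filter_upwards [hBd, hneg.eventually hBd, hg.eventually_density_neg _ _] with t h1 h2 h3
    rw [← h1, ← h2, h3]
  have hoddB : ∀ᶠ t in nhds 0, (B (-t)).det = (B t).det := by
    have hneg : Filter.Tendsto (fun t : ℝ => -t) (nhds 0) (nhds 0) := by
      simpa using (continuous_neg.tendsto (0 : ℝ))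
    filter_upwards [hBd, hneg.eventually hBd, hg.eventually_density_neg _ _] with t h1 h2 h3
    rw [← h1, ← h2, h3]
  obtain ⟨h2, h4, h6, h8⟩ := HarmonicSpace.taylorCoeff_det_of_even hR heven hB hB0 hode hHf
    (X := X)
    (τ := fun T => LinearMap.trace ℝ _ (T : EuclideanSpace ℝ (Fin m) →ₗ[ℝ] _)) (fun _ => rfl)
    (fun _ => rfl)
  refine ⟨(HarmonicSpace.contDiffAt_det hB).congr_of_eventuallyEq hdens, fun k => ?_, ?_⟩
  · rw [hHf]
    exact HarmonicSpace.taylorCoeff_eq_zero_of_even hoddB (odd_two_mul_add_one k)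
  · rw [h02, h011, hcube, hfourth, hsq 0, hsq 1, hsq 2, hJX 0]
    exact ⟨h2, h4, h6, h8⟩
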